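/- Let $N\ge 1$, $0<s<1$, $T>0$, let $\alpha,c\in\mathbb R$, $b>0$, and let $\Omega\subset\mathbb R^N$ be a non-empty bounded open set. Put $C_{N,s}=\frac{s2^{2s}\Gamma(\frac{2s+N}{2})}{\pi^{N/2}\Gamma(1-s)}$. Let $W^{s,2}(\mathbb R^N)$ be the space of all $u\in L^2(\mathbb R^N)$ with $\int_{\mathbb R^N}\int_{\mathbb R^N}\frac{|u(x)-u(y)|^2}{|x-y|^{N+2s}}\,dx\,dy<\infty$, with its usual norm, let $W_0^{s,2}(\overline\Omega)=\{u\in W^{s,2}(\mathbb R^N): u=0\text{ a.e. in }\mathbb R^N\setminus\Omega\}$, and let $W^{-s,2}(\overline\Omega)$ be the dual of $W_0^{s,2}(\overline\Omega)$, with duality pairing $\langle\cdot,\cdot\rangle$ and with $L^2(\Omega)\to W^{-s,2}(\overline\Omega)$, $f\mapsto(w\mapsto (f,w)_{L^2(\Omega)})$. For $f\in W^{s,2}(\mathbb R^N)$ and $w\in W^{s,2}_0(\overline\Omega)$ put $$\langle(-\Delta)^sf,w\rangle=\mathcal F(f,w):=\frac{C_{N,s}}2\int_{\mathbb R^N}\int_{\mathbb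 R^N}\frac{(f(x)-f(y))(w(x)-w(y))}{|x-y|^{N+2s}}\,dx\,dy .$$ Let $(-\Delta)_D^s$ be the operator in $L^2(\Omega)$ associated with the form $\mathcal F$ on $W_0^{s,2}(\overline\Omega)$, and for $x\in\mathbb R^N\setminus\overline\Omega$ let $\mathcal N_su(x)=C_{N,s}\int_\Omega\frac{u(x)-u(y)}{|x-y|^{N+2s}}\,dy$. Let $(u_0,u_1,u_2)\in W_0^{s,2}(\overline\Omega)\times W_0^{s,2}(\overline\Omega)\times L^2(\Omega)$ and $g\in\mathcal D((\mathbb R^N\setminus\Omega)\times(0,T))$, i.e. $g\in C_c^\infty(\mathbb R^N\times\mathbb R)$ with support contained in $(\mathbb R^N\setminus\Omega)\times(0,T)$. Consider $$\begin{cases}u_{ttt}+\alpha u_{tt}+c^2(-\Delta)^su+b(-\Delta)^su_t=0&\text{in }\Omega\times(0,T),\\ u=g&\text{in }(\mathbb R^N\setminus\Omega)\times(0,T),\\ u(\cdot,0)=u_0,\ u_t(\cdot,0)=u_1,\ u_{tt}(\cdot,0)=u_2&\text{in }\Omega.\end{cases}$$ A weak solution is a triple $(u,u_t,u_{tt})$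 with $u|_\Omega\in C([0,T];L^2(\Omega))\cap C^2([0,T];W^{-s,2}(\overline\Omega))$ and $u_{ttt}\in C((0,T);W^{-s,2}(\overline\Omega))$ (time derivatives are taken in $W^{-s,2}(\overline\Omega)$), which satisfies the initial conditions, satisfies $u(\cdot,t)=g(\cdot,t)$ a.e. in $\mathbb R^N\setminus\Omega$ for every $t\in(0,T)$, and satisfies the following: for a.e. $t\in(0,T)$ the function $c^2u+bu_t$ (extended by $c^2g+bg_t$ to $\mathbb R^N\setminus\Omega$) belongs to $W^{s,2}(\mathbb R^N)$, and for every $w\in W^{s,2}_0(\overline\Omega)$ and a.e. $t\in(0,T)$ $$\langle u_{ttt}+\alpha u_{tt},w\rangle+\langle(-\Delta)^s(c^2u+bu_t),w\rangle=0 .$$ Then there is an orthonormal basis of $L^2(\Omega)$ that consists of eigenfunctions $(\varphi_n)_{n\ge1}$ of $(-\Delta)_D^s$ with non-decreasing eigenvalues $(\lambda_n)_{n\ge1}$; the system has a unique weak solution $(u,u_t,u_{tt})$; and for every such basis and every $t\in[0,T]$ $$u(\cdot,t)=\sum_{n=1}^\infty\Big(A_n(t)u_{0,n}+B_n(t)u_{1,n}+C_n(t)u_{2,n}\Big)\varphi_n+\sum_{n=1}^\infty\Big(\int_0^t\big(g(\cdot,\tau),\mathcal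 N_s\varphi_n\big)_{\mathbb R^N\setminus\Omega}\frac1{\lambda_n}\big(C_n'''(t-\tau)+\alpha C_n''(t-\tau)\big)d\tau\Big)\varphi_n\quad\text{in }\Omega,$$ where both series converge in $L^2(\Omega)$, $u_{j,n}=(u_j,\varphi_n)_{L^2(\Omega)}$, $(g,h)_{\mathbb R^N\setminus\Omega}=\int_{\mathbb R^N\setminus\Omega}gh\,dx$, and $A_n,B_n,C_n$ are as follows. If the cubic $z^3+\alpha z^2+\lambda_nb\,z+\lambda_nc^2=0$ has three distinct roots $\lambda_{n,1},\lambda_{n,2},\lambda_{n,3}\in\mathbb C$, then, with $\xi_{n,1}=(\lambda_{n,1}-\lambda_{n,2})(\lambda_{n,1}-\lambda_{n,3})$, $\xi_{n,2}=(\lambda_{n,1}-\lambda_{n,2})(\lambda_{n,2}-\lambda_{n,3})$, $\xi_{n,3}=(\lambda_{n,1}-\lambda_{n,3})(\lambda_{n,2}-\lambda_{n,3})$, $$A_n(t)=\frac{\lambda_{n,2}\lambda_{n,3}}{\xi_{n,1}}e^{\lambda_{n,1}t}-\frac{\lambda_{n,1}\lambda_{n,3}}{\xi_{n,2}}e^{\lambda_{n,2}t}+\frac{\lambda_{n,1}\lambda_{n,2}}{\xi_{n,3}}e^{\lambda_{n,3}t},$$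 $$B_n(t)=-\frac{\lambda_{n,2}+\lambda_{n,3}}{\xi_{n,1}}e^{\lambda_{n,1}t}+\frac{\lambda_{n,1}+\lambda_{n,3}}{\xi_{n,2}}e^{\lambda_{n,2}t}-\frac{\lambda_{n,1}+\lambda_{n,2}}{\xi_{n,3}}e^{\lambda_{n,3}t},$$ $$C_n(t)=\frac1{\xi_{n,1}}e^{\lambda_{n,1}t}-\frac1{\xi_{n,2}}e^{\lambda_{n,2}t}+\frac1{\xi_{n,3}}e^{\lambda_{n,3}t}.$$ If the cubic has a multiple root, then $A_n,B_n,C_n$ are the solutions of $y'''+\alpha y''+\lambda_nb\,y'+\lambda_nc^2y=0$ on $\mathbb R$ with $(y,y',y'')(0)=(1,0,0)$, $(0,1,0)$, $(0,0,1)$ respectively. -/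

import Mathlib

open MeasureTheory Set Filter Topology
open scoped ContDiff ENNReal

noncomputable section

namespace NonlocalMGT

/-- The Euclidean space `ℝ^N`. -/
abbrev E (N : ℕ) : Type := EuclideanSpace ℝ (Fin N)

/-- `L²(ℝ^N)`. -/
abbrev L2 (N : ℕ) : Type := Lp ℝ 2 (volume : Measure (E N))

/-- `L²(Ω)`. -/
abbrev L2On {N : ℕ} (Ω : Set (E N)) : Type := Lp ℝ 2 ((volume : Measure (E N)).restrict Ω)

/-- Restriction `L²(ℝ^N) → L²(Ω)`. -/
def restr {N : ℕ} (Ω : Set (E N)) : L2 N →L[ℝ] L2On Ω :=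
  LpToLpRestrictCLM (E N) ℝ ℝ volume 2 Ω

/-! ### Fractional Sobolev spaces -/

/-- The Gagliardo difference quotient `(u(x) - u(y)) / |x - y|^{N/2 + s}`. -/
def gagliardo {N : ℕ} (s : ℝ) (u : E N → ℝ) (p : E N × E N) : ℝ :=
  (u p.1 - u p.2) / ‖p.1 - p.2‖ ^ ((N : ℝ) / 2 + s)

/-- `L²(ℝ^N) × L²(ℝ^N × ℝ^N)` with its Hilbert norm. -/
abbrev Ambient (N : ℕ) : Type :=
  WithLp 2 (L2 N × Lp ℝ 2 (volume : Measure (E N × E N)))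

theorem gagliardo_congr {N : ℕ} (s : ℝ) {u v : E N → ℝ} (h : u =ᵐ[volume] v) :
    gagliardo s u =ᵐ[volume] gagliardo s v := by
  have h1 : ∀ᵐ p : E N × E N, u p.1 = v p.1 :=
    Measure.quasiMeasurePreserving_fst.ae_eq_comp h
  have h2 : ∀ᵐ p : E N × E N, u p.2 = v p.2 :=
    Measure.quasiMeasurePreserving_snd.ae_eq_comp h
  filter_upwards [h1, h2] with p hp1 hp2
  simp only [gagliardo, hp1, hp2]

/-- The fractional Sobolev space `W^{s,2}(ℝ^N)`: all `u ∈ L²(ℝ^N)` whose Gagliardo quotient is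
square integrable on `ℝ^N × ℝ^N`.  Such a `u` is stored together with the class of its Gagliardo
quotient, so that the norm inherited from the ambient space is
`‖u‖² = ∫ |u|² + ∫∫ |u(x) - u(y)|² / |x - y|^{N + 2s}`. -/
def sobolev (N : ℕ) (s : ℝ) : Submodule ℝ (Ambient N) where
  carrier := {p | (p.snd : E N × E N → ℝ) =ᵐ[volume] gagliardo s (p.fst : E N → ℝ)}
  zero_mem' := by
    have h := gagliardo_congr s (Lp.coeFn_zero ℝ 2 (volume : Measure (E N)))
    have h' := Lp.coeFn_zero ℝ 2 (volume : Measure (E N × E N))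
    simp only [mem_ofPred_eq, WithLp.zero_fst, WithLp.zero_snd]
    filter_upwards [h, h'] with p hp hp'
    rw [hp, hp']
    simp [gagliardo]
  add_mem' := by
    intro a b ha hb
    simp only [mem_ofPred_eq, WithLp.add_fst, WithLp.add_snd] at ha hb ⊢
    filter_upwards [ha, hb, Lp.coeFn_add a.snd b.snd,
      gagliardo_congr s (Lp.coeFn_add a.fst b.fst)] with p h1 h2 h3 h4
    rw [h3, h4, Pi.add_apply, h1, h2]
    simp only [gagliardo, Pi.add_apply]
    ring
  smul_mem' := by
    intro c a ha
    simp only [mem_ofPred_eq, WithLp.smul_fst, WithLp.smul_snd] at ha ⊢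
    filter_upwards [ha, Lp.coeFn_smul c a.snd,
      gagliardo_congr s (Lp.coeFn_smul c a.fst)] with p h1 h2 h3
    rw [h2, h3, Pi.smul_apply, h1]
    simp only [gagliardo, Pi.smul_apply, smul_eq_mul]
    ring

/-- The functions of `L²(ℝ^N)` that vanish almost everywhere outside `Ω`. -/
def vanishOutside {N : ℕ} (Ω : Set (E N)) : Submodule ℝ (L2 N) where
  carrier := {u | ∀ᵐ x, x ∉ Ω → u x = 0}
  zero_mem' := by
    filter_upwards [Lp.coeFn_zero ℝ 2 (volume : Measure (E N))] with x hx _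
    rw [hx, Pi.zero_apply]
  add_mem' := by
    intro a b ha hb
    simp only [mem_ofPred_eq] at ha hb ⊢
    filter_upwards [ha, hb, Lp.coeFn_add a b] with x h1 h2 h3 hx
    rw [h3, Pi.add_apply, h1 hx, h2 hx, add_zero]
  smul_mem' := by
    intro c a ha
    simp only [mem_ofPred_eq] at ha ⊢
    filter_upwards [ha, Lp.coeFn_smul c a] with x h1 h2 hx
    rw [h2, Pi.smul_apply, h1 hx, smul_zero]

/-- The energy space `W₀^{s,2}(Ω̄) = {u ∈ W^{s,2}(ℝ^N) : u = 0 in ℝ^N ∖ Ω}`. -/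
def sobolevZero {N : ℕ} (s : ℝ) (Ω : Set (E N)) : Submodule ℝ (Ambient N) :=
  sobolev N s ⊓ (vanishOutside Ω).comap (WithLp.fstₗ 2 ℝ (L2 N) _)

/-- The dual space `W^{-s,2}(Ω̄)` of the energy space, with the dual norm. -/
abbrev NegSobolev {N : ℕ} (s : ℝ) (Ω : Set (E N)) : Type := StrongDual ℝ (sobolevZero s Ω)

/-- The restriction to `Ω` of an element of the energy space, `W₀^{s,2}(Ω̄) → L²(Ω)`. -/
def toL2 {N : ℕ} (s : ℝ) (Ω : Set (E N)) : sobolevZero s Ω →L[ℝ] L2On Ω :=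
  restr Ω ∘L WithLp.fstL 2 ℝ (L2 N) _ ∘L (sobolevZero s Ω).subtypeL

/-- The canonical map `L²(Ω) → W^{-s,2}(Ω̄)`, `f ↦ (w ↦ (f, w)_{L²(Ω)})`. -/
def toNeg {N : ℕ} (s : ℝ) (Ω : Set (E N)) (f : L2On Ω) : NegSobolev s Ω :=
  innerSL ℝ f ∘L toL2 s Ω

/-! ### The fractional Laplacian -/

/-- The normalization constant `C_{N,s}` of the fractional Laplacian. -/
def fracConst (N : ℕ) (s : ℝ) : ℝ :=
  s * 2 ^ (2 * s) * Real.Gamma ((2 * s + N) / 2) / (Real.pi ^ ((N : ℝ) / 2) * Real.Gamma (1 - s))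

/-- `(C_{N,s}/2) ∫∫ (u(x) - u(y)) (v(x) - v(y)) / |x - y|^{N + 2s} dx dy`.  For
`u ∈ W^{s,2}(ℝ^N)` and `v ∈ W₀^{s,2}(Ω̄)` this is the duality pairing of
`(-Δ)^s u ∈ W^{-s,2}(Ω̄)` with `v`. -/
def fracForm {N : ℕ} (s : ℝ) (u v : Ambient N) : ℝ :=
  fracConst N s / 2 * ∫ p : E N × E N,
    (u.fst p.1 - u.fst p.2) * (v.fst p.1 - v.fst p.2) / ‖p.1 - p.2‖ ^ ((N : ℝ) + 2 * s)

/-- The nonlocal normal derivative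
`𝒩_s u(x) = C_{N,s} ∫_Ω (u(x) - u(y)) / |x - y|^{N + 2s} dy`. -/
def normalDeriv {N : ℕ} (s : ℝ) (Ω : Set (E N)) (u : E N → ℝ) (x : E N) : ℝ :=
  fracConst N s * ∫ y in Ω, (u x - u y) / ‖x - y‖ ^ ((N : ℝ) + 2 * s)

/-- The graph of the Dirichlet realization `(-Δ)_D^s` in `L²(Ω)`: `u ∈ D((-Δ)_D^s)` and
`(-Δ)_D^s u = f`. -/
def IsDirichletFracLaplacian {N : ℕ} (s : ℝ) (Ω : Set (E N)) (u : sobolevZero s Ω)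
    (f : L2On Ω) : Prop :=
  ∀ v : sobolevZero s Ω, fracForm s (u : Ambient N) (v : Ambient N) = inner ℝ f (toL2 s Ω v)

/-- `(φ_n)` is an orthonormal basis of `L²(Ω)` of eigenfunctions of `(-Δ)_D^s`, with the
eigenvalues `(lam_n)` in nondecreasing order. -/
structure IsDirichletEigenbasis {N : ℕ} (s : ℝ) (Ω : Set (E N)) (φ : ℕ → sobolevZero s Ω)
    (lam : ℕ → ℝ) : Prop where
  orthonormal : Orthonormal ℝ (fun n => toL2 s Ω (φ n))
  total : (Submodule.span ℝ (range fun n => toL2 s Ω (φ n))).topologicalClosure = ⊤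
  eigen : ∀ n, IsDirichletFracLaplacian s Ω (φ n) (lam n • toL2 s Ω (φ n))
  mono : Monotone lam

/-! ### Weak solutions -/

/-- `(u, u_t, u_tt) = (u, u₁, u₂)` is a weak solution of
`u_ttt + α u_tt + c² (-Δ)^s u + b (-Δ)^s u_t = 0` in `Ω × (0,T)`, `u = g` in
`(ℝ^N ∖ Ω) × (0,T)`, with initial data `(d₀, d₁, d₂)` in `L²(Ω) × W^{-s,2}(Ω̄) × W^{-s,2}(Ω̄)`.
The curve `u` takes its values in `L²(ℝ^N)`; `u_t`, `u_tt` and `u_ttt` are the derivatives in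
`W^{-s,2}(Ω̄)` of the restriction of `u` to `Ω`. -/
structure IsWeakSolution {N : ℕ} (s : ℝ) (Ω : Set (E N)) (α b c T : ℝ) (g : E N × ℝ → ℝ)
    (d₀ : L2On Ω) (d₁ d₂ : NegSobolev s Ω)
    (u : ℝ → L2 N) (u₁ u₂ : ℝ → NegSobolev s Ω) : Prop where
  /-- `u ∈ C([0,T]; L²(Ω))` -/
  cont : ContinuousOn (fun t => restr Ω (u t)) (Icc 0 T)
  /-- `u ∈ C²([0,T]; W^{-s,2}(Ω̄))` -/
  deriv_one : ∀ t ∈ Icc 0 T,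
    HasDerivWithinAt (fun τ => toNeg s Ω (restr Ω (u τ))) (u₁ t) (Icc 0 T) t
  deriv_two : ∀ t ∈ Icc 0 T, HasDerivWithinAt u₁ (u₂ t) (Icc 0 T) t
  cont_two : ContinuousOn u₂ (Icc 0 T)
  /-- `u_ttt ∈ C((0,T); W^{-s,2}(Ω̄))`, and the variational identity.  The pairing
  `⟨(-Δ)^s (c² u + b u_t), w⟩` is meaningful when the function equal to `c² u + b u_t` in `Ω` and
  to `c² g + b g_t` in `ℝ^N ∖ Ω` belongs to `W^{s,2}(ℝ^N)`; this function is `f t`. -/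
  equation : ∃ (u₃ : ℝ → NegSobolev s Ω) (f : ℝ → sobolev N s),
    (∀ t ∈ Ioo 0 T, HasDerivAt u₂ (u₃ t) t) ∧
    ContinuousOn u₃ (Ioo 0 T) ∧
    (∀ᵐ t, t ∈ Ioo 0 T →
      toNeg s Ω (restr Ω (f t : Ambient N).fst)
          = c ^ 2 • toNeg s Ω (restr Ω (u t)) + b • u₁ t ∧
      ∀ᵐ x, x ∉ Ω →
        (f t : Ambient N).fst x = c ^ 2 * g (x, t) + b * deriv (fun τ => g (x, τ)) t) ∧
    ∀ w : sobolevZero s Ω, ∀ᵐ t, t ∈ Ioo 0 T →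
      (u₃ t + α • u₂ t) w + fracForm s (f t : Ambient N) (w : Ambient N) = 0
  /-- initial conditions -/
  init_zero : restr Ω (u 0) = d₀
  init_one : u₁ 0 = d₁
  init_two : u₂ 0 = d₂
  /-- exterior condition -/
  exterior : ∀ t ∈ Ioo 0 T, ∀ᵐ x, x ∉ Ω → u t x = g (x, t)

/-! ### The coefficients of the series -/

/-- `A(t)` for the characteristic roots `l₁, l₂, l₃`. -/
def coefA (l₁ l₂ l₃ : ℂ) (t : ℝ) : ℂ :=
  l₂ * l₃ / ((l₁ - l₂) * (l₁ - l₃)) * Complex.exp (l₁ * t)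
    - l₁ * l₃ / ((l₁ - l₂) * (l₂ - l₃)) * Complex.exp (l₂ * t)
    + l₁ * l₂ / ((l₁ - l₃) * (l₂ - l₃)) * Complex.exp (l₃ * t)

/-- `B(t)` for the characteristic roots `l₁, l₂, l₃`. -/
def coefB (l₁ l₂ l₃ : ℂ) (t : ℝ) : ℂ :=
  -((l₂ + l₃) / ((l₁ - l₂) * (l₁ - l₃))) * Complex.exp (l₁ * t)
    + (l₁ + l₃) / ((l₁ - l₂) * (l₂ - l₃)) * Complex.exp (l₂ * t)
    - (l₁ + l₂) / ((l₁ - l₃) * (l₂ - l₃)) * Complex.exp (l₃ * t)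

/-- `C(t)` for the characteristic roots `l₁, l₂, l₃`. -/
def coefC (l₁ l₂ l₃ : ℂ) (t : ℝ) : ℂ :=
  1 / ((l₁ - l₂) * (l₁ - l₃)) * Complex.exp (l₁ * t)
    - 1 / ((l₁ - l₂) * (l₂ - l₃)) * Complex.exp (l₂ * t)
    + 1 / ((l₁ - l₃) * (l₂ - l₃)) * Complex.exp (l₃ * t)

/-- `z` solves the cubic `z³ + α z² + (lam b) z + lam c² = 0`. -/
def IsCharRoot (α b c lam : ℝ) (z : ℂ) : Prop :=
  z ^ 3 + α * z ^ 2 + lam * b * z + lam * c ^ 2 = 0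

/-- `l₁, l₂, l₃` are pairwise distinct roots of the cubic. -/
def IsDistinctRoots (α b c lam : ℝ) (l₁ l₂ l₃ : ℂ) : Prop :=
  IsCharRoot α b c lam l₁ ∧ IsCharRoot α b c lam l₂ ∧ IsCharRoot α b c lam l₃ ∧
    l₁ ≠ l₂ ∧ l₁ ≠ l₃ ∧ l₂ ≠ l₃

/-- `y''' + α y'' + lam b y' + lam c² y = 0` on `ℝ` with `(y, y', y'')(0) = (y₀, y₁, y₂)`. -/
def IsModeSolution (α b c lam : ℝ) (y₀ y₁ y₂ : ℂ) (y : ℝ → ℂ) : Prop :=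
  ContDiff ℝ 3 y ∧
    (∀ t, iteratedDeriv 3 y t + α * iteratedDeriv 2 y t + lam * b * deriv y t
      + lam * c ^ 2 * y t = 0) ∧
    y 0 = y₀ ∧ deriv y 0 = y₁ ∧ iteratedDeriv 2 y 0 = y₂

/-- `A, B, C` are the coefficient functions of the eigenvalue `lam`: if the cubic has three
distinct roots, they are given by the explicit formulas.  If the cubic has a multiple root, where
the denominators of the formulas vanish, they are the solutions of the linear equation with that
characteristic polynomial and with the initial values that the formulas have, `(1,0,0)`, `(0,1,0)`
and `(0,0,1)`. -/
def IsCoefTriple (α b c lam : ℝ) (A B C : ℝ → ℂ) : Prop :=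
  (∃ l₁ l₂ l₃, IsDistinctRoots α b c lam l₁ l₂ l₃ ∧
    A = coefA l₁ l₂ l₃ ∧ B = coefB l₁ l₂ l₃ ∧ C = coefC l₁ l₂ l₃) ∨
  ((¬ ∃ l₁ l₂ l₃, IsDistinctRoots α b c lam l₁ l₂ l₃) ∧
    IsModeSolution α b c lam 1 0 0 A ∧ IsModeSolution α b c lam 0 1 0 B ∧
    IsModeSolution α b c lam 0 0 1 C)

/-- `f = ∑ a_n φ_n` with convergence in `L²(Ω)`. -/
def IsL2Series {N : ℕ} (s : ℝ) (Ω : Set (E N)) (φ : ℕ → sobolevZero s Ω) (a : ℕ → ℂ)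
    (f : L2On Ω) : Prop :=
  Tendsto (fun m : ℕ => eLpNorm
    (fun x => (f x : ℂ) - ∑ n ∈ Finset.range m, a n * ((φ n : Ambient N).fst x : ℂ)) 2
    ((volume : Measure (E N)).restrict Ω)) atTop (𝓝 0)

/-- `(g(·,τ), 𝒩_s φ)_{L²(ℝ^N ∖ Ω)}`. -/
def exteriorPairing {N : ℕ} (s : ℝ) (Ω : Set (E N)) (g : E N × ℝ → ℝ) (φ : sobolevZero s Ω)
    (τ : ℝ) : ℝ :=
  ∫ x in Ωᶜ, g (x, τ) * normalDeriv s Ω (φ : Ambient N).fst x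

/-- `∫₀ᵗ (g(·,τ), 𝒩_s φ)_{L²(ℝ^N ∖ Ω)} (1/lam) (C'''(t-τ) + α C''(t-τ)) dτ`. -/
def convCoef {N : ℕ} (s : ℝ) (Ω : Set (E N)) (α : ℝ) (g : E N × ℝ → ℝ) (φ : sobolevZero s Ω)
    (lam : ℝ) (C : ℝ → ℂ) (t : ℝ) : ℂ :=
  ∫ τ in (0 : ℝ)..t, (exteriorPairing s Ω g φ τ : ℂ) * (1 / lam) *
    (iteratedDeriv 3 C (t - τ) + α * iteratedDeriv 2 C (t - τ))

end NonlocalMGT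

end

open NonlocalMGT

open NonlocalMGT

/-! ### Eigenbases of compactly embedded coercive forms -/

/-! The problem is reduced to an evolution equation with zero exterior values, and this is solved
mode by mode in an eigenbasis of the Dirichlet form.

Eigenbasis. The form is coercive on the energy space (`exists_poincare`), and the embedding into
L²(Ω) is compact (`isCompactOperator_toL2`) and dense (`denseRange_toL2`). The Lax–Milgram solution
operator is therefore compact, symmetric and positive on L²(Ω), and the spectral theorem applies
(`exists_form_eigenbasis`).

Exterior data. As g vanishes on Ω, the function g(·,t) is its own lift to W^{s,2}(ℝ^N), and 𝓕(g, w)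
= -(S g, w) with S g(y) = C_{N,s} ∫_{ℝ^N∖Ω} g(x)/|x-y|^{N+2s} dx (`ExtBound.fracForm_eq`). The
support of g may touch ∂Ω, but a smooth function that is zero on the open set Ω vanishes to second
order at its points, with a uniform constant. Since min(1,|z|²)/|z|^{N+2s} is integrable for 0 < s <
1, S g is bounded on Ω, and t ↦ S g(·,t) is differentiable into L²(Ω). Writing u = U + g, with U
zero outside Ω, gives U''' + αU'' + A(c²U + bU') = S(c²g + bg_t), where A is the Dirichlet operator.

Existence. Each coefficient solves y''' + αy'' + λ_n(by' + c²y) = r_n. The energy bound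
`exists_energy_bound` has a constant independent of λ_n, so the eigenfunction series for U and U'
converge uniformly in the energy space and the one for U'' in L²(Ω)
(`FormEigenbasis.exists_evolution`).

Uniqueness and formula. Testing any weak solution with φ_n gives the same scalar equation, and
Duhamel's formula determines the coefficient (`IsWeakSolution.mode_formula`). The homogeneous part
is expressed by A_n, B_n, C_n. In the source part, (g, 𝒩_s φ_n) = -(S g, φ_n), the equation for C_n
replaces C_n''' + αC_n'' by -λ_n(bC_n' + c²C_n), and an integration by parts moves the derivative
from C_n to g (`convCoef_eq`). The first series taken alone is the solution with g = 0, so the two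
series converge separately. -/

theorem exists_equiv_nat_monotone {ι : Type*} [Infinite ι] (f : ι → ℝ)
    (hf : ∀ R, {i | f i ≤ R}.Finite) : ∃ e : ℕ ≃ ι, Monotone fun n => f (e n) := by
  classical
  have hc : Countable ι := by
    have h : (⋃ n : ℕ, {i | f i ≤ n}) = Set.univ := by
      ext i
      simpa using exists_nat_ge (f i)
    exact Set.countable_univ_iff.mp (h ▸ Set.countable_iUnion fun n => (hf n).countable)
  obtain ⟨code, hcode⟩ := hc.exists_injective_nat
  -- Ties of `f` are broken by an injective code. The initial segments of the resulting linear order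
  -- are finite and it has no largest element, so it is isomorphic to ℕ.
  let F : ι → ℝ ×ₗ ℕ := fun i => toLex (f i, code i)
  have hF : Function.Injective F := fun i k h => hcode (Prod.ext_iff.mp (toLex.injective h)).2
  let _ : LinearOrder ι := LinearOrder.lift' F hF
  have hle : ∀ {i k : ι}, i ≤ k → f i ≤ f k := by
    intro i k h
    have h' : F i ≤ F k := h
    rcases Prod.Lex.le_iff.mp h' with h1 | h1
    · exact h1.le
    · exact h1.1.le
  let _ : LocallyFiniteOrder ι := LocallyFiniteOrder.ofFiniteIcc fun i k =>
    (hf (f k)).subset fun x hx => hle hx.2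
  let _ : SuccOrder ι := LinearLocallyFiniteOrder.succOrder ι
  let _ : PredOrder ι := LinearLocallyFiniteOrder.predOrder ι
  have _ : NoMaxOrder ι := ⟨fun i => by
    by_contra! h
    exact Set.infinite_univ ((hf (f i)).subset fun x _ => hle (h x))⟩
  obtain ⟨i₀⟩ : Nonempty ι := inferInstance
  obtain ⟨m, hm, hmin⟩ := Set.exists_min_image {i | f i ≤ f i₀} id (hf _) ⟨i₀, le_refl (f i₀)⟩
  let _ : OrderBot ι :=
    { bot := m
      bot_le := fun x => by
        by_contra! h
        exact absurd (hmin x ((hle h.le).trans hm)) (not_le.mpr h) }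
  refine ⟨(orderIsoNatOfLinearSuccPredArch (ι := ι)).symm.toEquiv, fun a b hab => hle ?_⟩
  exact (orderIsoNatOfLinearSuccPredArch (ι := ι)).symm.monotone hab

/-! ### The spectral theorem for compact positive operators -/

section Spectral

variable {H : Type*} [NormedAddCommGroup H] [InnerProductSpace ℝ H]

/-- The images of two distinct such eigenvectors have squared distance μ² + μ'² ≥ 2ε², so an
infinite family of them would have no Cauchy subsequence of images. -/
theorem IsCompactOperator.finite_of_orthonormal_eigenvectors {S : H →L[ℝ] H}
    (hS : IsCompactOperator S) {ι : Type*} {e : ι → H} (he : Orthonormal ℝ e) {μ : ι → ℝ}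
    (hμ : ∀ i, S (e i) = μ i • e i) {ε : ℝ} (hε : 0 < ε) : {i | ε ≤ μ i}.Finite := by
  by_contra hinf
  have hinf' : Set.Infinite {i | ε ≤ μ i} := hinf
  let f : ℕ → ι := fun n => hinf'.natEmbedding _ n
  have hf : Function.Injective f := fun a b h =>
    (hinf'.natEmbedding _).injective (Subtype.ext h)
  have hfε : ∀ n, ε ≤ μ (f n) := fun n => (hinf'.natEmbedding _ n).2
  obtain ⟨K, hK, hKs⟩ := IsCompactOperator.image_closedBall_subset_compact (f := S.toLinearMap) hS 1
  have hmem : ∀ n, S (e (f n)) ∈ K := fun n => hKs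
    ⟨e (f n), by simp [he.1], rfl⟩
  obtain ⟨x, -, ψ, hψ, hlim⟩ := hK.tendsto_subseq hmem
  have hcau := hlim.cauchySeq
  obtain ⟨M, hM⟩ := Metric.cauchySeq_iff'.mp hcau ε hε
  have h1 := hM (M + 1) (by simp)
  have hne : f (ψ (M + 1)) ≠ f (ψ M) := fun h => by
    have := hψ.injective (hf h)
    omega
  have h2 : ‖S (e (f (ψ (M + 1)))) - S (e (f (ψ M)))‖ ^ 2
      = μ (f (ψ (M + 1))) ^ 2 + μ (f (ψ M)) ^ 2 := by
    rw [hμ, hμ, @norm_sub_sq ℝ, norm_smul, norm_smul, he.1, he.1, inner_smul_left,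
      inner_smul_right, he.2 hne]
    simp
  simp only [Function.comp_apply, dist_eq_norm] at h1
  have h3 := hfε (ψ (M + 1))
  have h4 := hfε (ψ M)
  have h5 := norm_nonneg (S (e (f (ψ (M + 1)))) - S (e (f (ψ M))))
  nlinarith

/-- Positivity excludes the eigenvalue 0, so all eigenspaces are finite-dimensional. Orthonormal
bases of them together form a total system, and compactness allows it to be listed with decreasing
eigenvalues. -/
theorem exists_orthonormal_eigenbasis [CompleteSpace H] {S : H →L[ℝ] H}
    (hS : IsCompactOperator S) (hsym : S.IsSymmetric) (hpos : ∀ x, x ≠ 0 → 0 < inner ℝ (S x) x)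
    (hdim : ¬ FiniteDimensional ℝ H) :
    ∃ (e : ℕ → H) (μ : ℕ → ℝ), Orthonormal ℝ e ∧
      (Submodule.span ℝ (range e)).topologicalClosure = ⊤ ∧
      (∀ n, 0 < μ n) ∧ (∀ n, S (e n) = μ n • e n) ∧ Antitone μ := by
  classical
  let G : ℝ → Submodule ℝ H := fun μ => Module.End.eigenspace (S : H →ₗ[ℝ] H) μ
  have hfin : ∀ μ, FiniteDimensional ℝ (G μ) := by
    intro μ
    by_cases h : μ = 0
    · have : G μ = ⊥ := by
        rw [Submodule.eq_bot_iff]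
        intro x hx
        by_contra hx0
        have h1 := Module.End.mem_eigenspace_iff.mp hx
        have h2 := hpos x hx0
        rw [ContinuousLinearMap.coe_coe] at h1
        rw [h1, h] at h2
        simp at h2
      rw [this]
      infer_instance
    · exact ContinuousLinearMap.finite_dimensional_eigenspace hS μ h
  -- Every real μ is admitted; those that are not eigenvalues contribute an empty fibre.
  let ι := Σ μ : ℝ, Fin (Module.finrank ℝ (G μ))
  let e : ι → H := fun i => (stdOrthonormalBasis ℝ (G i.1) i.2 : H)
  have he : Orthonormal ℝ e :=
    hsym.orthogonalFamily_eigenspaces.orthonormal_sigma_orthonormal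
      (v_family := fun μ => stdOrthonormalBasis ℝ (G μ))
      fun μ => (stdOrthonormalBasis ℝ (G μ)).orthonormal
  have heig : ∀ i : ι, S (e i) = i.1 • e i := fun i =>
    Module.End.mem_eigenspace_iff.mp (stdOrthonormalBasis ℝ (G i.1) i.2).2
  have hμ : ∀ i : ι, 0 < i.1 := by
    intro i
    have h := hpos (e i) (he.ne_zero i)
    rwa [heig, inner_smul_left, real_inner_self_eq_norm_sq, he.1, one_pow, mul_one] at h
  have hspan : (Submodule.span ℝ (range e)).topologicalClosure = ⊤ := by
    rw [Submodule.topologicalClosure_eq_top_iff, Submodule.eq_bot_iff]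
    intro x hx
    have hx' : x ∈ (⨆ μ, G μ)ᗮ := by
      rw [Submodule.mem_orthogonal]
      intro u hu
      refine Submodule.iSup_induction G (motive := fun u => inner ℝ u x = 0) hu ?_ (by simp) ?_
      · intro μ v hv
        have : v = ∑ k, inner ℝ ((stdOrthonormalBasis ℝ (G μ) k : H)) v • e ⟨μ, k⟩ := by
          have h := (stdOrthonormalBasis ℝ (G μ)).sum_repr' ⟨v, hv⟩
          have h' := congrArg (fun z : G μ => (z : H)) h
          simpa [e] using h'.symm
        rw [this, sum_inner]
        refine Finset.sum_eq_zero fun k _ => ?_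
        rw [inner_smul_left, (Submodule.mem_orthogonal _ _).mp hx _
          (Submodule.subset_span ⟨⟨μ, k⟩, rfl⟩), mul_zero]
      · intro v w hv hw
        rw [inner_add_left, hv, hw, add_zero]
    have := ContinuousLinearMap.orthogonalComplement_iSup_eigenspaces_eq_bot hS hsym
    exact (Submodule.mem_bot ℝ).mp (this ▸ hx')
  have hinf : Infinite ι := by
    by_contra h
    rw [not_infinite_iff_finite] at h
    apply hdim
    have hf : (range e).Finite := Set.finite_range e
    have : FiniteDimensional ℝ (Submodule.span ℝ (range e)) := FiniteDimensional.span_of_finite ℝ hf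
    have hc := (Submodule.span ℝ (range e)).closed_of_finiteDimensional
    rw [hc.submodule_topologicalClosure_eq] at hspan
    rw [hspan] at this
    exact Submodule.topEquiv.finiteDimensional
  obtain ⟨σ, hσ⟩ := exists_equiv_nat_monotone (fun i : ι => (i.1)⁻¹) (by
    intro R
    by_cases hR : 0 < R
    · refine (hS.finite_of_orthonormal_eigenvectors he heig (inv_pos.mpr hR)).subset ?_
      intro i hi
      exact inv_le_of_inv_le₀ (hμ i) hi
    · refine Set.finite_empty.subset fun i hi => ?_
      exact hR ((inv_pos.mpr (hμ i)).trans_le hi))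
  refine ⟨e ∘ σ, fun n => (σ n).1, he.comp σ σ.injective, ?_, fun n => hμ _, fun n => heig _, ?_⟩
  · rw [σ.surjective.range_comp]
    exact hspan
  · intro m n hmn
    exact (inv_le_inv₀ (hμ _) (hμ _)).mp (hσ hmn)

variable {V : Type*} [NormedAddCommGroup V] [InnerProductSpace ℝ V]

/-- A symmetric coercive form on a Hilbert space that embeds compactly and densely into an
infinite-dimensional Hilbert space has an eigenbasis. -/
theorem exists_form_eigenbasis [CompleteSpace H] [CompleteSpace V] {j : V →L[ℝ] H}
    (hj : IsCompactOperator j) (hd : DenseRange j)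
    (hdim : ¬ FiniteDimensional ℝ H) {a : V →L[ℝ] V →L[ℝ] ℝ} (hsym : ∀ v w, a v w = a w v)
    (hcoer : IsCoercive a) :
    ∃ (φ : ℕ → V) (lam : ℕ → ℝ), Orthonormal ℝ (fun n => j (φ n)) ∧
      (Submodule.span ℝ (range fun n => j (φ n))).topologicalClosure = ⊤ ∧
      (∀ n v, a (φ n) v = lam n * inner ℝ (j (φ n)) (j v)) ∧ Monotone lam := by
  -- The solution operator of Lax–Milgram: P f is the v with a(v, ·) = (f, j ·). An eigenvector e of
  -- j ∘ P for μ yields the eigenvector μ⁻¹ P e of the form for 1/μ, and j maps this vector to e.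
  let P : H →L[ℝ] V := hcoer.continuousLinearEquivOfBilin.symm.toContinuousLinearMap ∘L
    ContinuousLinearMap.adjoint j
  have hP : ∀ f v, a (P f) v = inner ℝ f (j v) := by
    intro f v
    rw [← hcoer.continuousLinearEquivOfBilin_apply]
    simp [P, ContinuousLinearMap.adjoint_inner_left]
  have hPinj : ∀ f, P f = 0 → f = 0 := by
    intro f hf
    have h : ∀ y, inner ℝ f y = 0 := by
      have hcl : IsClosed {y | inner ℝ f y = 0} :=
        isClosed_eq (continuous_const.inner continuous_id) continuous_const
      intro y
      refine hd.induction_on (p := fun y => inner ℝ f y = 0) y hcl fun v => ?_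
      rw [← hP, hf]
      simp
    exact inner_self_eq_zero.mp (h f)
  let S : H →L[ℝ] H := j ∘L P
  have hS : IsCompactOperator S := hj.comp_clm P
  have hSin : ∀ f g, inner ℝ (S f) g = a (P g) (P f) := by
    intro f g
    rw [hP, real_inner_comm]
    rfl
  have hSs : S.IsSymmetric := by
    intro f g
    show inner ℝ (S f) g = inner ℝ f (S g)
    rw [real_inner_comm (S g) f, hSin, hSin, hsym]
  obtain ⟨C, hC, hcoe⟩ := id hcoer
  have hpos : ∀ x, x ≠ 0 → 0 < inner ℝ (S x) x := by
    intro x hx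
    rw [hSin]
    have hn : 0 < ‖P x‖ := norm_pos_iff.mpr fun h => hx (hPinj x h)
    exact lt_of_lt_of_le (by positivity) (hcoe (P x))
  obtain ⟨e, μ, he, hsp, hμ, heig, hanti⟩ := exists_orthonormal_eigenbasis hS hSs hpos hdim
  have hje : ∀ n, j ((μ n)⁻¹ • P (e n)) = e n := by
    intro n
    rw [map_smul]
    have : j (P (e n)) = μ n • e n := heig n
    rw [this, smul_smul, inv_mul_cancel₀ (hμ n).ne', one_smul]
  refine ⟨fun n => (μ n)⁻¹ • P (e n), fun n => (μ n)⁻¹, ?_, ?_, ?_, ?_⟩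
  · simpa only [hje] using he
  · simpa only [hje] using hsp
  · intro n v
    rw [hje, map_smul, smul_apply, hP, smul_eq_mul]
  · intro m n hmn
    exact inv_anti₀ (hμ n) (hanti hmn)

end Spectral

/-! ### The third order scalar equation -/

/-- Variation of constants: Y(t) = e^{tM} (Y₀ + ∫₀ᵗ e^{-τM} R(τ) dτ). -/
theorem exists_hasDerivAt_linear {E : Type*} [NormedAddCommGroup E] [NormedSpace ℝ E]
    [CompleteSpace E] (M : E →L[ℝ] E) (Y₀ : E) {R : ℝ → E} (hR : Continuous R) :
    ∃ Y : ℝ → E, Y 0 = Y₀ ∧ ∀ t, HasDerivAt Y (M (Y t) + R t) t := by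
  let X : ℝ → (E →L[ℝ] E) := fun t => NormedSpace.exp (t • M)
  have hX : ∀ t, HasDerivAt X (M * X t) t := fun t => hasDerivAt_exp_smul_const' M t
  have hXc : Continuous X := continuous_iff_continuousAt.mpr fun t => (hX t).continuousAt
  have hinv : ∀ t, X t * X (-t) = 1 := by
    intro t
    have h := NormedSpace.exp_add_of_commute_of_mem_ball (𝕂 := ℝ) (x := t • M) (y := (-t) • M)
      ((Commute.refl M).smul_left t |>.smul_right (-t))
      ((NormedSpace.expSeries_radius_eq_top ℝ (E →L[ℝ] E)).symm ▸ edist_lt_top _ _)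
      ((NormedSpace.expSeries_radius_eq_top ℝ (E →L[ℝ] E)).symm ▸ edist_lt_top _ _)
    rw [← add_smul, add_neg_cancel, zero_smul, NormedSpace.exp_zero] at h
    exact h.symm
  let I : ℝ → E := fun t => Y₀ + ∫ τ in (0 : ℝ)..t, X (-τ) (R τ)
  have hic : Continuous fun τ => X (-τ) (R τ) := (hXc.comp continuous_neg).clm_apply hR
  have hI : ∀ t, HasDerivAt I (X (-t) (R t)) t := fun t =>
    (intervalIntegral.integral_hasDerivAt_right (hic.intervalIntegrable _ _)
      (hic.stronglyMeasurableAtFilter _ _) hic.continuousAt).const_add Y₀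
  refine ⟨fun t => X t (I t), ?_, fun t => ?_⟩
  · simp [X, I]
  · have h := (hX t).clm_apply (hI t)
    have h2 : X t (X (-t) (R t)) = R t := by
      have := congrArg (fun L : E →L[ℝ] E => L (R t)) (hinv t)
      simpa using this
    rw [h2] at h
    exact h

theorem exists_cubic_mode (α b c lam y₀ y₁ y₂ : ℝ) {r : ℝ → ℝ} (hr : Continuous r) :
    ∃ y y' y'' : ℝ → ℝ, (∀ t, HasDerivAt y (y' t) t) ∧ (∀ t, HasDerivAt y' (y'' t) t) ∧
      (∀ t, HasDerivAt y'' (r t - α * y'' t - lam * (c ^ 2 * y t + b * y' t)) t) ∧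
      y 0 = y₀ ∧ y' 0 = y₁ ∧ y'' 0 = y₂ := by
  let p₁ : ℝ × ℝ × ℝ →L[ℝ] ℝ := ContinuousLinearMap.fst ℝ ℝ (ℝ × ℝ)
  let p₂ : ℝ × ℝ × ℝ →L[ℝ] ℝ := ContinuousLinearMap.fst ℝ ℝ ℝ ∘L ContinuousLinearMap.snd ℝ ℝ (ℝ × ℝ)
  let p₃ : ℝ × ℝ × ℝ →L[ℝ] ℝ := ContinuousLinearMap.snd ℝ ℝ ℝ ∘L ContinuousLinearMap.snd ℝ ℝ (ℝ × ℝ)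
  let M : ℝ × ℝ × ℝ →L[ℝ] ℝ × ℝ × ℝ :=
    p₂.prod (p₃.prod (-(α • p₃) - lam • (c ^ 2 • p₁ + b • p₂)))
  obtain ⟨Y, hY0, hY⟩ := exists_hasDerivAt_linear M (y₀, y₁, y₂)
    (R := fun t => (0, 0, r t)) (by fun_prop)
  refine ⟨fun t => (Y t).1, fun t => (Y t).2.1, fun t => (Y t).2.2, fun t => ?_, fun t => ?_,
    fun t => ?_, by simp [hY0], by simp [hY0], by simp [hY0]⟩
  · exact (p₁.hasFDerivAt.comp_hasDerivAt t (hY t)).congr_deriv (by simp [p₁, M, p₂, p₃])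
  · exact (p₂.hasFDerivAt.comp_hasDerivAt t (hY t)).congr_deriv (by simp [p₁, M, p₂, p₃])
  · refine (p₃.hasFDerivAt.comp_hasDerivAt t (hY t)).congr_deriv ?_
    simp [p₁, M, p₂, p₃]
    ring

/-- The energy estimate for the modes; the constant does not depend on `lam`. -/
theorem exists_energy_bound (α b c T : ℝ) (hb : 0 < b) (hT : 0 ≤ T) :
    ∃ K : ℝ, 0 ≤ K ∧ ∀ (lam : ℝ), 0 ≤ lam → ∀ (r y y' y'' : ℝ → ℝ), Continuous r →
      (∀ t, HasDerivAt y (y' t) t) → (∀ t, HasDerivAt y' (y'' t) t) →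
      (∀ t, HasDerivAt y'' (r t - α * y'' t - lam * (c ^ 2 * y t + b * y' t)) t) →
      ∀ t ∈ Icc 0 T, y'' t ^ 2 + lam * y' t ^ 2 + lam * y t ^ 2 ≤
        K * (y'' 0 ^ 2 + lam * y' 0 ^ 2 + lam * y 0 ^ 2 + ∫ τ in (0 : ℝ)..T, r τ ^ 2) := by
  -- Completing the square, by'² + 2c²yy' = (by' + 2c²y)²/(2b) + (b/2)y'² - (2c⁴/b)y². This κ
  -- compensates the negative term and leaves y² over.
  set κ : ℝ := 2 * c ^ 4 / b + 1 with hκ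
  have hκ1 : 1 ≤ κ := by
    have : 0 ≤ 2 * c ^ 4 / b := by positivity
    linarith
  set M : ℝ := (2 * |α| + 1) + 2 / b * (2 * c ^ 2 + κ) + κ with hM
  have hM0 : 0 ≤ M := by positivity
  -- The constants `q` and `D` compare the energy `En` below with y''² + lam y'² + lam y², from
  -- below and from above.
  set q : ℝ := min 1 (b / 2) with hq
  have hq0 : 0 < q := lt_min one_pos (by positivity)
  set D : ℝ := 1 + b + c ^ 2 + κ with hD
  have hD1 : 1 ≤ D := by have := sq_nonneg c; linarith
  refine ⟨q⁻¹ * (Real.exp (M * T) * D), by positivity, ?_⟩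
  intro lam hlam r y y' y'' hr h0 h1 h2 t ht
  have hrc : Continuous fun τ => r τ ^ 2 := hr.pow 2
  -- The derivative of y''² contains -2 lam y''(c²y + by'). The terms by'² and 2c²yy' are chosen so
  -- that their derivatives cancel it. What remains carries `lam` only as the weight of y'² and yy',
  -- so the growth rate `M` does not depend on `lam`.
  let En : ℝ → ℝ := fun t => y'' t ^ 2 + lam * (b * y' t ^ 2 + 2 * c ^ 2 * (y t * y' t)
    + κ * y t ^ 2)
  have hlow : ∀ t, y'' t ^ 2 + lam * (b / 2 * y' t ^ 2 + y t ^ 2) ≤ En t := by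
    intro t
    have : b / 2 * y' t ^ 2 + y t ^ 2 ≤ b * y' t ^ 2 + 2 * c ^ 2 * (y t * y' t) + κ * y t ^ 2 := by
      have h : 0 ≤ (b * y' t + 2 * c ^ 2 * y t) ^ 2 / (2 * b) := by positivity
      have h' : (b * y' t + 2 * c ^ 2 * y t) ^ 2 / (2 * b)
          = b / 2 * y' t ^ 2 + 2 * c ^ 2 * (y t * y' t) + 2 * c ^ 4 / b * y t ^ 2 := by
        field_simp
        ring
      rw [hκ]
      linarith
    have := mul_le_mul_of_nonneg_left this hlam
    simp only [En]
    linarith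
  have hup : ∀ t, En t ≤ D * (y'' t ^ 2 + lam * y' t ^ 2 + lam * y t ^ 2) := by
    intro t
    have h3 : b * y' t ^ 2 + 2 * c ^ 2 * (y t * y' t) + κ * y t ^ 2
        ≤ D * (y' t ^ 2 + y t ^ 2) := by
      have := mul_nonneg (sq_nonneg c) (sq_nonneg (y' t - y t))
      rw [hD]
      nlinarith [sq_nonneg (y' t), sq_nonneg (y t), mul_nonneg hb.le (sq_nonneg (y t)),
        mul_nonneg (zero_le_one.trans hκ1) (sq_nonneg (y' t))]
    have h4 := mul_le_mul_of_nonneg_left h3 hlam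
    have h5 := mul_le_mul_of_nonneg_right hD1 (sq_nonneg (y'' t))
    simp only [En]
    linarith
  let En' : ℝ → ℝ := fun t => 2 * y'' t * (r t - α * y'' t - lam * (c ^ 2 * y t + b * y' t))
    + lam * (b * (2 * y' t * y'' t) + 2 * c ^ 2 * (y' t * y' t + y t * y'' t)
      + κ * (2 * y t * y' t))
  have hEn : ∀ t, HasDerivAt En (En' t) t := by
    intro t
    have e2 := (h2 t).pow 2
    have e1 := (h1 t).pow 2
    have e0 := (h0 t).pow 2
    have e01 := (h0 t).mul (h1 t)
    have := e2.add ((((e1.const_mul b).add (e01.const_mul (2 * c ^ 2))).add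
      (e0.const_mul κ)).const_mul lam)
    refine this.congr_deriv ?_
    simp only [En']
    push_cast
    ring
  have hEn' : ∀ t, En' t ≤ M * En t + r t ^ 2 := by
    intro t
    have k1 : En' t = -(2 * α * y'' t ^ 2) + 2 * r t * y'' t + lam * (2 * c ^ 2 * y' t ^ 2
        + 2 * κ * (y t * y' t)) := by
      simp only [En']
      ring
    have k2 : -(2 * α * y'' t ^ 2) ≤ 2 * |α| * y'' t ^ 2 := by
      have := mul_le_mul_of_nonneg_right (neg_abs_le α) (sq_nonneg (y'' t))
      linarith
    have k3 : 2 * r t * y'' t ≤ r t ^ 2 + y'' t ^ 2 := two_mul_le_add_sq _ _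
    have k4 : 2 * c ^ 2 * y' t ^ 2 + 2 * κ * (y t * y' t)
        ≤ (2 * c ^ 2 + κ) * y' t ^ 2 + κ * y t ^ 2 := by
      nlinarith [mul_nonneg (zero_le_one.trans hκ1) (sq_nonneg (y t - y' t))]
    have k5 := mul_le_mul_of_nonneg_left k4 hlam
    have k6 := mul_le_mul_of_nonneg_left (hlow t) hM0
    have k7 : (2 * |α| + 1) * y'' t ^ 2 ≤ M * y'' t ^ 2 := by
      refine mul_le_mul_of_nonneg_right ?_ (sq_nonneg _)
      have : 0 ≤ 2 / b * (2 * c ^ 2 + κ) := by positivity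
      rw [hM]
      linarith
    have k8 : (2 * c ^ 2 + κ) * y' t ^ 2 + κ * y t ^ 2 ≤ M * (b / 2 * y' t ^ 2 + y t ^ 2) := by
      have a1 : 2 * c ^ 2 + κ ≤ M * (b / 2) := by
        have : 2 / b * (2 * c ^ 2 + κ) * (b / 2) = 2 * c ^ 2 + κ := by field_simp
        have a2 : 0 ≤ (2 * |α| + 1 + κ) * (b / 2) := by positivity
        rw [hM]
        linarith
      have a3 : κ ≤ M := by
        have : 0 ≤ 2 / b * (2 * c ^ 2 + κ) := by positivity
        have := abs_nonneg α
        rw [hM]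
        linarith
      have a4 := mul_le_mul_of_nonneg_right a1 (sq_nonneg (y' t))
      have a5 := mul_le_mul_of_nonneg_right a3 (sq_nonneg (y t))
      linarith
    have k9 := mul_le_mul_of_nonneg_left k8 hlam
    rw [k1]
    linarith
  -- Gronwall's argument: Φ decreases for t ≥ 0, where exp(-Mt) ≤ 1.
  let Φ : ℝ → ℝ := fun t => Real.exp (-M * t) * En t - ∫ τ in (0 : ℝ)..t, r τ ^ 2
  have hΦ : ∀ t, HasDerivAt Φ (Real.exp (-M * t) * (-M) * En t + Real.exp (-M * t) * En' t
      - r t ^ 2) t := by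
    intro t
    have e1 : HasDerivAt (fun t => Real.exp (-M * t)) (Real.exp (-M * t) * (-M)) t := by
      simpa using ((hasDerivAt_id t).const_mul (-M)).exp
    exact (e1.mul (hEn t)).sub (intervalIntegral.integral_hasDerivAt_right
      (hrc.intervalIntegrable _ _) (hrc.stronglyMeasurableAtFilter _ _) hrc.continuousAt)
  have hanti : AntitoneOn Φ (Ici 0) := by
    refine antitoneOn_of_deriv_nonpos (convex_Ici 0)
      (fun t _ => (hΦ t).continuousAt.continuousWithinAt)
      (fun t _ => (hΦ t).differentiableAt.differentiableWithinAt) fun t ht => ?_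
    rw [interior_Ici] at ht
    have ht' : (0 : ℝ) < t := ht
    rw [(hΦ t).deriv]
    have e1 : Real.exp (-M * t) ≤ 1 := Real.exp_le_one_iff.mpr (by nlinarith)
    have e2 := mul_le_mul_of_nonneg_left (hEn' t) (Real.exp_pos (-M * t)).le
    have e3 := mul_le_mul_of_nonneg_right e1 (sq_nonneg (r t))
    linarith
  have hle := hanti (mem_Ici.mpr le_rfl) (mem_Ici.mpr ht.1) ht.1
  have hint : ∫ τ in (0 : ℝ)..t, r τ ^ 2 ≤ ∫ τ in (0 : ℝ)..T, r τ ^ 2 :=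
    intervalIntegral.integral_mono_interval le_rfl ht.1 ht.2
      (Eventually.of_forall fun τ => sq_nonneg _) (hrc.intervalIntegrable _ _)
  have hint0 : 0 ≤ ∫ τ in (0 : ℝ)..T, r τ ^ 2 :=
    intervalIntegral.integral_nonneg hT fun τ _ => sq_nonneg _
  set S := ∫ τ in (0 : ℝ)..T, r τ ^ 2
  set N₀ := y'' 0 ^ 2 + lam * y' 0 ^ 2 + lam * y 0 ^ 2
  have f1 : Real.exp (-M * t) * En t ≤ D * (N₀ + S) := by
    have f2 : Φ 0 = En 0 := by simp [Φ]
    rw [f2] at hle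
    have f3 : Real.exp (-M * t) * En t - ∫ τ in (0 : ℝ)..t, r τ ^ 2 ≤ En 0 := hle
    have f4 := hup 0
    nlinarith
  have f5 : En t ≤ Real.exp (M * T) * (D * (N₀ + S)) := by
    have f6 : En t = Real.exp (M * t) * (Real.exp (-M * t) * En t) := by
      rw [← mul_assoc, ← Real.exp_add]
      simp
    have hN₀ : 0 ≤ N₀ := by positivity
    rw [f6]
    exact mul_le_mul (Real.exp_le_exp.mpr (mul_le_mul_of_nonneg_left ht.2 hM0)) f1
      (mul_nonneg (Real.exp_pos _).le ((by positivity : (0 : ℝ) ≤ y'' t ^ 2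
        + lam * (b / 2 * y' t ^ 2 + y t ^ 2)).trans (hlow t))) (Real.exp_pos _).le
  have f7 : q * (y'' t ^ 2 + lam * y' t ^ 2 + lam * y t ^ 2) ≤ En t := by
    refine le_trans ?_ (hlow t)
    have q1 : q ≤ 1 := min_le_left _ _
    have q2 : q ≤ b / 2 := min_le_right _ _
    have g1 := mul_le_mul_of_nonneg_right q1 (sq_nonneg (y'' t))
    have g2 := mul_le_mul_of_nonneg_right q2 (mul_nonneg hlam (sq_nonneg (y' t)))
    have g3 := mul_le_mul_of_nonneg_right q1 (mul_nonneg hlam (sq_nonneg (y t)))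
    linarith
  rw [mul_assoc, ← div_eq_inv_mul, le_div_iff₀ hq0, mul_comm, mul_assoc]
  exact f7.trans f5

/-- Duhamel's formula for `y''' + α y'' + β y' + γ y = r`. -/
theorem duhamel_cubic {α β γ : ℂ} {K K₁ K₂ : ℝ → ℂ} (hK : ∀ t, HasDerivAt K (K₁ t) t)
    (hK₁ : ∀ t, HasDerivAt K₁ (K₂ t) t)
    (hK₂ : ∀ t, HasDerivAt K₂ (-(α * K₂ t + β * K₁ t + γ * K t)) t)
    (hK0 : K 0 = 0) (hK10 : K₁ 0 = 0) (hK20 : K₂ 0 = 1) {T : ℝ} {y y' y'' r : ℝ → ℂ}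
    (hy : ContinuousOn y (Icc 0 T)) (hy' : ContinuousOn y' (Icc 0 T))
    (hy'' : ContinuousOn y'' (Icc 0 T)) (hr : ContinuousOn r (Icc 0 T))
    (hyd : ∀ t ∈ Ioo 0 T, HasDerivAt y (y' t) t) (hyd' : ∀ t ∈ Ioo 0 T, HasDerivAt y' (y'' t) t)
    (hyd'' : ∀ t ∈ Ioo 0 T, HasDerivAt y'' (r t - (α * y'' t + β * y' t + γ * y t)) t)
    {t : ℝ} (ht : t ∈ Icc 0 T) :
    y t = (K₂ t + α * K₁ t + β * K t) * y 0 + (K₁ t + α * K t) * y' 0 + K t * y'' 0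
      + ∫ τ in (0 : ℝ)..t, K (t - τ) * r τ := by
  have hsub : Icc 0 t ⊆ Icc 0 T := Icc_subset_Icc_right ht.2
  have hsub' : Ioo 0 t ⊆ Ioo 0 T := Ioo_subset_Ioo_right ht.2
  have cK : Continuous K := continuous_iff_continuousAt.mpr fun t => (hK t).continuousAt
  have cK₁ : Continuous K₁ := continuous_iff_continuousAt.mpr fun t => (hK₁ t).continuousAt
  have cK₂ : Continuous K₂ := continuous_iff_continuousAt.mpr fun t => (hK₂ t).continuousAt
  have cs : Continuous fun τ : ℝ => t - τ := continuous_const.sub continuous_id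
  have hs : ∀ τ : ℝ, HasDerivAt (fun τ : ℝ => t - τ) (-1) τ := fun τ => by
    simpa using (hasDerivAt_id τ).const_sub t
  -- Here Φ(t) = y(t), and Φ(0) is the homogeneous part. In the derivative all terms with y, y', y''
  -- cancel because K solves the homogeneous equation, and K(t - τ) r(τ) is left.
  let Φ : ℝ → ℂ := fun τ => (K₂ (t - τ) + α * K₁ (t - τ) + β * K (t - τ)) * y τ
    + (K₁ (t - τ) + α * K (t - τ)) * y' τ + K (t - τ) * y'' τ
  have hΦc : ContinuousOn Φ (Icc 0 t) := by
    have a0 := (cK.comp cs).continuousOn (s := Icc 0 t)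
    have a1 := (cK₁.comp cs).continuousOn (s := Icc 0 t)
    have a2 := (cK₂.comp cs).continuousOn (s := Icc 0 t)
    exact ((((a2.add (continuousOn_const.mul a1)).add (continuousOn_const.mul a0)).mul
      (hy.mono hsub)).add ((a1.add (continuousOn_const.mul a0)).mul (hy'.mono hsub))).add
      (a0.mul (hy''.mono hsub))
  have hΦd : ∀ τ ∈ Ioo 0 t, HasDerivAt Φ (K (t - τ) * r τ) τ := by
    intro τ hτ
    have b0 : HasDerivAt (fun τ => K (t - τ)) (-K₁ (t - τ)) τ := by
      exact ((hK (t - τ)).scomp τ (hs τ)).congr_deriv (by simp)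
    have b1 : HasDerivAt (fun τ => K₁ (t - τ)) (-K₂ (t - τ)) τ := by
      exact ((hK₁ (t - τ)).scomp τ (hs τ)).congr_deriv (by simp)
    have b2 : HasDerivAt (fun τ => K₂ (t - τ))
        (α * K₂ (t - τ) + β * K₁ (t - τ) + γ * K (t - τ)) τ := by
      exact ((hK₂ (t - τ)).scomp τ (hs τ)).congr_deriv (by simp; ring)
    have := ((((b2.add (b1.const_mul α)).add (b0.const_mul β)).mul (hyd τ (hsub' hτ))).add
      ((b1.add (b0.const_mul α)).mul (hyd' τ (hsub' hτ)))).add (b0.mul (hyd'' τ (hsub' hτ)))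
    refine this.congr_deriv ?_
    simp only [Pi.add_apply]
    ring
  have hint : IntervalIntegrable (fun τ => K (t - τ) * r τ) volume 0 t := by
    apply ContinuousOn.intervalIntegrable
    rw [uIcc_of_le ht.1]
    exact (cK.comp cs).continuousOn.mul (hr.mono hsub)
  have := intervalIntegral.integral_eq_sub_of_hasDerivAt_of_le ht.1 hΦc hΦd hint
  rw [this]
  simp only [Φ, sub_self, sub_zero, hK0, hK10, hK20]
  ring

/-! ### The coefficient functions as solutions of the mode equation -/

namespace NonlocalMGT

theorem IsModeSolution.hasDerivAt {α b c lam : ℝ} {y₀ y₁ y₂ : ℂ} {y : ℝ → ℂ}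
    (h : IsModeSolution α b c lam y₀ y₁ y₂ y) :
    (∀ t, HasDerivAt y (deriv y t) t) ∧ (∀ t, HasDerivAt (deriv y) (iteratedDeriv 2 y t) t) ∧
      ∀ t, HasDerivAt (iteratedDeriv 2 y)
        (-(α * iteratedDeriv 2 y t + lam * b * deriv y t + lam * c ^ 2 * y t)) t := by
  obtain ⟨hc, he, -⟩ := h
  have hd : ∀ m : ℕ, m < 3 → ∀ t, HasDerivAt (iteratedDeriv m y) (iteratedDeriv (m + 1) y t) t := by
    intro m hm t
    rw [iteratedDeriv_succ]
    exact ((hc.differentiable_iteratedDeriv m (by exact_mod_cast hm)) t).hasDerivAt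
  refine ⟨fun t => ?_, fun t => ?_, fun t => ?_⟩
  · simpa [iteratedDeriv_zero, iteratedDeriv_one] using hd 0 (by norm_num) t
  · simpa [iteratedDeriv_one] using hd 1 (by norm_num) t
  · have := hd 2 (by norm_num) t
    convert this using 1
    linear_combination -(he t)

theorem hasDerivAt_expSum (p₁ p₂ p₃ l₁ l₂ l₃ : ℂ) (t : ℝ) :
    HasDerivAt (fun t : ℝ => p₁ * Complex.exp (l₁ * t) + p₂ * Complex.exp (l₂ * t)
      + p₃ * Complex.exp (l₃ * t)) (p₁ * l₁ * Complex.exp (l₁ * t)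
        + p₂ * l₂ * Complex.exp (l₂ * t) + p₃ * l₃ * Complex.exp (l₃ * t)) t := by
  have h : ∀ l : ℂ, HasDerivAt (fun t : ℝ => Complex.exp (l * t)) (Complex.exp (l * t) * l) t := by
    intro l
    have := ((hasDerivAt_id (t : ℂ)).const_mul l).cexp.comp_ofReal
    simpa using this
  have := (((h l₁).const_mul p₁).add ((h l₂).const_mul p₂)).add ((h l₃).const_mul p₃)
  refine this.congr_deriv ?_
  ring

theorem isModeSolution_expSum {α b c lam : ℝ} {l₁ l₂ l₃ : ℂ} (h₁ : IsCharRoot α b c lam l₁)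
    (h₂ : IsCharRoot α b c lam l₂) (h₃ : IsCharRoot α b c lam l₃) (p₁ p₂ p₃ : ℂ) :
    IsModeSolution α b c lam (p₁ + p₂ + p₃) (p₁ * l₁ + p₂ * l₂ + p₃ * l₃)
      (p₁ * l₁ ^ 2 + p₂ * l₂ ^ 2 + p₃ * l₃ ^ 2)
      (fun t : ℝ => p₁ * Complex.exp (l₁ * t) + p₂ * Complex.exp (l₂ * t)
        + p₃ * Complex.exp (l₃ * t)) := by
  have hd : ∀ q₁ q₂ q₃ : ℂ, deriv (fun t : ℝ => q₁ * Complex.exp (l₁ * t)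
      + q₂ * Complex.exp (l₂ * t) + q₃ * Complex.exp (l₃ * t))
      = fun t : ℝ => q₁ * l₁ * Complex.exp (l₁ * t) + q₂ * l₂ * Complex.exp (l₂ * t)
        + q₃ * l₃ * Complex.exp (l₃ * t) :=
    fun q₁ q₂ q₃ => funext fun t => (hasDerivAt_expSum q₁ q₂ q₃ l₁ l₂ l₃ t).deriv
  have h1 := hd p₁ p₂ p₃
  have hd2 : ∀ (f : ℝ → ℂ), iteratedDeriv 2 f = deriv (deriv f) := fun f => by
    rw [iteratedDeriv_succ, iteratedDeriv_one]
  have hd3 : ∀ (f : ℝ → ℂ), iteratedDeriv 3 f = deriv (deriv (deriv f)) := fun f => by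
    rw [iteratedDeriv_succ, hd2]
  refine ⟨?_, fun t => ?_, ?_, ?_, ?_⟩
  · have hof : ContDiff ℝ 3 (fun t : ℝ => (t : ℂ)) := Complex.ofRealCLM.contDiff
    fun_prop
  · rw [hd3, hd2, hd, hd, hd]
    unfold IsCharRoot at h₁ h₂ h₃
    linear_combination p₁ * Complex.exp (l₁ * t) * h₁ + p₂ * Complex.exp (l₂ * t) * h₂
      + p₃ * Complex.exp (l₃ * t) * h₃
  · simp
  · rw [hd]; simp
  · rw [hd2, hd, hd]; simp; ring

/-- The factors of exp(l_i t) in A, B, C are the coefficients of 1, z, z² in the Lagrange basis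
polynomial of the node l_i, which produces the initial values. From here on, simple and multiple
roots are treated alike. -/
theorem IsCoefTriple.isModeSolution {α b c lam : ℝ} {A B C : ℝ → ℂ}
    (h : IsCoefTriple α b c lam A B C) :
    IsModeSolution α b c lam 1 0 0 A ∧ IsModeSolution α b c lam 0 1 0 B ∧
      IsModeSolution α b c lam 0 0 1 C := by
  rcases h with ⟨l₁, l₂, l₃, ⟨h₁, h₂, h₃, h12, h13, h23⟩, rfl, rfl, rfl⟩ | ⟨-, h⟩
  · have n12 := sub_ne_zero.mpr h12
    have n13 := sub_ne_zero.mpr h13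
    have n23 := sub_ne_zero.mpr h23
    refine ⟨?_, ?_, ?_⟩
    · convert isModeSolution_expSum h₁ h₂ h₃ (l₂ * l₃ / ((l₁ - l₂) * (l₁ - l₃)))
        (-(l₁ * l₃ / ((l₁ - l₂) * (l₂ - l₃)))) (l₁ * l₂ / ((l₁ - l₃) * (l₂ - l₃))) using 1
      · field_simp; ring
      · field_simp; ring
      · field_simp; ring
      · funext t; simp only [coefA]; ring
    · convert isModeSolution_expSum h₁ h₂ h₃ (-((l₂ + l₃) / ((l₁ - l₂) * (l₁ - l₃))))
        ((l₁ + l₃) / ((l₁ - l₂) * (l₂ - l₃))) (-((l₁ + l₂) / ((l₁ - l₃) * (l₂ - l₃)))) using 1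
      · field_simp; ring
      · field_simp; ring
      · field_simp; ring
      · funext t; simp only [coefB]; ring
    · convert isModeSolution_expSum h₁ h₂ h₃ (1 / ((l₁ - l₂) * (l₁ - l₃)))
        (-(1 / ((l₁ - l₂) * (l₂ - l₃)))) (1 / ((l₁ - l₃) * (l₂ - l₃))) using 1
      · field_simp; ring
      · field_simp; ring
      · field_simp; ring
      · funext t; simp only [coefC]; ring
  · exact h

end NonlocalMGT

/-! ### The abstract evolution equation -/

/-- A Weierstrass test in square means: the Bessel-type bound on finite sums turns the tails of Σ
m_n into a Cauchy estimate uniform in t. The series need not converge absolutely. -/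
theorem exists_continuous_series {X : Type*} [NormedAddCommGroup X] [NormedSpace ℝ X]
    [CompleteSpace X] {ψ : ℕ → X} {K : ℝ} (hK : 0 ≤ K)
    (hψ : ∀ (s : Finset ℕ) (d : ℕ → ℝ), ‖∑ n ∈ s, d n • ψ n‖ ^ 2 ≤ K * ∑ n ∈ s, d n ^ 2)
    {a : ℕ → ℝ → ℝ} (ha : ∀ n, Continuous (a n)) {m : ℕ → ℝ} (hm : Summable m)
    (ham : ∀ n t, a n t ^ 2 ≤ m n) :
    ∃ F : ℝ → X, Continuous F ∧ ∀ t, HasSum (fun n => a n t • ψ n) (F t) := by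
  classical
  have hm0 : ∀ n, 0 ≤ m n := fun n => (sq_nonneg _).trans (ham n 0)
  have hle : ∀ (s : Finset ℕ) t, ‖∑ n ∈ s, a n t • ψ n‖ ^ 2 ≤ K * ∑ n ∈ s, m n := fun s t =>
    (hψ s fun n => a n t).trans
      (mul_le_mul_of_nonneg_left (Finset.sum_le_sum fun n _ => ham n t) hK)
  have hsum : ∀ t, Summable fun n => a n t • ψ n := by
    intro t
    rw [summable_iff_vanishing_norm]
    intro ε hε
    obtain ⟨s, hs⟩ := summable_iff_vanishing_norm.mp hm (ε ^ 2 / (K + 1)) (by positivity)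
    refine ⟨s, fun u hu => ?_⟩
    have h1 := hs u hu
    rw [Real.norm_of_nonneg (Finset.sum_nonneg fun n _ => hm0 n), lt_div_iff₀ (by positivity)] at h1
    have h2 := hle u t
    have h3 : 0 ≤ ∑ n ∈ u, m n := Finset.sum_nonneg fun n _ => hm0 n
    exact lt_of_pow_lt_pow_left₀ 2 hε.le (by nlinarith)
  refine ⟨fun t => ∑' n, a n t • ψ n, ?_, fun t => (hsum t).hasSum⟩
  have hunif : TendstoUniformly (fun (s : Finset ℕ) t => ∑ n ∈ s, a n t • ψ n)
      (fun t => ∑' n, a n t • ψ n) atTop := by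
    rw [Metric.tendstoUniformly_iff]
    intro ε hε
    obtain ⟨s, hs⟩ := summable_iff_vanishing_norm.mp hm ((ε / 2) ^ 2 / (K + 1)) (by positivity)
    filter_upwards [eventually_ge_atTop s] with s' hs' t
    have hbound : ∀ᶠ u : Finset ℕ in atTop,
        ‖∑ n ∈ u, a n t • ψ n - ∑ n ∈ s', a n t • ψ n‖ ≤ ε / 2 := by
      filter_upwards [eventually_ge_atTop s'] with u hu
      rw [← Finset.sum_sdiff hu, add_sub_cancel_right]
      have h1 := hs (u \ s') (Finset.disjoint_of_subset_right hs' Finset.sdiff_disjoint)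
      rw [Real.norm_of_nonneg (Finset.sum_nonneg fun n _ => hm0 n),
        lt_div_iff₀ (by positivity)] at h1
      have h2 := hle (u \ s') t
      have h3 : 0 ≤ ∑ n ∈ u \ s', m n := Finset.sum_nonneg fun n _ => hm0 n
      exact (lt_of_pow_lt_pow_left₀ 2 (half_pos hε).le (by nlinarith)).le
    have hlim := ((hsum t).hasSum.sub_const (∑ n ∈ s', a n t • ψ n)).norm
    rw [dist_eq_norm]
    exact (le_of_tendsto hlim hbound).trans_lt (half_lt_self hε)
  exact hunif.continuous (Frequently.of_forall fun s =>
    continuous_finsetSum _ fun n _ => (ha n).smul continuous_const)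

/-- The functionals `l n` cannot distinguish G(t) from G(0) + ∫₀ᵗ G', by the scalar fundamental
theorem of calculus. As they separate points, G is a primitive of the continuous curve G', and no
series has to be differentiated termwise. -/
theorem hasDerivWithinAt_of_separating {X : Type*} [NormedAddCommGroup X] [NormedSpace ℝ X]
    [CompleteSpace X] {T : ℝ} {G G' : ℝ → X} (hG' : Continuous G')
    {l : ℕ → X →L[ℝ] ℝ} (hl : ∀ x y, (∀ n, l n x = l n y) → x = y) {y : ℕ → ℝ → ℝ}
    (hy : ∀ n, ∀ t ∈ Icc 0 T, l n (G t) = y n t)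
    (hyd : ∀ n, ∀ t ∈ Icc 0 T, HasDerivAt (y n) (l n (G' t)) t) :
    ∀ t ∈ Icc 0 T, HasDerivWithinAt G (G' t) (Icc 0 T) t := by
  have key : ∀ t ∈ Icc 0 T, G t = G 0 + ∫ τ in (0 : ℝ)..t, G' τ := by
    intro t ht
    refine hl _ _ fun n => ?_
    have hT : (0 : ℝ) ∈ Icc 0 T := ⟨le_rfl, ht.1.trans ht.2⟩
    rw [map_add, ← (l n).intervalIntegral_comp_comm (hG'.intervalIntegrable _ _), hy n t ht,
      hy n 0 hT, intervalIntegral.integral_eq_sub_of_hasDerivAt (f := y n) (fun τ hτ => hyd n τ ?_)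
        (((l n).continuous.comp hG').intervalIntegrable _ _)]
    · ring
    · rw [uIcc_of_le ht.1] at hτ
      exact ⟨hτ.1, hτ.2.trans ht.2⟩
  intro t ht
  have h := ((intervalIntegral.integral_hasDerivAt_right (hG'.intervalIntegrable 0 t)
    (hG'.stronglyMeasurableAtFilter _ _) hG'.continuousAt).const_add (G 0)).hasDerivWithinAt
      (s := Icc 0 T)
  exact h.congr key (key t ht)

/-! ### Eigenfunction expansions for a coercive form -/

section Abstract

variable {V H : Type*} [NormedAddCommGroup V] [InnerProductSpace ℝ V]
  [NormedAddCommGroup H] [InnerProductSpace ℝ H]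

/-- `(φ_n)` is an eigenbasis, with eigenvalues `(lam_n)`, of the symmetric coercive form `a` on `V`,
where `V` is embedded into `H` by `j`. -/
structure FormEigenbasis (j : V →L[ℝ] H) (a : V →L[ℝ] V →L[ℝ] ℝ) (φ : ℕ → V) (lam : ℕ → ℝ) :
    Prop where
  inj : Function.Injective j
  symm : ∀ v w, a v w = a w v
  coercive : IsCoercive a
  orthonormal : Orthonormal ℝ (fun n => j (φ n))
  total : (Submodule.span ℝ (range fun n => j (φ n))).topologicalClosure = ⊤
  eigen : ∀ n v, a (φ n) v = lam n * inner ℝ (j (φ n)) (j v)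

namespace FormEigenbasis

variable {j : V →L[ℝ] H} {a : V →L[ℝ] V →L[ℝ] ℝ} {φ : ℕ → V} {lam : ℕ → ℝ}

theorem eigen_right (h : FormEigenbasis j a φ lam) (n : ℕ) (v : V) :
    a v (φ n) = lam n * inner ℝ (j v) (j (φ n)) := by
  rw [h.symm, h.eigen, real_inner_comm]

theorem lam_pos (h : FormEigenbasis j a φ lam) (n : ℕ) : 0 < lam n := by
  obtain ⟨C, hC, hcoe⟩ := h.coercive
  have h1 := h.eigen n (φ n)
  rw [real_inner_self_eq_norm_sq, h.orthonormal.1, one_pow, mul_one] at h1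
  have hne : φ n ≠ 0 := fun h0 => h.orthonormal.ne_zero n (by rw [h0, map_zero])
  have : 0 < ‖φ n‖ := norm_pos_iff.mpr hne
  rw [← h1]
  exact lt_of_lt_of_le (by positivity) (hcoe (φ n))

theorem ext_right [CompleteSpace H] (h : FormEigenbasis j a φ lam) {x y : H}
    (hxy : ∀ n, (inner ℝ x (j (φ n)) : ℝ) = inner ℝ y (j (φ n))) : x = y := by
  have h0 : x - y ∈ (Submodule.span ℝ (range fun n => j (φ n)))ᗮ := by
    rw [Submodule.mem_orthogonal]
    intro u hu
    refine Submodule.span_induction ?_ (by simp) (fun a b _ _ ha hb => ?_) (fun c a _ ha => ?_) hu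
    · rintro _ ⟨n, rfl⟩
      rw [real_inner_comm, inner_sub_left, hxy n, sub_self]
    · rw [inner_add_left, ha, hb, add_zero]
    · rw [inner_smul_left, ha, mul_zero]
  rw [(Submodule.topologicalClosure_eq_top_iff).mp h.total, Submodule.mem_bot] at h0
  exact sub_eq_zero.mp h0

theorem ext_form [CompleteSpace H] (h : FormEigenbasis j a φ lam) {v w : V}
    (hvw : ∀ n, (inner ℝ (j v) (j (φ n)) : ℝ) = inner ℝ (j w) (j (φ n))) : v = w :=
  h.inj (h.ext_right hvw)

/-- By Lax–Milgram S - R = a(v, ·), and a(v, φ_n) = λ_n (j v, j φ_n) with λ_n ≠ 0, so v is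
orthogonal in H to the whole basis. -/
theorem ext_dual [CompleteSpace H] [CompleteSpace V] (h : FormEigenbasis j a φ lam)
    {S R : StrongDual ℝ V} (hSR : ∀ n, S (φ n) = R (φ n)) : S = R := by
  let v : V := h.coercive.continuousLinearEquivOfBilin.symm
    ((InnerProductSpace.toDual ℝ V).symm (S - R))
  have hv : ∀ w, a v w = S w - R w := by
    intro w
    rw [← h.coercive.continuousLinearEquivOfBilin_apply, ContinuousLinearEquiv.apply_symm_apply,
      InnerProductSpace.toDual_symm_apply, sub_apply]
  have hv0 : v = 0 := h.ext_form fun n => by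
    have h1 := h.eigen_right n v
    rw [hv, hSR, sub_self] at h1
    rw [map_zero, inner_zero_left]
    exact (mul_eq_zero.mp h1.symm).resolve_left (h.lam_pos n).ne'
  ext w
  have := hv w
  rw [hv0, map_zero, zero_apply] at this
  linarith

theorem form_sum_sum (h : FormEigenbasis j a φ lam) (s : Finset ℕ) (d : ℕ → ℝ) :
    a (∑ n ∈ s, d n • φ n) (∑ n ∈ s, d n • φ n) = ∑ n ∈ s, lam n * d n ^ 2 := by
  classical
  rw [map_sum]
  refine Finset.sum_congr rfl fun n hn => ?_
  rw [map_smul, h.eigen_right, map_sum, sum_inner, Finset.sum_eq_single n]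
  · rw [map_smul, inner_smul_left, real_inner_self_eq_norm_sq, h.orthonormal.1]
    simp
    ring
  · intro k _ hk
    rw [map_smul, inner_smul_left, h.orthonormal.2 hk, mul_zero]
  · exact fun hn' => absurd hn hn'

/-- Bessel's inequality for the inner product a, in which the φ_n are orthogonal with a(φ_n, φ_n) =
λ_n. -/
theorem sum_coef_le (h : FormEigenbasis j a φ lam) (v : V) (s : Finset ℕ) :
    ∑ n ∈ s, lam n * (inner ℝ (j v) (j (φ n)) : ℝ) ^ 2 ≤ a v v := by
  obtain ⟨C, hC, hcoe⟩ := h.coercive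
  let d : ℕ → ℝ := fun n => inner ℝ (j v) (j (φ n))
  have h1 : 0 ≤ a (v - ∑ n ∈ s, d n • φ n) (v - ∑ n ∈ s, d n • φ n) :=
    le_trans (by positivity) (hcoe _)
  have h2 : a v (∑ n ∈ s, d n • φ n) = ∑ n ∈ s, lam n * d n ^ 2 := by
    rw [map_sum]
    refine Finset.sum_congr rfl fun n _ => ?_
    rw [map_smul, h.eigen_right, smul_eq_mul]
    ring
  rw [map_sub, map_sub, sub_apply, sub_apply, h.symm (∑ n ∈ s, d n • φ n) v, h.form_sum_sum,
    h2] at h1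
  linarith

theorem summable_coef (h : FormEigenbasis j a φ lam) (v : V) :
    Summable fun n => lam n * (inner ℝ (j v) (j (φ n)) : ℝ) ^ 2 :=
  summable_of_sum_le (fun n => mul_nonneg (h.lam_pos n).le (sq_nonneg _)) (h.sum_coef_le v)

theorem sum_sq_le (h : FormEigenbasis j a φ lam) (x : H) (s : Finset ℕ) :
    ∑ n ∈ s, (inner ℝ x (j (φ n)) : ℝ) ^ 2 ≤ ‖x‖ ^ 2 := by
  have := h.orthonormal.sum_inner_products_le (s := s) x
  simpa [real_inner_comm] using this

/-- The curve in `V` with given coordinates. -/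
theorem exists_continuous_form [CompleteSpace V] (h : FormEigenbasis j a φ lam)
    {y : ℕ → ℝ → ℝ} (hy : ∀ n, Continuous (y n)) {m : ℕ → ℝ} (hm : Summable m)
    (hym : ∀ n t, lam n * y n t ^ 2 ≤ m n) :
    ∃ F : ℝ → V, Continuous F ∧ ∀ t n, inner ℝ (j (F t)) (j (φ n)) = y n t := by
  obtain ⟨C, hC, hcoe⟩ := h.coercive
  have hs : ∀ n, Real.sqrt (lam n) ≠ 0 := fun n => (Real.sqrt_pos.mpr (h.lam_pos n)).ne'
  -- The vectors φ_n/√λ_n are orthonormal for a, and coercivity bounds the norm of V by a with the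
  -- factor C⁻¹.
  obtain ⟨F, hF, hsum⟩ := exists_continuous_series (ψ := fun n => (Real.sqrt (lam n))⁻¹ • φ n)
    (K := C⁻¹) (by positivity) (fun s d => by
      have h1 := h.form_sum_sum s fun n => d n * (Real.sqrt (lam n))⁻¹
      have h2 := hcoe (∑ n ∈ s, (d n * (Real.sqrt (lam n))⁻¹) • φ n)
      have h3 : ∑ n ∈ s, lam n * (d n * (Real.sqrt (lam n))⁻¹) ^ 2 = ∑ n ∈ s, d n ^ 2 := by
        refine Finset.sum_congr rfl fun n _ => ?_
        rw [mul_pow, inv_pow, Real.sq_sqrt (h.lam_pos n).le]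
        have := (h.lam_pos n).ne'
        field_simp
      rw [h1, h3] at h2
      simp only [smul_smul]
      rw [← div_eq_inv_mul, le_div_iff₀ hC]
      linarith) (a := fun n t => Real.sqrt (lam n) * y n t)
    (fun n => continuous_const.mul (hy n)) hm (fun n t => by
      rw [mul_pow, Real.sq_sqrt (h.lam_pos n).le]
      exact hym n t)
  refine ⟨F, hF, fun t n => ?_⟩
  have h1 := (hsum t).mapL ((innerSL ℝ (j (φ n))) ∘L j)
  have h2 := h1.unique (hasSum_single n fun k hk => by
    simp [h.orthonormal.2 hk.symm])
  have h3 := h.orthonormal.1 n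
  rw [real_inner_comm]
  simpa [inner_smul_right, h3, hs n, mul_comm] using h2

/-- The curve in `H` with given coordinates. -/
theorem exists_continuous_right [CompleteSpace H] (h : FormEigenbasis j a φ lam)
    {y : ℕ → ℝ → ℝ} (hy : ∀ n, Continuous (y n)) {m : ℕ → ℝ} (hm : Summable m)
    (hym : ∀ n t, y n t ^ 2 ≤ m n) :
    ∃ F : ℝ → H, Continuous F ∧ ∀ t n, inner ℝ (F t) (j (φ n)) = y n t := by
  obtain ⟨F, hF, hsum⟩ := exists_continuous_series (ψ := fun n => j (φ n)) (K := 1)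
    zero_le_one (fun s d => by
      rw [one_mul, ← real_inner_self_eq_norm_sq, h.orthonormal.inner_sum]
      simp [sq]) hy hm hym
  refine ⟨F, hF, fun t n => ?_⟩
  have h1 := (hsum t).mapL (innerSL ℝ (j (φ n)))
  have h2 := h1.unique (hasSum_single n fun k hk => by
    simp [h.orthonormal.2 hk.symm])
  have h3 := h.orthonormal.1 n
  rw [real_inner_comm]
  simpa [inner_smul_right, h3] using h2

/-- Existence for `u''' + α u'' + A (c² u + b u') = R`, where `A : V → V'` is the operator of the
form `a`. -/
theorem exists_evolution [CompleteSpace H] [CompleteSpace V] (h : FormEigenbasis j a φ lam)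
    (α c : ℝ) {b T : ℝ} (hb : 0 < b) (hT : 0 ≤ T) (u₀ u₁ : V) (u₂ : H) {R : ℝ → H}
    (hR : Continuous R) :
    ∃ (U U₁ : ℝ → V) (U₂ : ℝ → H), Continuous U ∧ Continuous U₁ ∧ Continuous U₂ ∧
      U 0 = u₀ ∧ U₁ 0 = u₁ ∧ U₂ 0 = u₂ ∧
      (∀ t ∈ Icc 0 T, HasDerivWithinAt U (U₁ t) (Icc 0 T) t) ∧
      (∀ t ∈ Icc 0 T, HasDerivWithinAt (fun τ => j (U₁ τ)) (U₂ t) (Icc 0 T) t) ∧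
      ∀ t ∈ Icc 0 T, HasDerivWithinAt (fun τ => innerSL ℝ (U₂ τ) ∘L j)
        (innerSL ℝ (R t - α • U₂ t) ∘L j - a (c ^ 2 • U t + b • U₁ t)) (Icc 0 T) t := by
  obtain ⟨K, hK, hbound⟩ := exists_energy_bound α b c T hb hT
  have hr : ∀ n, Continuous fun t => (inner ℝ (R t) (j (φ n)) : ℝ) := fun n =>
    hR.inner continuous_const
  choose y y' y'' hy hy' hy'' hy0 hy'0 hy''0 using fun n =>
    exists_cubic_mode α b c (lam n) (inner ℝ (j u₀) (j (φ n))) (inner ℝ (j u₁) (j (φ n)))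
      (inner ℝ u₂ (j (φ n))) (hr n)
  have cy : ∀ n, Continuous (y n) := fun n =>
    continuous_iff_continuousAt.mpr fun t => (hy n t).continuousAt
  have cy' : ∀ n, Continuous (y' n) := fun n =>
    continuous_iff_continuousAt.mpr fun t => (hy' n t).continuousAt
  have cy'' : ∀ n, Continuous (y'' n) := fun n =>
    continuous_iff_continuousAt.mpr fun t => (hy'' n t).continuousAt
  -- Time is clamped to [0,T]: the energy bound holds only there, whereas the series lemmas require
  -- a bound for all real t.
  let π : ℝ → ℝ := fun t => max 0 (min T t)
  have cπ : Continuous π := continuous_const.max (continuous_const.min continuous_id)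
  have hπ : ∀ t, π t ∈ Icc 0 T := fun t => ⟨le_max_left _ _, max_le hT (min_le_left _ _)⟩
  have hπid : ∀ t ∈ Icc 0 T, π t = t := fun t ht => by
    simp only [π]
    rw [min_eq_right ht.2, max_eq_right ht.1]
  -- The energy bound of the n-th mode. It is summable by Bessel's inequality, for a applied to u₀
  -- and u₁, and in H applied to u₂ and to R(τ) before integration over τ.
  let m : ℕ → ℝ := fun n => K * ((inner ℝ u₂ (j (φ n)) : ℝ) ^ 2
    + lam n * (inner ℝ (j u₁) (j (φ n)) : ℝ) ^ 2 + lam n * (inner ℝ (j u₀) (j (φ n)) : ℝ) ^ 2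
    + ∫ τ in (0 : ℝ)..T, (inner ℝ (R τ) (j (φ n)) : ℝ) ^ 2)
  have hm : Summable m := by
    refine Summable.mul_left K (((Summable.add ?_ (h.summable_coef u₁)).add
      (h.summable_coef u₀)).add ?_)
    · exact summable_of_sum_le (fun n => sq_nonneg _) (h.sum_sq_le u₂)
    · refine summable_of_sum_le (c := ∫ τ in (0 : ℝ)..T, ‖R τ‖ ^ 2)
        (fun n => intervalIntegral.integral_nonneg hT fun _ _ => sq_nonneg _) fun s => ?_
      have hri : ∀ n, IntervalIntegrable (fun τ => (inner ℝ (R τ) (j (φ n)) : ℝ) ^ 2) volume 0 T :=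
        fun n => ((hr n).pow 2).intervalIntegrable _ _
      rw [← intervalIntegral.integral_finsetSum fun n _ => hri n]
      exact intervalIntegral.integral_mono hT
        ((continuous_finsetSum _ fun n _ => (hr n).pow 2).intervalIntegrable _ _)
        ((hR.norm.pow 2).intervalIntegrable _ _) fun τ => h.sum_sq_le (R τ) s
  have hE : ∀ n t, y'' n (π t) ^ 2 + lam n * y' n (π t) ^ 2 + lam n * y n (π t) ^ 2 ≤ m n := by
    intro n t
    have := hbound (lam n) (h.lam_pos n).le _ _ _ _ (hr n) (hy n) (hy' n) (hy'' n) (π t) (hπ t)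
    rwa [hy0, hy'0, hy''0] at this
  have hn : ∀ n (x : ℝ), 0 ≤ lam n * x ^ 2 := fun n x => mul_nonneg (h.lam_pos n).le (sq_nonneg x)
  obtain ⟨U, cU, hU⟩ := h.exists_continuous_form (fun n => (cy n).comp cπ) hm fun n t => by
    have := hE n t
    have := hn n (y' n (π t))
    have := sq_nonneg (y'' n (π t))
    simp only [Function.comp_apply]
    linarith
  obtain ⟨U₁, cU₁, hU₁⟩ := h.exists_continuous_form (fun n => (cy' n).comp cπ) hm fun n t => by
    have := hE n t
    have := hn n (y n (π t))
    have := sq_nonneg (y'' n (π t))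
    simp only [Function.comp_apply]
    linarith
  obtain ⟨U₂, cU₂, hU₂⟩ := h.exists_continuous_right (fun n => (cy'' n).comp cπ) hm fun n t => by
    have := hE n t
    have := hn n (y n (π t))
    have := hn n (y' n (π t))
    simp only [Function.comp_apply]
    linarith
  simp only [Function.comp_apply] at hU hU₁ hU₂
  have h0 : π 0 = 0 := hπid 0 ⟨le_rfl, hT⟩
  have cJ : Continuous fun τ => innerSL ℝ (U₂ τ) ∘L j :=
    ((innerSL ℝ).continuous.comp cU₂).clm_comp continuous_const
  refine ⟨U, U₁, U₂, cU, cU₁, cU₂, h.ext_form fun n => ?_, h.ext_form fun n => ?_,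
    h.ext_right fun n => ?_, ?_, ?_, ?_⟩
  · rw [hU, h0, hy0]
  · rw [hU₁, h0, hy'0]
  · rw [hU₂, h0, hy''0]
  · refine hasDerivWithinAt_of_separating cU₁ (l := fun n => (innerSL ℝ (j (φ n))) ∘L j)
      (fun v w hvw => h.ext_form fun n => ?_) (y := y) (fun n t ht => ?_) (fun n t ht => ?_)
    · rw [real_inner_comm, real_inner_comm _ (j w)]
      exact hvw n
    · show inner ℝ (j (φ n)) (j (U t)) = y n t
      rw [real_inner_comm, hU, hπid t ht]
    · have : inner ℝ (j (φ n)) (j (U₁ t)) = y' n t := by rw [real_inner_comm, hU₁, hπid t ht]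
      exact (hy n t).congr_deriv this.symm
  · refine hasDerivWithinAt_of_separating cU₂ (l := fun n => innerSL ℝ (j (φ n)))
      (fun v w hvw => h.ext_right fun n => ?_) (y := y') (fun n t ht => ?_) (fun n t ht => ?_)
    · rw [real_inner_comm, real_inner_comm _ w]
      exact hvw n
    · show inner ℝ (j (φ n)) (j (U₁ t)) = y' n t
      rw [real_inner_comm, hU₁, hπid t ht]
    · have : inner ℝ (j (φ n)) (U₂ t) = y'' n t := by rw [real_inner_comm, hU₂, hπid t ht]
      exact (hy' n t).congr_deriv this.symm
  · refine hasDerivWithinAt_of_separating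
      (G' := fun t => innerSL ℝ (R t - α • U₂ t) ∘L j - a (c ^ 2 • U t + b • U₁ t)) ?_
      (l := fun n => ContinuousLinearMap.apply ℝ ℝ (φ n)) (fun v w hvw => h.ext_dual hvw)
      (y := y'') (fun n t ht => ?_) (fun n t ht => ?_)
    · exact (((innerSL ℝ).continuous.comp (hR.sub (cU₂.const_smul α))).clm_comp
        continuous_const).sub (a.continuous.comp ((cU.const_smul _).add (cU₁.const_smul _)))
    · show inner ℝ (U₂ t) (j (φ n)) = y'' n t
      rw [hU₂, hπid t ht]
    · refine (hy'' n t).congr_deriv ?_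
      show _ = inner ℝ (R t - α • U₂ t) (j (φ n)) - a (c ^ 2 • U t + b • U₁ t) (φ n)
      rw [h.eigen_right, map_add, map_smul, map_smul, inner_sub_left, inner_smul_left,
        inner_add_left, inner_smul_left, inner_smul_left, hU, hU₁, hU₂, hπid t ht]
      rfl

end FormEigenbasis

end Abstract

/-! ### The energy space -/

namespace NonlocalMGT

variable {N : ℕ} {s : ℝ} {Ω : Set (E N)}

theorem mem_sobolevZero {p : Ambient N} :
    p ∈ sobolevZero s Ω ↔ p ∈ sobolev N s ∧ ∀ᵐ x, x ∉ Ω → p.fst x = 0 := Iff.rfl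

theorem mem_sobolev {p : Ambient N} :
    p ∈ sobolev N s ↔ (p.snd : E N × E N → ℝ) =ᵐ[volume] gagliardo s (p.fst : E N → ℝ) := Iff.rfl

theorem exists_subseq_ae_tendsto {X : Type*} [MeasurableSpace X] {μ : Measure X}
    {f : ℕ → Lp ℝ 2 μ} {g : Lp ℝ 2 μ} (h : Tendsto f atTop (𝓝 g)) :
    ∃ ns : ℕ → ℕ, StrictMono ns ∧ ∀ᵐ x ∂μ, Tendsto (fun i => f (ns i) x) atTop (𝓝 (g x)) :=
  (tendstoInMeasure_of_tendsto_Lp h).exists_seq_tendsto_ae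

/-- Along a common subsequence both components converge almost everywhere, so the two pointwise
relations that define the space pass to the limit. This gives the completeness needed for
Lax–Milgram. -/
theorem isClosed_sobolevZero : IsClosed (sobolevZero s Ω : Set (Ambient N)) := by
  refine IsSeqClosed.isClosed fun f p hf hlim => ?_
  have h1 : Tendsto (fun n => (f n).fst) atTop (𝓝 p.fst) :=
    ((WithLp.fstL 2 ℝ (L2 N) (Lp ℝ 2 (volume : Measure (E N × E N)))).continuous.tendsto p).comp hlim
  have h2 : Tendsto (fun n => (f n).snd) atTop (𝓝 p.snd) :=
    ((WithLp.sndL 2 ℝ (L2 N) (Lp ℝ 2 (volume : Measure (E N × E N)))).continuous.tendsto p).comp hlim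
  obtain ⟨ns, hns, hae⟩ := exists_subseq_ae_tendsto h1
  obtain ⟨ms, hms, hae2⟩ := exists_subseq_ae_tendsto (h2.comp hns.tendsto_atTop)
  refine ⟨?_, ?_⟩
  · have e1 : ∀ᵐ q : E N × E N, Tendsto (fun i => (f (ns i)).fst q.1) atTop (𝓝 (p.fst q.1)) :=
      Measure.quasiMeasurePreserving_fst.ae hae
    have e2 : ∀ᵐ q : E N × E N, Tendsto (fun i => (f (ns i)).fst q.2) atTop (𝓝 (p.fst q.2)) :=
      Measure.quasiMeasurePreserving_snd.ae hae
    have e3 : ∀ᵐ q : E N × E N, ∀ n, (f n).snd q = gagliardo s (f n).fst q :=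
      ae_all_iff.mpr fun n => (hf n).1
    show ∀ᵐ q, p.snd q = gagliardo s p.fst q
    filter_upwards [e1, e2, e3, hae2] with q h1 h2 h3 h4
    refine tendsto_nhds_unique h4 ?_
    simp only [Function.comp_apply, h3]
    exact ((h1.comp hms.tendsto_atTop).sub (h2.comp hms.tendsto_atTop)).div_const _
  · have e3 : ∀ᵐ x : E N, ∀ n, x ∉ Ω → (f n).fst x = 0 :=
      ae_all_iff.mpr fun n => (hf n).2
    show ∀ᵐ x, x ∉ Ω → p.fst x = 0
    filter_upwards [hae, e3] with x h1 h2 hx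
    refine tendsto_nhds_unique h1 ?_
    simp only [h2 _ hx]
    exact tendsto_const_nhds

instance : CompleteSpace (sobolevZero s Ω) := isClosed_sobolevZero.completeSpace_coe

theorem fracConst_pos (hs0 : 0 < s) (hs1 : s < 1) : 0 < fracConst N s := by
  have h1 : 0 < Real.Gamma ((2 * s + N) / 2) := Real.Gamma_pos_of_pos (by positivity)
  have h2 : 0 < Real.Gamma (1 - s) := Real.Gamma_pos_of_pos (by linarith)
  have := Real.pi_pos
  unfold fracConst
  positivity

theorem gagliardo_mul (u v : E N → ℝ) (p : E N × E N) :
    gagliardo s u p * gagliardo s v p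
      = (u p.1 - u p.2) * (v p.1 - v p.2) / ‖p.1 - p.2‖ ^ ((N : ℝ) + 2 * s) := by
  unfold gagliardo
  by_cases h : p.1 = p.2
  · simp [h]
  · have hn : 0 < ‖p.1 - p.2‖ := norm_pos_iff.mpr (sub_ne_zero.mpr h)
    rw [div_mul_div_comm, ← Real.rpow_add hn]
    congr 2
    ring

theorem fracForm_eq_inner {u v : Ambient N} (hu : u ∈ sobolev N s) (hv : v ∈ sobolev N s) :
    fracForm s u v = fracConst N s / 2 * inner ℝ u.snd v.snd := by
  rw [fracForm, L2.inner_def]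
  congr 1
  refine integral_congr_ae ?_
  filter_upwards [mem_sobolev.mp hu, mem_sobolev.mp hv] with p h1 h2
  rw [h1, h2, ← gagliardo_mul]
  simp [mul_comm]

/-- The Gagliardo quotient, as a map on the energy space. -/
noncomputable def sndCLM (s : ℝ) (Ω : Set (E N)) : sobolevZero s Ω →L[ℝ] Lp ℝ 2 (volume : Measure (E N × E N)) :=
  WithLp.sndL 2 ℝ (L2 N) _ ∘L (sobolevZero s Ω).subtypeL

/-- The form `𝓕` on the energy space. -/
noncomputable def energyForm (s : ℝ) (Ω : Set (E N)) : sobolevZero s Ω →L[ℝ] sobolevZero s Ω →L[ℝ] ℝ :=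
  (fracConst N s / 2) • ((innerSL ℝ).bilinearComp (sndCLM s Ω) (sndCLM s Ω))

theorem energyForm_apply (v w : sobolevZero s Ω) :
    energyForm s Ω v w = fracForm s (v : Ambient N) (w : Ambient N) := by
  rw [fracForm_eq_inner (mem_sobolevZero.mp v.2).1 (mem_sobolevZero.mp w.2).1]
  rfl

theorem toL2_coeFn (v : sobolevZero s Ω) :
    toL2 s Ω v =ᵐ[volume.restrict Ω] ((v : Ambient N).fst : E N → ℝ) :=
  LpToLpRestrictCLM_coeFn ℝ Ω _

theorem restr_coeFn (u : L2 N) : restr Ω u =ᵐ[volume.restrict Ω] u :=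
  LpToLpRestrictCLM_coeFn ℝ Ω _

theorem toL2_injective (hΩ : MeasurableSet Ω) : Function.Injective (toL2 s Ω) := by
  rw [injective_iff_map_eq_zero]
  intro v hv
  have h1 : ∀ᵐ x ∂(volume.restrict Ω), (v : Ambient N).fst x = 0 := by
    have h0 := Lp.coeFn_zero ℝ 2 (volume.restrict Ω)
    rw [← hv] at h0
    filter_upwards [h0, toL2_coeFn v] with x h2 h3
    rw [← h3, h2, Pi.zero_apply]
  rw [ae_restrict_iff' hΩ] at h1
  have h2 : (v : Ambient N).fst = 0 := by
    refine Lp.ext ?_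
    filter_upwards [h1, (mem_sobolevZero.mp v.2).2, Lp.coeFn_zero ℝ 2 (volume : Measure (E N))]
      with x h3 h4 h5
    rw [h5, Pi.zero_apply]
    by_cases hx : x ∈ Ω
    · exact h3 hx
    · exact h4 hx
  have h3 : (v : Ambient N).snd = 0 := by
    refine Lp.ext ?_
    have h4 := gagliardo_congr s (Lp.coeFn_zero ℝ 2 (volume : Measure (E N)))
    filter_upwards [mem_sobolev.mp (mem_sobolevZero.mp v.2).1, h4,
      Lp.coeFn_zero ℝ 2 (volume : Measure (E N × E N))] with p h5 h6 h7
    rw [h5, h2, h6, h7]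
    simp [gagliardo]
  refine Subtype.ext ?_
  have : ‖(v : Ambient N)‖ ^ 2 = 0 := by
    rw [WithLp.prod_norm_sq_eq_of_L2, h2, h3]
    simp
  simpa using this

/-! ### The Poincaré inequality and coercivity -/

theorem norm_sq_eq_integral {X : Type*} [MeasurableSpace X] {μ : Measure X} (f : Lp ℝ 2 μ) :
    ‖f‖ ^ 2 = ∫ x, f x ^ 2 ∂μ := by
  rw [← real_inner_self_eq_norm_sq, L2.inner_def]
  simp [sq]

theorem integrable_sq {X : Type*} [MeasurableSpace X] {μ : Measure X} (f : Lp ℝ 2 μ) :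
    Integrable (fun x => f x ^ 2) μ := (Lp.memLp f).integrable_sq

theorem norm_snd_sq {v : Ambient N} (hv : v ∈ sobolev N s) :
    ‖v.snd‖ ^ 2 = ∫ p : E N × E N, gagliardo s v.fst p ^ 2 := by
  rw [norm_sq_eq_integral]
  refine integral_congr_ae ?_
  filter_upwards [mem_sobolev.mp hv] with p hp
  rw [hp]

theorem integrable_gagliardo_sq {v : Ambient N} (hv : v ∈ sobolev N s) :
    Integrable (fun p : E N × E N => gagliardo s v.fst p ^ 2) := by
  refine (integrable_sq v.snd).congr ?_
  filter_upwards [mem_sobolev.mp hv] with p hp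
  rw [hp]

/-- The Poincaré inequality. -/
theorem exists_poincare (hN : 0 < N) (hs0 : 0 < s) (hΩ : MeasurableSet Ω)
    (hΩb : Bornology.IsBounded Ω) :
    ∃ K : ℝ, 0 ≤ K ∧ ∀ v : Ambient N, v ∈ sobolevZero s Ω → ‖v.fst‖ ^ 2 ≤ K * ‖v.snd‖ ^ 2 := by
  obtain ⟨r, hr0, hr⟩ := hΩb.subset_ball_lt 0 (0 : E N)
  -- The unit ball around e misses Ω, so v = 0 there. For x in Ω and y in this ball, |x - y| ≤ r +
  -- (r + 2) = D, hence v(x)² ≤ D^q · gagliardo(x,y)². Integration over Ω × B gives the inequality.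
  let e : E N := EuclideanSpace.single ⟨0, hN⟩ (r + 1)
  have he : ‖e‖ = r + 1 := by
    simp only [e, PiLp.norm_single, Real.norm_eq_abs]
    exact abs_of_pos (by linarith)
  let B : Set (E N) := Metric.ball e 1
  have hB : MeasurableSet B := measurableSet_ball
  have hBΩ : ∀ y ∈ B, y ∉ Ω := by
    intro y hy hyΩ
    have h1 := hr hyΩ
    rw [mem_ball_zero_iff] at h1
    rw [mem_ball_iff_norm'] at hy
    have := norm_le_norm_add_norm_sub' e y
    rw [he] at this
    linarith
  set D : ℝ := 2 * r + 2
  have hD : 0 < D := by positivity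
  have hdist : ∀ x ∈ Ω, ∀ y ∈ B, ‖x - y‖ ≤ D := by
    intro x hx y hy
    have h1 := hr hx
    rw [mem_ball_zero_iff] at h1
    rw [mem_ball_iff_norm] at hy
    have h2 := norm_sub_le x y
    have h3 := norm_le_norm_add_norm_sub' y e
    rw [he] at h3
    simp only [D]
    linarith
  have hvB : 0 < volume.real B := ENNReal.toReal_pos
    (Metric.measure_ball_pos volume e one_pos).ne' measure_ball_lt_top.ne
  set q : ℝ := (N : ℝ) + 2 * s
  have hq : 0 < q := by positivity
  refine ⟨D ^ q / volume.real B, by positivity, fun v hv => ?_⟩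
  obtain ⟨hvs, hv0⟩ := mem_sobolevZero.mp hv
  have e1 : ‖v.fst‖ ^ 2 = ∫ x in Ω, v.fst x ^ 2 := by
    rw [norm_sq_eq_integral, ← integral_indicator hΩ]
    refine integral_congr_ae ?_
    filter_upwards [hv0] with x hx
    by_cases h : x ∈ Ω
    · simp [h]
    · simp [h, hx h]
  have e2 : ∫ p in Ω ×ˢ B, v.fst p.1 ^ 2 * 1 = (∫ x in Ω, v.fst x ^ 2) * volume.real B :=
    (setIntegral_prod_mul (fun x => v.fst x ^ 2) (fun _ : E N => (1 : ℝ)) Ω B).trans (by simp)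
  have hBint : IntegrableOn (fun _ : E N => (1 : ℝ)) B :=
    integrableOn_const measure_ball_lt_top.ne
  have hint : IntegrableOn (fun p : E N × E N => v.fst p.1 ^ 2 * 1) (Ω ×ˢ B) := by
    have h := ((integrable_sq v.fst).integrableOn (s := Ω)).mul_prod hBint
    rw [Measure.prod_restrict] at h
    exact h
  have e3 : ∫ p in Ω ×ˢ B, v.fst p.1 ^ 2 * 1 ≤ ∫ p in Ω ×ˢ B, D ^ q * gagliardo s v.fst p ^ 2 := by
    refine setIntegral_mono_ae_restrict hint
      (((integrable_gagliardo_sq hvs).const_mul _).integrableOn) ?_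
    have h2 : ∀ᵐ p : E N × E N, p.2 ∉ Ω → v.fst p.2 = 0 :=
      Measure.quasiMeasurePreserving_snd.ae hv0
    filter_upwards [ae_restrict_of_ae h2, ae_restrict_mem (hΩ.prod hB)] with p hp hpm
    have hz := hp (hBΩ _ hpm.2)
    have hne : p.1 ≠ p.2 := fun h => hBΩ _ hpm.2 (h ▸ hpm.1)
    have hn : 0 < ‖p.1 - p.2‖ := norm_pos_iff.mpr (sub_ne_zero.mpr hne)
    have hle := Real.rpow_le_rpow hn.le (hdist _ hpm.1 _ hpm.2) hq.le
    rw [sq (gagliardo s _ p), gagliardo_mul, hz, sub_zero, mul_one, ← sq, mul_div_assoc',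
      le_div_iff₀ (Real.rpow_pos_of_pos hn _), mul_comm]
    exact mul_le_mul_of_nonneg_right hle (sq_nonneg _)
  have e4 : ∫ p in Ω ×ˢ B, D ^ q * gagliardo s v.fst p ^ 2 ≤ D ^ q * ‖v.snd‖ ^ 2 := by
    rw [integral_const_mul, norm_snd_sq hvs]
    refine mul_le_mul_of_nonneg_left ?_ (by positivity)
    exact setIntegral_le_integral (integrable_gagliardo_sq hvs)
      (Eventually.of_forall fun p => sq_nonneg _)
  rw [div_mul_eq_mul_div, le_div_iff₀ hvB, e1, ← e2]
  exact e3.trans e4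

theorem isCoercive_energyForm (hN : 0 < N) (hs0 : 0 < s) (hs1 : s < 1) (hΩ : MeasurableSet Ω)
    (hΩb : Bornology.IsBounded Ω) : IsCoercive (energyForm s Ω) := by
  obtain ⟨K, hK, h⟩ := exists_poincare hN hs0 hΩ hΩb
  have hC := fracConst_pos (N := N) hs0 hs1
  refine ⟨fracConst N s / 2 / (K + 1), by positivity, fun v => ?_⟩
  have h1 := h v v.2
  rw [energyForm_apply, fracForm_eq_inner (mem_sobolevZero.mp v.2).1 (mem_sobolevZero.mp v.2).1,
    real_inner_self_eq_norm_sq, mul_assoc, ← sq]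
  have h2 : ‖v‖ ^ 2 = ‖(v : Ambient N).fst‖ ^ 2 + ‖(v : Ambient N).snd‖ ^ 2 :=
    WithLp.prod_norm_sq_eq_of_L2 _
  rw [h2, div_mul_eq_mul_div, div_le_iff₀ (by positivity), mul_assoc]
  refine mul_le_mul_of_nonneg_left ?_ (by positivity)
  linarith

theorem energyForm_symm (v w : sobolevZero s Ω) : energyForm s Ω v w = energyForm s Ω w v := by
  rw [energyForm_apply, energyForm_apply,
    fracForm_eq_inner (mem_sobolevZero.mp v.2).1 (mem_sobolevZero.mp w.2).1,
    fracForm_eq_inner (mem_sobolevZero.mp w.2).1 (mem_sobolevZero.mp v.2).1, real_inner_comm]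

/-- The indicators of infinitely many disjoint nonempty open subsets of Ω are orthogonal and
nonzero. This is what permits an eigenbasis indexed by ℕ. -/
theorem not_finiteDimensional_L2On (hN : 0 < N) (hΩo : IsOpen Ω) (hΩn : Ω.Nonempty)
    (hΩb : Bornology.IsBounded Ω) : ¬ FiniteDimensional ℝ (L2On Ω) := by
  have : Nonempty (Fin N) := ⟨⟨0, hN⟩⟩
  have hnt : Nontrivial (E N) :=
    ⟨⟨0, EuclideanSpace.single ⟨0, hN⟩ 1, fun h => by
      simpa using congrArg (fun x : E N => x ⟨0, hN⟩) h⟩⟩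
  obtain ⟨x, hx⟩ := hΩn
  have hinf : Infinite Ω := (infinite_of_mem_nhds x (hΩo.mem_nhds hx)).to_subtype
  obtain ⟨U, hUi, hUo, hUd⟩ := exists_seq_infinite_isOpen_pairwise_disjoint Ω
  let W : ℕ → Set (E N) := fun n => Subtype.val '' U n
  have hWo : ∀ n, IsOpen (W n) := fun n => hΩo.isOpenMap_subtype_val _ (hUo n)
  have hWΩ : ∀ n, W n ⊆ Ω := by
    rintro n _ ⟨y, -, rfl⟩
    exact y.2
  have hWd : ∀ m n, m ≠ n → W m ∩ W n = ∅ := fun m n h => by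
    rw [← Set.image_inter Subtype.val_injective, (hUd h).inter_eq, image_empty]
  have hWfin : ∀ n, volume.restrict Ω (W n) ≠ ⊤ := fun n =>
    ((measure_mono (hWΩ n)).trans_lt (by
      rw [Measure.restrict_apply_self]
      exact hΩb.measure_lt_top)).ne
  have hWpos : ∀ n, 0 < volume.real (W n) := fun n => by
    refine ENNReal.toReal_pos ((hWo n).measure_pos volume ?_).ne'
      ((measure_mono (hWΩ n)).trans_lt hΩb.measure_lt_top).ne
    exact (hUi n).nonempty.image _
  let f : ℕ → L2On Ω := fun n => indicatorConstLp 2 (hWo n).measurableSet (hWfin n) (1 : ℝ)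
  have hin : ∀ m n, inner ℝ (f m) (f n) = volume.real (W m ∩ W n) := by
    intro m n
    have : W m ∩ W n ⊆ Ω := inter_subset_left.trans (hWΩ m)
    simp only [f]
    rw [L2.inner_indicatorConstLp_indicatorConstLp (hWo m).measurableSet (hWo n).measurableSet
      (hWfin m) (hWfin n)]
    simp [Measure.real, Measure.restrict_apply ((hWo m).inter (hWo n)).measurableSet,
      inter_eq_left.mpr this]
  have hli : LinearIndependent ℝ f := by
    refine linearIndependent_of_ne_zero_of_inner_eq_zero (𝕜 := ℝ) (fun n h => ?_) fun m n h => ?_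
    · have h1 := hin n n
      rw [h, inter_self, inner_zero_left] at h1
      exact (hWpos n).ne h1
    · show inner ℝ (f m) (f n) = 0
      rw [hin, hWd m n h]
      simp
  intro hfd
  exact Set.infinite_univ (α := ℕ) (Set.finite_univ_iff.mpr hli.finite)

end NonlocalMGT

/-! ### Smooth functions in the energy space -/

namespace NonlocalMGT

variable {N : ℕ} {s : ℝ} {Ω : Set (E N)}

theorem nontrivial_of_pos (hN : 0 < N) : Nontrivial (E N) :=
  ⟨⟨0, EuclideanSpace.single ⟨0, hN⟩ 1, fun h => by
    simpa using congrArg (fun x : E N => x ⟨0, hN⟩) h⟩⟩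

/-- The truncated kernel `min(1, |z|²) / |z|^{N + 2s}`. -/
noncomputable def truncKernel (N : ℕ) (s : ℝ) (z : E N) : ℝ :=
  min 1 (‖z‖ ^ 2) / ‖z‖ ^ ((N : ℝ) + 2 * s)

theorem truncKernel_nonneg (z : E N) : 0 ≤ truncKernel N s z :=
  div_nonneg (le_min zero_le_one (sq_nonneg _)) (Real.rpow_nonneg (norm_nonneg _) _)

/-- In polar coordinates the integrand is r^{1-2s} on (0,1), integrable since s < 1, and r^{-1-2s}
beyond 1, integrable since s > 0. -/
theorem integrable_truncKernel (hN : 0 < N) (hs0 : 0 < s) (hs1 : s < 1) :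
    Integrable (truncKernel N s) := by
  have := nontrivial_of_pos hN
  refine (integrable_fun_norm_addHaar (volume : Measure (E N))
    (f := fun r : ℝ => min 1 (r ^ 2) / r ^ ((N : ℝ) + 2 * s))).mpr ?_
  rw [finrank_euclideanSpace_fin]
  have hpow : ∀ r : ℝ, 0 < r → r ^ (N - 1) = r ^ ((N : ℝ) - 1) := by
    intro r hr
    rw [← Real.rpow_natCast, Nat.cast_sub hN, Nat.cast_one]
  have hU : Ioi (0 : ℝ) = Ioo 0 1 ∪ Ici 1 := (Ioo_union_Ici_eq_Ioi zero_lt_one).symm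
  rw [hU, integrableOn_union]
  constructor
  · have h := (intervalIntegral.integrableOn_Ioo_rpow_iff (s := 1 - 2 * s) zero_lt_one).mpr
      (by linarith)
    refine h.congr_fun (fun r hr => ?_) measurableSet_Ioo
    have hr0 : 0 < r := hr.1
    have h1 : min 1 (r ^ 2) = r ^ (2 : ℝ) := by
      rw [min_eq_right (pow_le_one₀ hr0.le hr.2.le)]
      norm_cast
    simp only [smul_eq_mul]
    rw [h1, hpow r hr0, ← Real.rpow_sub hr0, ← Real.rpow_add hr0]
    congr 1
    ring
  · have h := integrableOn_Ioi_rpow_of_lt (a := -1 - 2 * s) (by linarith) zero_lt_one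
    rw [integrableOn_Ici_iff_integrableOn_Ioi]
    refine h.congr_fun (fun r hr => ?_) measurableSet_Ioi
    have hr1 : 1 < r := hr
    have hr0 : 0 < r := zero_lt_one.trans hr1
    simp only [smul_eq_mul]
    rw [min_eq_left (one_le_pow₀ hr1.le), hpow r hr0, ← Real.rpow_zero r, ← Real.rpow_sub hr0,
      ← Real.rpow_add hr0]
    congr 1
    ring

theorem integrable_mul_truncKernel (hN : 0 < N) (hs0 : 0 < s) (hs1 : s < 1) {f : E N → ℝ}
    (hf : Integrable f) :
    Integrable (fun p : E N × E N => f p.2 * truncKernel N s (p.1 - p.2)) :=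
  hf.convolution_integrand (ContinuousLinearMap.mul ℝ ℝ) (integrable_truncKernel hN hs0 hs1)

theorem truncKernel_sub_comm (x y : E N) : truncKernel N s (x - y) = truncKernel N s (y - x) := by
  unfold truncKernel
  rw [norm_sub_rev]

theorem integrable_mul_truncKernel' (hN : 0 < N) (hs0 : 0 < s) (hs1 : s < 1) {f : E N → ℝ}
    (hf : Integrable f) :
    Integrable (fun p : E N × E N => f p.1 * truncKernel N s (p.1 - p.2)) := by
  have h := (integrable_mul_truncKernel hN hs0 hs1 hf).swap
  refine h.congr (Eventually.of_forall fun p => ?_)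
  simp [truncKernel_sub_comm p.1]

theorem measurable_gagliardo {ψ : E N → ℝ} (hψ : Measurable ψ) : Measurable (gagliardo s ψ) := by
  unfold gagliardo
  fun_prop

/-- Smooth functions with compact support belong to the fractional Sobolev space. -/
theorem exists_sobolev_of_contDiff (hN : 0 < N) (hs0 : 0 < s) (hs1 : s < 1) {ψ : E N → ℝ}
    (hψ : ContDiff ℝ ∞ ψ) (hc : HasCompactSupport ψ) :
    ∃ u : Ambient N, u ∈ sobolev N s ∧ (u.fst : E N → ℝ) =ᵐ[volume] ψ := by
  obtain ⟨L, hL⟩ := ContDiff.lipschitzWith_of_hasCompactSupport hc hψ (by simp)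
  obtain ⟨M, hM⟩ := hc.exists_bound_of_continuous hψ.continuous
  have hM0 : 0 ≤ M := (norm_nonneg _).trans (hM 0)
  set A : ℝ := 4 * M ^ 2 + (L : ℝ) ^ 2
  have hK : IsCompact (tsupport ψ) := hc
  let χ : E N → ℝ := (tsupport ψ).indicator fun _ => 1
  have hχ : Integrable χ := (integrable_indicator_iff hK.measurableSet).mpr
    (integrableOn_const hK.measure_lt_top.ne)
  have hχ0 : ∀ x, 0 ≤ χ x := fun x => indicator_nonneg (fun _ _ => zero_le_one) x
  -- The bound 4M² serves distant points and the Lipschitz bound close ones. The factor χ(x) + χ(y)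
  -- records that one point lies in the support, which makes the product with the truncated kernel
  -- integrable on the product space.
  have hbd : ∀ x y, (ψ x - ψ y) ^ 2 ≤ A * min 1 (‖x - y‖ ^ 2) * (χ x + χ y) := by
    intro x y
    by_cases h : x ∈ tsupport ψ ∨ y ∈ tsupport ψ
    · have h1 : 1 ≤ χ x + χ y := by
        rcases h with h | h
        · have := hχ0 y
          have h2 : χ x = 1 := indicator_of_mem h _
          linarith
        · have := hχ0 x
          have h2 : χ y = 1 := indicator_of_mem h _
          linarith
      have h2 : (ψ x - ψ y) ^ 2 ≤ A * min 1 (‖x - y‖ ^ 2) := by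
        have hA : 0 ≤ A := by positivity
        rw [mul_min_of_nonneg _ _ hA]
        refine le_min ?_ ?_
        · have hx := abs_le.mp (hM x)
          have hy := abs_le.mp (hM y)
          have h3 : (ψ x - ψ y) ^ 2 ≤ (2 * M) ^ 2 := sq_le_sq' (by linarith) (by linarith)
          have := sq_nonneg (L : ℝ)
          simp only [A]
          nlinarith
        · have h3 := hL.norm_sub_le x y
          rw [Real.norm_eq_abs] at h3
          have h4 : (ψ x - ψ y) ^ 2 ≤ (L * ‖x - y‖) ^ 2 := by
            rw [← sq_abs]
            exact pow_le_pow_left₀ (abs_nonneg _) h3 2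
          have h5 : 0 ≤ 4 * M ^ 2 * ‖x - y‖ ^ 2 := by positivity
          simp only [A]
          nlinarith
      exact h2.trans (le_mul_of_one_le_right ((sq_nonneg _).trans h2) h1)
    · push Not at h
      rw [image_eq_zero_of_notMem_tsupport h.1, image_eq_zero_of_notMem_tsupport h.2, sub_self]
      have := hχ0 x
      have := hχ0 y
      have : 0 ≤ min 1 (‖x - y‖ ^ 2) := le_min zero_le_one (sq_nonneg _)
      have hA : 0 ≤ A := by positivity
      simp only [ne_eq, OfNat.ofNat_ne_zero, not_false_eq_true, zero_pow]
      positivity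
  have hint : Integrable (fun p : E N × E N => gagliardo s ψ p ^ 2) := by
    refine Integrable.mono' (((integrable_mul_truncKernel' hN hs0 hs1 hχ).add
      (integrable_mul_truncKernel hN hs0 hs1 hχ)).const_mul A)
      ((measurable_gagliardo hψ.continuous.measurable).pow_const 2).aestronglyMeasurable
      (Eventually.of_forall fun p => ?_)
    rw [Real.norm_of_nonneg (sq_nonneg _), sq, gagliardo_mul, ← sq]
    have h1 := div_le_div_of_nonneg_right (hbd p.1 p.2)
      (Real.rpow_nonneg (norm_nonneg (p.1 - p.2)) ((N : ℝ) + 2 * s))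
    refine h1.trans (le_of_eq ?_)
    simp only [truncKernel, Pi.add_apply]
    ring
  have hg : MemLp (gagliardo s ψ) 2 (volume : Measure (E N × E N)) :=
    (memLp_two_iff_integrable_sq
      (measurable_gagliardo hψ.continuous.measurable).aestronglyMeasurable).mpr hint
  have hf : MemLp ψ 2 (volume : Measure (E N)) := hψ.continuous.memLp_of_hasCompactSupport hc
  refine ⟨WithLp.toLp 2 (hf.toLp ψ, hg.toLp _), ?_, hf.coeFn_toLp⟩
  rw [mem_sobolev]
  exact hg.coeFn_toLp.trans (gagliardo_congr s hf.coeFn_toLp).symm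

theorem inner_toL2 (f : L2On Ω) (v : sobolevZero s Ω) :
    inner ℝ f (toL2 s Ω v) = ∫ x in Ω, f x * (v : Ambient N).fst x := by
  rw [L2.inner_def]
  refine integral_congr_ae ?_
  filter_upwards [toL2_coeFn v] with x hx
  rw [hx]
  simp [mul_comm]

/-- The range contains all test functions of Ω, and a function orthogonal to these is zero by the
fundamental lemma of the calculus of variations. -/
theorem denseRange_toL2 (hN : 0 < N) (hs0 : 0 < s) (hs1 : s < 1) (hΩo : IsOpen Ω)
    (hΩb : Bornology.IsBounded Ω) : DenseRange (toL2 s Ω) := by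
  have hΩ := hΩo.measurableSet
  have hfin : IsFiniteMeasure ((volume : Measure (E N)).restrict Ω) :=
    ⟨by rw [Measure.restrict_apply_univ]; exact hΩb.measure_lt_top⟩
  have key : (LinearMap.range (toL2 s Ω).toLinearMap).topologicalClosure = ⊤ := by
    rw [Submodule.topologicalClosure_eq_top_iff, Submodule.eq_bot_iff]
    intro h hh
    have horth : ∀ v : sobolevZero s Ω, inner ℝ h (toL2 s Ω v) = 0 := fun v => by
      rw [real_inner_comm]
      exact (Submodule.mem_orthogonal _ _).mp hh _ ⟨v, rfl⟩
    have hint : IntegrableOn h Ω := (Lp.memLp h).integrable one_le_two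
    have hae := hΩo.ae_eq_zero_of_integral_contDiff_smul_eq_zero
      hint.locallyIntegrableOn fun ψ hψ hc hsupp => by
        obtain ⟨u, hu, hu'⟩ := exists_sobolev_of_contDiff hN hs0 hs1 hψ hc
        have huv : u ∈ sobolevZero s Ω := by
          refine mem_sobolevZero.mpr ⟨hu, ?_⟩
          filter_upwards [hu'] with x hx hxΩ
          rw [hx]
          exact image_eq_zero_of_notMem_tsupport fun h => hxΩ (hsupp h)
        have h0 := horth ⟨u, huv⟩
        rw [inner_toL2] at h0
        rw [← h0, ← integral_indicator hΩ]
        refine integral_congr_ae ?_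
        filter_upwards [hu'] with x hx
        by_cases hxΩ : x ∈ Ω
        · rw [indicator_of_mem hxΩ, hx, smul_eq_mul, mul_comm]
        · rw [indicator_of_notMem hxΩ,
            image_eq_zero_of_notMem_tsupport (fun h => hxΩ (hsupp h)), zero_smul]
    refine Lp.ext ?_
    filter_upwards [(ae_restrict_iff' hΩ).mpr hae, Lp.coeFn_zero ℝ 2 (volume.restrict Ω)]
      with x h1 h2
    rw [h1, h2, Pi.zero_apply]
  have h := Submodule.dense_iff_topologicalClosure_eq_top.mpr key
  rwa [LinearMap.coe_range] at h

end NonlocalMGT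

/-! ### The compact embedding -/

theorem isCompactOperator_of_approx {X Y : Type*} [NormedAddCommGroup X] [NormedSpace ℝ X]
    [NormedAddCommGroup Y] [NormedSpace ℝ Y] [CompleteSpace Y] {J : X →L[ℝ] Y}
    (h : ∀ η > 0, ∃ F : X →L[ℝ] Y, IsCompactOperator F ∧ ∀ x, ‖J x - F x‖ ≤ η * ‖x‖) :
    IsCompactOperator J := by
  refine isClosed_setOfPred_isCompactOperator.closure_subset
    (Metric.mem_closure_iff.mpr fun η hη => ?_)
  obtain ⟨F, hF, hle⟩ := h (η / 2) (half_pos hη)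
  refine ⟨F, hF, ?_⟩
  rw [dist_eq_norm]
  exact (ContinuousLinearMap.opNorm_le_bound _ (half_pos hη).le hle).trans_lt (half_lt_self hη)

theorem isCompactOperator_sum_smulRight {X ι : Type*} [NormedAddCommGroup X] [NormedSpace ℝ X]
    (I : Finset ι) (l : ι → X →L[ℝ] ℝ) (e : ι → X) :
    IsCompactOperator (∑ k ∈ I, (l k).smulRight (e k) : X →L[ℝ] X) := by
  refine Submodule.sum_mem (compactOperator (RingHom.id ℝ) X X) fun k _ => ?_
  exact (isCompactOperator_of_locallyCompactSpace_dom (l k)).clm_comp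
    (ContinuousLinearMap.toSpanSingleton ℝ (e k))

namespace NonlocalMGT

variable {N : ℕ} {s : ℝ} {Ω : Set (E N)}

/-- The cube of side `ε` with lower corner `ε k`. -/
def cube (ε : ℝ) (k : Fin N → ℤ) : Set (E N) :=
  (WithLp.ofLp : E N → Fin N → ℝ) ⁻¹' (univ.pi fun i => Ico (ε * k i) (ε * (k i + 1)))

theorem mem_cube {ε : ℝ} {k : Fin N → ℤ} {x : E N} :
    x ∈ cube ε k ↔ ∀ i, ε * k i ≤ x i ∧ x i < ε * (k i + 1) := by
  simp [cube]

theorem measurableSet_cube (ε : ℝ) (k : Fin N → ℤ) : MeasurableSet (cube ε k) :=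
  (PiLp.volume_preserving_ofLp (Fin N)).measurable
    (MeasurableSet.univ_pi fun _ => measurableSet_Ico)

theorem volume_cube {ε : ℝ} (hε : 0 ≤ ε) (k : Fin N → ℤ) :
    volume (cube ε k) = ENNReal.ofReal (ε ^ N) := by
  rw [cube, (PiLp.volume_preserving_ofLp (Fin N)).measure_preimage
    (MeasurableSet.univ_pi fun _ => measurableSet_Ico).nullMeasurableSet, Real.volume_pi_Ico]
  simp only [← mul_sub, add_sub_cancel_left, mul_one]
  rw [Finset.prod_const, Finset.card_univ, Fintype.card_fin, ENNReal.ofReal_pow hε]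

theorem mem_cube_floor {ε : ℝ} (hε : 0 < ε) (x : E N) : x ∈ cube ε fun i => ⌊x i / ε⌋ := by
  rw [mem_cube]
  intro i
  constructor
  · rw [mul_comm, ← le_div_iff₀ hε]
    exact Int.floor_le _
  · rw [mul_comm, ← div_lt_iff₀ hε]
    exact Int.lt_floor_add_one _

theorem eq_floor_of_mem_cube {ε : ℝ} (hε : 0 < ε) {k : Fin N → ℤ} {x : E N} (hx : x ∈ cube ε k) :
    k = fun i => ⌊x i / ε⌋ := by
  rw [mem_cube] at hx
  funext i
  refine (Int.floor_eq_iff.mpr ⟨?_, ?_⟩).symm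
  · rw [le_div_iff₀ hε, mul_comm]
    exact (hx i).1
  · rw [div_lt_iff₀ hε, mul_comm]
    exact (hx i).2

theorem disjoint_cube {ε : ℝ} (hε : 0 < ε) {k l : Fin N → ℤ} (h : k ≠ l) :
    Disjoint (cube ε k) (cube ε l) := by
  rw [Set.disjoint_left]
  intro x hk hl
  exact h ((eq_floor_of_mem_cube hε hk).trans (eq_floor_of_mem_cube hε hl).symm)

theorem norm_sub_le_of_mem_cube {ε : ℝ} (hε : 0 < ε) {k : Fin N → ℤ} {x y : E N}
    (hx : x ∈ cube ε k) (hy : y ∈ cube ε k) : ‖x - y‖ ≤ N * ε := by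
  rw [mem_cube] at hx hy
  rw [EuclideanSpace.norm_eq]
  refine Real.sqrt_le_iff.mpr ⟨by positivity, ?_⟩
  have h1 : ∀ i ∈ Finset.univ, ‖(x - y) i‖ ^ 2 ≤ ε ^ 2 := by
    intro i _
    have h2 := hx i
    have h3 := hy i
    rw [PiLp.sub_apply, Real.norm_eq_abs, sq_abs]
    exact sq_le_sq' (by linarith) (by linarith)
  refine (Finset.sum_le_sum h1).trans ?_
  rw [Finset.sum_const, Finset.card_univ, Fintype.card_fin, nsmul_eq_mul, mul_pow]
  refine mul_le_mul_of_nonneg_right ?_ (sq_nonneg _)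
  have : (N : ℝ) ≤ (N : ℝ) ^ 2 := by
    exact_mod_cast Nat.le_self_pow (by norm_num) N
  exact this

theorem finite_cubes {ε : ℝ} (hε : 0 < ε) (hΩb : Bornology.IsBounded Ω) :
    ∃ I : Finset (Fin N → ℤ), Ω ⊆ ⋃ k ∈ I, cube ε k := by
  obtain ⟨r, hr0, hr⟩ := hΩb.subset_closedBall_lt 0 (0 : E N)
  refine ⟨Finset.Icc (fun _ => ⌊-r / ε⌋) fun _ => ⌊r / ε⌋, fun x hx => ?_⟩
  have hx' := hr hx
  rw [mem_closedBall_zero_iff] at hx'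
  refine mem_biUnion (x := fun i => ⌊x i / ε⌋) ?_ (mem_cube_floor hε x)
  have hxi : ∀ i, |x i| ≤ r := fun i => (PiLp.norm_apply_le x i).trans hx'
  refine Finset.mem_coe.mpr (Finset.mem_Icc.mpr ⟨fun i => ?_, fun i => ?_⟩)
  · exact Int.floor_mono (div_le_div_of_nonneg_right (abs_le.mp (hxi i)).1 hε.le)
  · exact Int.floor_mono (div_le_div_of_nonneg_right (abs_le.mp (hxi i)).2 hε.le)

/-- The variance as a double integral of squared differences: this links the distance of f to its
mean over a cube with the Gagliardo quotient. -/
theorem integral_prod_sub_sq {X : Type*} [MeasurableSpace X] {μ : Measure X} [IsFiniteMeasure μ]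
    {f : X → ℝ} (hf : MemLp f 2 μ) :
    ∫ p : X × X, (f p.1 - f p.2) ^ 2 ∂(μ.prod μ)
      = 2 * (μ.real univ * ∫ x, f x ^ 2 ∂μ) - 2 * (∫ x, f x ∂μ) ^ 2 := by
  have i1 : Integrable f μ := hf.integrable one_le_two
  have i2 : Integrable (fun x => f x ^ 2) μ := hf.integrable_sq
  have i3 : Integrable (fun _ : X => (1 : ℝ)) μ := integrable_const 1
  have j1 := i2.mul_prod i3
  have j2 := i3.mul_prod i2
  have j3 := i1.mul_prod i1
  have e : ∀ p : X × X, (f p.1 - f p.2) ^ 2 = f p.1 ^ 2 * 1 + 1 * f p.2 ^ 2 - 2 * (f p.1 * f p.2) :=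
    fun p => by ring
  simp only [e]
  have j4 : Integrable (fun z : X × X => f z.1 ^ 2 * 1 + 1 * f z.2 ^ 2) (μ.prod μ) := j1.add j2
  rw [integral_sub j4 (j3.const_mul 2), integral_add j1 j2,
    integral_prod_mul (fun x => f x ^ 2) (fun _ => (1 : ℝ)),
    integral_prod_mul (fun _ => (1 : ℝ)) (fun x => f x ^ 2), integral_const_mul,
    integral_prod_mul f f]
  simp
  ring

/-- Averaging over the cubes of a grid approximates functions of the energy space. -/
theorem exists_orthonormal_average (hΩb : Bornology.IsBounded Ω) (hs0 : 0 < s) {ε : ℝ} (hε : 0 < ε) :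
    ∃ (I : Finset (Fin N → ℤ)) (e : (Fin N → ℤ) → L2 N), ∀ v : Ambient N, v ∈ sobolevZero s Ω →
      ‖v.fst - ∑ k ∈ I, (inner ℝ (e k) v.fst : ℝ) • e k‖ ^ 2
        ≤ (N * ε) ^ ((N : ℝ) + 2 * s) / (2 * ε ^ N) * ‖v.snd‖ ^ 2 := by
  classical
  obtain ⟨I, hI⟩ := finite_cubes hε hΩb
  set m : ℝ := ε ^ N
  have hm : 0 < m := by positivity
  have hvol : ∀ k, volume (cube ε k : Set (E N)) ≠ ⊤ := fun k => by
    rw [volume_cube hε.le]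
    exact ENNReal.ofReal_ne_top
  have hvolr : ∀ k, volume.real (cube ε k : Set (E N)) = m := fun k => by
    rw [Measure.real, volume_cube hε.le, ENNReal.toReal_ofReal hm.le]
  let e : (Fin N → ℤ) → L2 N := fun k =>
    indicatorConstLp 2 (measurableSet_cube ε k) (hvol k) (Real.sqrt m)⁻¹
  have he : Orthonormal ℝ e := by
    rw [orthonormal_iff_ite]
    intro k l
    simp only [e]
    rw [L2.inner_indicatorConstLp_indicatorConstLp (measurableSet_cube ε k) (measurableSet_cube ε l)
      (hvol k) (hvol l)]
    split_ifs with h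
    · subst h
      rw [inter_self, hvolr]
      simp [Real.sq_sqrt hm.le, hm.ne']
    · rw [(disjoint_cube hε h).inter_eq]
      simp
  refine ⟨I, e, fun v hv => ?_⟩
  obtain ⟨hvs, hv0⟩ := mem_sobolevZero.mp hv
  set f : L2 N := v.fst
  set q : ℝ := (N : ℝ) + 2 * s
  have hq : 0 < q := by positivity
  have h1 : ‖f - ∑ k ∈ I, (inner ℝ (e k) f : ℝ) • e k‖ ^ 2
      = ‖f‖ ^ 2 - ∑ k ∈ I, (inner ℝ (e k) f : ℝ) ^ 2 := by
    have h2 : ‖∑ k ∈ I, (inner ℝ (e k) f : ℝ) • e k‖ ^ 2 = ∑ k ∈ I, (inner ℝ (e k) f : ℝ) ^ 2 := by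
      rw [← real_inner_self_eq_norm_sq, he.inner_sum]
      simp [sq]
    rw [norm_sub_sq_real, h2, inner_sum]
    simp only [inner_smul_right, real_inner_comm, ← sq]
    ring
  have hcoef : ∀ k, (inner ℝ (e k) f : ℝ) ^ 2 = m⁻¹ * (∫ x in cube ε k, f x) ^ 2 := by
    intro k
    simp only [e]
    have hin : ∀ a b : ℝ, (inner ℝ a b : ℝ) = b * a := fun a b => by simp
    rw [L2.inner_indicatorConstLp_eq_inner_setIntegral, hin, mul_pow, inv_pow, Real.sq_sqrt hm.le]
    ring
  have hdisj : Set.PairwiseDisjoint (I : Set (Fin N → ℤ)) fun k => (cube ε k : Set (E N)) :=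
    fun k _ l _ h => disjoint_cube hε h
  have hnorm : ‖f‖ ^ 2 = ∑ k ∈ I, ∫ x in cube ε k, f x ^ 2 := by
    rw [norm_sq_eq_integral, ← integral_biUnion_finset I (fun k _ => measurableSet_cube ε k) hdisj
      (fun k _ => (integrable_sq f).integrableOn), ← integral_indicator
      (Finset.measurableSet_biUnion I fun k _ => measurableSet_cube ε k)]
    refine integral_congr_ae ?_
    filter_upwards [hv0] with x hx
    by_cases h : x ∈ ⋃ k ∈ I, cube ε k
    · rw [indicator_of_mem h]
    · rw [indicator_of_notMem h, hx fun hxΩ => h (hI hxΩ)]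
      simp
  -- Two points of one cube satisfy |x - y| ≤ Nε, so (f(x) - f(y))² ≤ (Nε)^q · gagliardo². The left
  -- side is the squared error of averaging on that cube.
  have hloc : ∀ k, (∫ x in cube ε k, f x ^ 2) - m⁻¹ * (∫ x in cube ε k, f x) ^ 2
      ≤ (N * ε) ^ q / (2 * m) * ∫ p in cube ε k ×ˢ cube ε k, gagliardo s f p ^ 2 := by
    intro k
    have hfin : IsFiniteMeasure ((volume : Measure (E N)).restrict (cube ε k)) :=
      ⟨by rw [Measure.restrict_apply_univ]; exact (hvol k).lt_top⟩
    have hf : MemLp f 2 ((volume : Measure (E N)).restrict (cube ε k)) := (Lp.memLp f).restrict _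
    have h2 := integral_prod_sub_sq hf
    rw [Measure.prod_restrict] at h2
    have hreal : ((volume : Measure (E N)).restrict (cube ε k)).real univ = m := by
      rw [Measure.real, Measure.restrict_apply_univ]
      exact hvolr k
    rw [hreal] at h2
    have h3 : ∫ p in cube ε k ×ˢ cube ε k, (f p.1 - f p.2) ^ 2
        ≤ ∫ p in cube ε k ×ˢ cube ε k, (N * ε) ^ q * gagliardo s f p ^ 2 := by
      refine integral_mono_of_nonneg (Eventually.of_forall fun p => sq_nonneg _)
        (((integrable_gagliardo_sq hvs).const_mul _).integrableOn) ?_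
      filter_upwards [ae_restrict_mem ((measurableSet_cube ε k).prod (measurableSet_cube ε k))]
        with p hp
      by_cases hpe : p.1 = p.2
      · rw [hpe, sub_self]
        have := sq_nonneg (gagliardo s f p)
        simp only [ne_eq, OfNat.ofNat_ne_zero, not_false_eq_true, zero_pow]
        positivity
      · have hn : 0 < ‖p.1 - p.2‖ := norm_pos_iff.mpr (sub_ne_zero.mpr hpe)
        have hle := Real.rpow_le_rpow hn.le (norm_sub_le_of_mem_cube hε hp.1 hp.2) hq.le
        rw [sq (gagliardo s _ p), gagliardo_mul, ← sq, mul_div_assoc',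
          le_div_iff₀ (Real.rpow_pos_of_pos hn _), mul_comm]
        exact mul_le_mul_of_nonneg_right hle (sq_nonneg _)
    rw [integral_const_mul] at h3
    have h4 : ∫ p in cube ε k ×ˢ cube ε k, (f p.1 - f p.2) ^ 2
        = 2 * (m * ∫ x in cube ε k, f x ^ 2) - 2 * (∫ x in cube ε k, f x) ^ 2 := h2
    rw [h4] at h3
    rw [div_mul_eq_mul_div, le_div_iff₀ (by positivity)]
    refine le_trans (le_of_eq ?_) h3
    field_simp
  have hsum : ∑ k ∈ I, ∫ p in cube ε k ×ˢ cube ε k, gagliardo s f p ^ 2 ≤ ‖v.snd‖ ^ 2 := by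
    rw [norm_snd_sq hvs, ← integral_biUnion_finset I
      (fun k _ => (measurableSet_cube ε k).prod (measurableSet_cube ε k))
      (fun k _ l _ h => Set.Disjoint.set_prod_left (disjoint_cube hε h) _ _)
      (fun k _ => (integrable_gagliardo_sq hvs).integrableOn)]
    exact setIntegral_le_integral (integrable_gagliardo_sq hvs)
      (Eventually.of_forall fun p => sq_nonneg _)
  rw [h1, hnorm, ← Finset.sum_sub_distrib]
  simp only [hcoef]
  refine (Finset.sum_le_sum fun k _ => hloc k).trans ?_
  rw [← Finset.mul_sum]
  exact mul_le_mul_of_nonneg_left hsum (by positivity)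

/-- The embedding of the energy space into `L²(Ω)` is compact. -/
theorem isCompactOperator_toL2 (hN : 0 < N) (hs0 : 0 < s) (hΩb : Bornology.IsBounded Ω) :
    IsCompactOperator (toL2 s Ω) := by
  let J : sobolevZero s Ω →L[ℝ] L2 N := WithLp.fstL 2 ℝ (L2 N) _ ∘L (sobolevZero s Ω).subtypeL
  have hJ : IsCompactOperator J := by
    refine isCompactOperator_of_approx fun η hη => ?_
    have hN' : (0 : ℝ) < N := Nat.cast_pos.mpr hN
    set q : ℝ := (N : ℝ) + 2 * s with hq
    -- Solves (Nε)^q / (2ε^N) = η²; as q = N + 2s, the left side is N^q ε^{2s} / 2.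
    set ε : ℝ := (η ^ 2 * 2 / (N : ℝ) ^ q) ^ (1 / (2 * s)) with hεdef
    have hε : 0 < ε := by positivity
    obtain ⟨I, e, he⟩ := exists_orthonormal_average (s := s) hΩb hs0 hε
    let P : L2 N →L[ℝ] L2 N := ∑ k ∈ I, (innerSL ℝ (e k)).smulRight (e k)
    have hP : IsCompactOperator (P ∘L J) :=
      (isCompactOperator_sum_smulRight I (fun k => innerSL ℝ (e k)) e).comp_clm J
    refine ⟨P ∘L J, hP, fun v => ?_⟩
    have h1 := he v v.2
    have h2 : J v - (P ∘L J) v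
        = (v : Ambient N).fst - ∑ k ∈ I, (inner ℝ (e k) (v : Ambient N).fst : ℝ) • e k := by
      simp [J, P]
    have h3 : (N * ε) ^ q / (2 * ε ^ N) = η ^ 2 := by
      rw [Real.mul_rpow hN'.le hε.le, hq, Real.rpow_add hε, Real.rpow_natCast, ← hq]
      have h4 : ε ^ (2 * s) = η ^ 2 * 2 / (N : ℝ) ^ q := by
        rw [hεdef, ← Real.rpow_mul (by positivity), one_div_mul_cancel (by positivity),
          Real.rpow_one]
      rw [h4]
      field_simp
    rw [h3] at h1
    have h5 : ‖(v : Ambient N).snd‖ ^ 2 ≤ ‖v‖ ^ 2 := by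
      have h6 : ‖v‖ ^ 2 = ‖(v : Ambient N).fst‖ ^ 2 + ‖(v : Ambient N).snd‖ ^ 2 :=
        WithLp.prod_norm_sq_eq_of_L2 _
      rw [h6]
      exact le_add_of_nonneg_left (sq_nonneg _)
    rw [h2]
    refine le_of_sq_le_sq ?_ (by positivity)
    rw [mul_pow]
    exact h1.trans (mul_le_mul_of_nonneg_left h5 (sq_nonneg _))
  exact hJ.clm_comp (restr Ω)

end NonlocalMGT

/-! ### The source generated by exterior data -/

namespace NonlocalMGT

variable {N : ℕ} {s : ℝ} {Ω : Set (E N)}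

/-- `k` is measurable and vanishes to second order, with constant `M`, at the points of `Ω`. -/
structure ExtBound (Ω : Set (E N)) (k : E N → ℝ) (M : ℝ) : Prop where
  meas : Measurable k
  bound : ∀ y ∈ Ω, ∀ x, |k x| ≤ M * min 1 (‖x - y‖ ^ 2)

namespace ExtBound

variable {k l : E N → ℝ} {M M' : ℝ}

theorem eq_zero (h : ExtBound Ω k M) {y : E N} (hy : y ∈ Ω) : k y = 0 := by
  simpa using h.bound y hy y

theorem add (h : ExtBound Ω k M) (h' : ExtBound Ω l M') :
    ExtBound Ω (fun x => k x + l x) (M + M') where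
  meas := h.meas.add h'.meas
  bound y hy x := by
    rw [add_mul]
    exact (abs_add_le _ _).trans (add_le_add (h.bound y hy x) (h'.bound y hy x))

theorem const_mul (h : ExtBound Ω k M) (r : ℝ) : ExtBound Ω (fun x => r * k x) (|r| * M) where
  meas := h.meas.const_mul r
  bound y hy x := by
    rw [abs_mul, mul_assoc]
    exact mul_le_mul_of_nonneg_left (h.bound y hy x) (abs_nonneg r)

theorem abs_div_le (h : ExtBound Ω k M) {y : E N} (hy : y ∈ Ω) (x : E N) :
    |k x / ‖x - y‖ ^ ((N : ℝ) + 2 * s)| ≤ M * truncKernel N s (x - y) := by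
  have hr : 0 ≤ ‖x - y‖ ^ ((N : ℝ) + 2 * s) := Real.rpow_nonneg (norm_nonneg _) _
  rw [abs_div, abs_of_nonneg hr, truncKernel, ← mul_div_assoc]
  exact div_le_div_of_nonneg_right (h.bound y hy x) hr

end ExtBound

/-- The function `y ↦ C_{N,s} ∫_{ℝ^N ∖ Ω} k(x) / |x - y|^{N + 2s} dx`. -/
noncomputable def extFun (s : ℝ) (Ω : Set (E N)) (k : E N → ℝ) (y : E N) : ℝ :=
  fracConst N s * ∫ x in Ωᶜ, k x / ‖x - y‖ ^ ((N : ℝ) + 2 * s)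

open Classical in
/-- The class of `extFun` in `L²(Ω)`. -/
noncomputable def extSource (s : ℝ) (Ω : Set (E N)) (k : E N → ℝ) : L2On Ω :=
  -- The default 0 does not occur for data with an `ExtBound` on a bounded measurable Ω when N > 0
  -- and 0 < s < 1.
  if h : MemLp (extFun s Ω k) 2 (volume.restrict Ω) then h.toLp else 0

theorem ExtBound.integrable (hN : 0 < N) (hs0 : 0 < s) (hs1 : s < 1) {k : E N → ℝ} {M : ℝ}
    (h : ExtBound Ω k M) {y : E N} (hy : y ∈ Ω) :
    Integrable fun x => k x / ‖x - y‖ ^ ((N : ℝ) + 2 * s) := by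
  refine Integrable.mono' (((integrable_truncKernel hN hs0 hs1).comp_sub_right y).const_mul M) ?_
    (Eventually.of_forall fun x => h.abs_div_le hy x)
  have := h.meas
  exact Measurable.aestronglyMeasurable (by fun_prop)

/-- The integrand is dominated by M times a translate of the truncated kernel, whose integral does
not depend on y. The bound therefore does not deteriorate as y approaches ∂Ω. -/
theorem ExtBound.abs_extFun_le (hN : 0 < N) (hs0 : 0 < s) (hs1 : s < 1) {k : E N → ℝ} {M : ℝ}
    (h : ExtBound Ω k M) {y : E N} (hy : y ∈ Ω) :
    |extFun s Ω k y| ≤ fracConst N s * (∫ z : E N, truncKernel N s z) * M := by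
  have hC := fracConst_pos (N := N) hs0 hs1
  have hint := ((integrable_truncKernel hN hs0 hs1).comp_sub_right y).const_mul M
  rw [extFun, abs_mul, abs_of_pos hC, mul_assoc]
  refine mul_le_mul_of_nonneg_left ?_ hC.le
  have h1 : |∫ x in Ωᶜ, k x / ‖x - y‖ ^ ((N : ℝ) + 2 * s)|
      ≤ ∫ x in Ωᶜ, |k x / ‖x - y‖ ^ ((N : ℝ) + 2 * s)| := abs_integral_le_integral_abs
  have h2 : ∫ x in Ωᶜ, |k x / ‖x - y‖ ^ ((N : ℝ) + 2 * s)|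
      ≤ ∫ x, |k x / ‖x - y‖ ^ ((N : ℝ) + 2 * s)| :=
    setIntegral_le_integral (h.integrable hN hs0 hs1 hy).abs
      (Eventually.of_forall fun x => abs_nonneg _)
  have h3 : ∫ x, |k x / ‖x - y‖ ^ ((N : ℝ) + 2 * s)| ≤ ∫ x, M * truncKernel N s (x - y) :=
    integral_mono (h.integrable hN hs0 hs1 hy).abs hint fun x => h.abs_div_le hy x
  rw [integral_const_mul, integral_sub_right_eq_self (truncKernel N s) y, mul_comm M] at h3
  exact h1.trans (h2.trans h3)

theorem ExtBound.memLp (hN : 0 < N) (hs0 : 0 < s) (hs1 : s < 1) (hΩ : MeasurableSet Ω)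
    (hΩb : Bornology.IsBounded Ω) {k : E N → ℝ} {M : ℝ} (h : ExtBound Ω k M) :
    MemLp (extFun s Ω k) 2 (volume.restrict Ω) := by
  have : IsFiniteMeasure ((volume : Measure (E N)).restrict Ω) :=
    ⟨by rw [Measure.restrict_apply_univ]; exact hΩb.measure_lt_top⟩
  refine MemLp.of_bound ?_ (fracConst N s * (∫ z : E N, truncKernel N s z) * M) ?_
  · have hm : Measurable fun p : E N × E N => k p.2 / ‖p.2 - p.1‖ ^ ((N : ℝ) + 2 * s) := by
      have := h.meas
      fun_prop
    exact ((hm.stronglyMeasurable.integral_prod_right').const_mul _).aestronglyMeasurable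
  · filter_upwards [ae_restrict_mem hΩ] with y hy
    exact h.abs_extFun_le hN hs0 hs1 hy

theorem ExtBound.extSource_coeFn (hN : 0 < N) (hs0 : 0 < s) (hs1 : s < 1) (hΩ : MeasurableSet Ω)
    (hΩb : Bornology.IsBounded Ω) {k : E N → ℝ} {M : ℝ} (h : ExtBound Ω k M) :
    extSource s Ω k =ᵐ[volume.restrict Ω] extFun s Ω k := by
  rw [extSource, dif_pos (h.memLp hN hs0 hs1 hΩ hΩb)]
  exact MemLp.coeFn_toLp _

theorem ExtBound.extSource_add_mul (hN : 0 < N) (hs0 : 0 < s) (hs1 : s < 1) (hΩ : MeasurableSet Ω)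
    (hΩb : Bornology.IsBounded Ω) {k l : E N → ℝ} {M M' : ℝ} (h : ExtBound Ω k M)
    (h' : ExtBound Ω l M') (r : ℝ) :
    extSource s Ω (fun x => k x + r * l x) = extSource s Ω k + r • extSource s Ω l := by
  refine Lp.ext ?_
  filter_upwards [ae_restrict_mem hΩ, h.extSource_coeFn hN hs0 hs1 hΩ hΩb,
    h'.extSource_coeFn hN hs0 hs1 hΩ hΩb,
    (h.add (h'.const_mul r)).extSource_coeFn hN hs0 hs1 hΩ hΩb,
    Lp.coeFn_add (extSource s Ω k) (r • extSource s Ω l), Lp.coeFn_smul r (extSource s Ω l)]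
    with y hy h1 h2 h3 h4 h5
  rw [h3, h4, Pi.add_apply, h5, Pi.smul_apply, h1, h2]
  have i1 := (h.integrable hN hs0 hs1 hy).integrableOn (s := Ωᶜ)
  have i2 := (h'.integrable hN hs0 hs1 hy).integrableOn (s := Ωᶜ)
  simp only [extFun, add_div, mul_div_assoc, smul_eq_mul]
  rw [integral_add i1 (i2.const_mul r), integral_const_mul]
  ring

/-- Linearity in M is the point: applied to Taylor remainders in time, it gives the
differentiability of the source. -/
theorem exists_extSource_bound (hN : 0 < N) (hs0 : 0 < s) (hs1 : s < 1) (hΩ : MeasurableSet Ω)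
    (hΩb : Bornology.IsBounded Ω) :
    ∃ D : ℝ, ∀ (k : E N → ℝ) (M : ℝ), 0 ≤ M → ExtBound Ω k M → ‖extSource s Ω k‖ ≤ D * M := by
  have : IsFiniteMeasure ((volume : Measure (E N)).restrict Ω) :=
    ⟨by rw [Measure.restrict_apply_univ]; exact hΩb.measure_lt_top⟩
  have hC := fracConst_pos (N := N) hs0 hs1
  have hK : 0 ≤ ∫ z : E N, truncKernel N s z := integral_nonneg fun z => truncKernel_nonneg z
  refine ⟨_, fun k M hM h => (Lp.norm_le_of_ae_bound (p := 2)
    (C := fracConst N s * (∫ z : E N, truncKernel N s z) * M) (by positivity) ?_).trans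
      (le_of_eq (mul_assoc _ _ _).symm)⟩
  filter_upwards [ae_restrict_mem hΩ, h.extSource_coeFn hN hs0 hs1 hΩ hΩb] with y hy hy'
  rw [hy']
  exact h.abs_extFun_le hN hs0 hs1 hy

theorem ExtBound.integrable_prod (hN : 0 < N) (hs0 : 0 < s) (hs1 : s < 1) (hΩ : MeasurableSet Ω)
    (hΩb : Bornology.IsBounded Ω) {k : E N → ℝ} {M : ℝ} (h : ExtBound Ω k M) (w : L2 N) :
    IntegrableOn (fun p : E N × E N => k p.1 * w p.2 / ‖p.1 - p.2‖ ^ ((N : ℝ) + 2 * s))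
      (Ωᶜ ×ˢ Ω) := by
  have hfin : IsFiniteMeasure ((volume : Measure (E N)).restrict Ω) :=
    ⟨by rw [Measure.restrict_apply_univ]; exact hΩb.measure_lt_top⟩
  have hw : IntegrableOn w Ω := ((Lp.memLp w).restrict Ω).integrable one_le_two
  have hw' : Integrable (Ω.indicator fun y => |w y|) := (integrable_indicator_iff hΩ).mpr hw.abs
  have hm := h.meas
  have hwm : Measurable (w : E N → ℝ) := (Lp.stronglyMeasurable w).measurable
  refine Integrable.mono' (((integrable_mul_truncKernel hN hs0 hs1 hw').const_mul M).integrableOn)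
    (Measurable.aestronglyMeasurable (by fun_prop)) ?_
  filter_upwards [ae_restrict_mem (hΩ.compl.prod hΩ)] with p hp
  have h1 := mul_le_mul_of_nonneg_left (h.abs_div_le (s := s) hp.2 p.1) (abs_nonneg (w p.2))
  rw [indicator_of_mem hp.2, Real.norm_eq_abs, mul_comm (k p.1), mul_div_assoc, abs_mul]
  linarith

theorem ExtBound.inner_extSource (hN : 0 < N) (hs0 : 0 < s) (hs1 : s < 1) (hΩ : MeasurableSet Ω)
    (hΩb : Bornology.IsBounded Ω) {k : E N → ℝ} {M : ℝ} (h : ExtBound Ω k M)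
    (w : sobolevZero s Ω) :
    inner ℝ (extSource s Ω k) (toL2 s Ω w) = fracConst N s *
      ∫ p in Ωᶜ ×ˢ Ω, k p.1 * (w : Ambient N).fst p.2 / ‖p.1 - p.2‖ ^ ((N : ℝ) + 2 * s) := by
  have hi := h.integrable_prod (s := s) hN hs0 hs1 hΩ hΩb (w : Ambient N).fst
  have e1 : ∫ p in Ωᶜ ×ˢ Ω, k p.1 * (w : Ambient N).fst p.2 / ‖p.1 - p.2‖ ^ ((N : ℝ) + 2 * s)
      = ∫ y in Ω, ∫ x in Ωᶜ, k x * (w : Ambient N).fst y / ‖x - y‖ ^ ((N : ℝ) + 2 * s) := by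
    have hi' : Integrable (fun p : E N × E N =>
        k p.1 * (w : Ambient N).fst p.2 / ‖p.1 - p.2‖ ^ ((N : ℝ) + 2 * s))
        (((volume : Measure (E N)).restrict Ωᶜ).prod ((volume : Measure (E N)).restrict Ω)) := by
      rw [Measure.prod_restrict]
      exact hi
    have := integral_prod_symm _ hi'
    rw [Measure.prod_restrict] at this
    exact this
  rw [inner_toL2, e1, ← integral_const_mul]
  refine integral_congr_ae ?_
  filter_upwards [h.extSource_coeFn hN hs0 hs1 hΩ hΩb] with y hy
  rw [hy, extFun, mul_assoc, ← integral_mul_const]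
  congr 2
  funext x
  ring

/-- For almost every x outside Ω, w(x) = 0 and 𝒩_s w(x) = -C_{N,s} ∫_Ω w(y)/|x-y|^{N+2s} dy.
Fubini's theorem then exchanges the roles of k and w. -/
theorem ExtBound.integral_mul_normalDeriv (hN : 0 < N) (hs0 : 0 < s) (hs1 : s < 1)
    (hΩ : MeasurableSet Ω) (hΩb : Bornology.IsBounded Ω) {k : E N → ℝ} {M : ℝ}
    (h : ExtBound Ω k M) (w : sobolevZero s Ω) :
    ∫ x in Ωᶜ, k x * normalDeriv s Ω (w : Ambient N).fst x
      = -inner ℝ (extSource s Ω k) (toL2 s Ω w) := by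
  have hi := h.integrable_prod (s := s) hN hs0 hs1 hΩ hΩb (w : Ambient N).fst
  have e1 : ∫ p in Ωᶜ ×ˢ Ω, k p.1 * (w : Ambient N).fst p.2 / ‖p.1 - p.2‖ ^ ((N : ℝ) + 2 * s)
      = ∫ x in Ωᶜ, ∫ y in Ω, k x * (w : Ambient N).fst y / ‖x - y‖ ^ ((N : ℝ) + 2 * s) := by
    have hi' : Integrable (fun p : E N × E N =>
        k p.1 * (w : Ambient N).fst p.2 / ‖p.1 - p.2‖ ^ ((N : ℝ) + 2 * s))
        (((volume : Measure (E N)).restrict Ωᶜ).prod ((volume : Measure (E N)).restrict Ω)) := by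
      rw [Measure.prod_restrict]
      exact hi
    have := integral_prod _ hi'
    rw [Measure.prod_restrict] at this
    exact this
  rw [h.inner_extSource hN hs0 hs1 hΩ hΩb, e1, ← neg_mul, ← integral_const_mul]
  refine integral_congr_ae ?_
  filter_upwards [ae_restrict_mem hΩ.compl, ae_restrict_of_ae (mem_sobolevZero.mp w.2).2]
    with x hx hx'
  rw [normalDeriv, hx' hx, mul_left_comm, ← integral_const_mul, neg_mul, ← mul_neg,
    ← integral_neg]
  congr 2
  funext y
  ring

/-- On Ω × Ω the differences of k vanish, on Ωᶜ × Ωᶜ those of w. The two mixed regions are mirror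
images with equal integrals, which absorbs the factor 1/2. -/
theorem ExtBound.fracForm_eq (hN : 0 < N) (hs0 : 0 < s) (hs1 : s < 1) (hΩ : MeasurableSet Ω)
    (hΩb : Bornology.IsBounded Ω) {k : E N → ℝ} {M : ℝ} (h : ExtBound Ω k M) {u : Ambient N}
    (hu : (u.fst : E N → ℝ) =ᵐ[volume] k) (w : sobolevZero s Ω) :
    fracForm s u (w : Ambient N) = -inner ℝ (extSource s Ω k) (toL2 s Ω w) := by
  have hS := hΩ.compl.prod hΩ
  let G : E N × E N → ℝ := (Ωᶜ ×ˢ Ω).indicator fun p =>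
    k p.1 * (w : Ambient N).fst p.2 / ‖p.1 - p.2‖ ^ ((N : ℝ) + 2 * s)
  have hG : Integrable G := (integrable_indicator_iff hS).mpr
    (h.integrable_prod hN hs0 hs1 hΩ hΩb _)
  have hG' : Integrable fun p : E N × E N => G p.swap := hG.swap
  have e1 : ∫ p : E N × E N, (u.fst p.1 - u.fst p.2) *
      ((w : Ambient N).fst p.1 - (w : Ambient N).fst p.2) / ‖p.1 - p.2‖ ^ ((N : ℝ) + 2 * s)
      = ∫ p : E N × E N, -(G p + G p.swap) := by
    refine integral_congr_ae ?_
    have a1 : ∀ᵐ p : E N × E N, u.fst p.1 = k p.1 :=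
      Measure.quasiMeasurePreserving_fst.ae_eq_comp hu
    have a2 : ∀ᵐ p : E N × E N, u.fst p.2 = k p.2 :=
      Measure.quasiMeasurePreserving_snd.ae_eq_comp hu
    have a3 : ∀ᵐ p : E N × E N, p.1 ∉ Ω → (w : Ambient N).fst p.1 = 0 :=
      Measure.quasiMeasurePreserving_fst.ae (mem_sobolevZero.mp w.2).2
    have a4 : ∀ᵐ p : E N × E N, p.2 ∉ Ω → (w : Ambient N).fst p.2 = 0 :=
      Measure.quasiMeasurePreserving_snd.ae (mem_sobolevZero.mp w.2).2
    filter_upwards [a1, a2, a3, a4] with p h1 h2 h3 h4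
    rw [h1, h2]
    by_cases hp1 : p.1 ∈ Ω <;> by_cases hp2 : p.2 ∈ Ω
    · simp [G, hp1, hp2, h.eq_zero hp1, h.eq_zero hp2]
    · simp [G, hp1, hp2, h.eq_zero hp1, h4 hp2, norm_sub_rev p.2 p.1]
      ring
    · simp [G, hp1, hp2, h.eq_zero hp2, h3 hp1]
      ring
    · simp [G, hp1, hp2, h3 hp1, h4 hp2]
  have e2 : ∫ p : E N × E N, G p.swap = ∫ p, G p := integral_prod_swap G
  rw [fracForm, e1, integral_neg, integral_add hG hG', e2, h.inner_extSource hN hs0 hs1 hΩ hΩb,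
    ← integral_indicator hS]
  ring

end NonlocalMGT

/-! ### Time dependence of the exterior data -/

/-- The mean value inequality applied twice; the sharp constant B/2 is not needed. -/
theorem abs_sub_sub_mul_le {f f' f'' : ℝ → ℝ} {B : ℝ} (hf : ∀ t, HasDerivAt f (f' t) t)
    (hf' : ∀ t, HasDerivAt f' (f'' t) t) (hB : ∀ t, |f'' t| ≤ B) (t t' : ℝ) :
    |f t' - f t - (t' - t) * f' t| ≤ B * |t' - t| ^ 2 := by
  have h1 : ∀ τ, |f' τ - f' t| ≤ B * |τ - t| := fun τ =>
    convex_univ.norm_image_sub_le_of_norm_hasDerivWithin_le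
      (fun x _ => (hf' x).hasDerivWithinAt) (fun x _ => hB x) (mem_univ t) (mem_univ τ)
  have hB0 : 0 ≤ B := (abs_nonneg _).trans (hB 0)
  have h2 : ∀ τ ∈ uIcc t t', HasDerivWithinAt (fun τ => f τ - τ * f' t) (f' τ - f' t)
      (uIcc t t') τ := fun τ _ => by
    have := ((hf τ).sub ((hasDerivAt_id τ).mul_const (f' t))).hasDerivWithinAt (s := uIcc t t')
    exact this.congr_deriv (by simp)
  have h3 := (convex_uIcc t t').norm_image_sub_le_of_norm_hasDerivWithin_le
    (C := B * |t' - t|) h2 (fun τ hτ => (h1 τ).trans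
      (mul_le_mul_of_nonneg_left (abs_sub_left_of_mem_uIcc hτ) hB0)) left_mem_uIcc right_mem_uIcc
  rw [Real.norm_eq_abs, Real.norm_eq_abs, mul_assoc, ← sq] at h3
  refine le_trans (le_of_eq ?_) h3
  congr 1
  ring

namespace NonlocalMGT

variable {N : ℕ} {s : ℝ} {Ω : Set (E N)}

/-- Smooth data with compact support that vanish on `Ω`. -/
structure IsExteriorData (Ω : Set (E N)) (g : E N × ℝ → ℝ) : Prop where
  smooth : ContDiff ℝ ∞ g
  compact : HasCompactSupport g
  vanish : ∀ y ∈ Ω, ∀ t, g (y, t) = 0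

/-- The time derivative of exterior data. -/
noncomputable def timeDeriv (g : E N × ℝ → ℝ) (p : E N × ℝ) : ℝ := fderiv ℝ g p (0, 1)

namespace IsExteriorData

variable {g : E N × ℝ → ℝ}

theorem hasDerivAt (h : IsExteriorData Ω g) (x : E N) (t : ℝ) :
    HasDerivAt (fun τ => g (x, τ)) (timeDeriv g (x, t)) t := by
  have h1 := (h.smooth.differentiable (by simp) (x, t)).hasFDerivAt
  exact h1.comp_hasDerivAt t ((hasDerivAt_const t x).prodMk (hasDerivAt_id t))

theorem timeDeriv (h : IsExteriorData Ω g) : IsExteriorData Ω (timeDeriv g) where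
  smooth := by
    have h1 : ContDiff ℝ ∞ (fderiv ℝ g) := h.smooth.fderiv_right (by simp)
    exact h1.clm_apply contDiff_const
  compact := by
    refine (h.compact.fderiv ℝ).mono fun p hp hz => hp ?_
    show fderiv ℝ g p (0, 1) = 0
    rw [hz]
    rfl
  vanish y hy t := by
    have h1 := h.hasDerivAt y t
    have h2 : (fun τ => g (y, τ)) = fun _ => (0 : ℝ) := funext fun τ => h.vanish y hy τ
    rw [h2] at h1
    exact h1.unique (hasDerivAt_const t 0)

theorem contDiff_slice (h : IsExteriorData Ω g) (t : ℝ) : ContDiff ℝ ∞ fun x => g (x, t) :=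
  h.smooth.comp (contDiff_id.prodMk contDiff_const)

theorem hasCompactSupport_slice (h : IsExteriorData Ω g) (t : ℝ) :
    HasCompactSupport fun x => g (x, t) := by
  have hK : IsCompact (Prod.fst '' tsupport g) := IsCompact.image h.compact continuous_fst
  refine HasCompactSupport.intro hK fun x hx => ?_
  exact image_eq_zero_of_notMem_tsupport fun h' => hx ⟨(x, t), h', rfl⟩

/-- As Ω is open, the spatial gradient of g also vanishes at y ∈ Ω. The gradient is Lipschitz, so it
is at most L|x - y| on the segment from y to x, and the mean value inequality gives L|x - y|². -/
theorem exists_extBound (hΩo : IsOpen Ω) (h : IsExteriorData Ω g) :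
    ∃ M : ℝ, 0 ≤ M ∧ ∀ t, ExtBound Ω (fun x => g (x, t)) M := by
  obtain ⟨M₀, hM₀⟩ := h.compact.exists_bound_of_continuous h.smooth.continuous
  have hM₀0 : 0 ≤ M₀ := (norm_nonneg _).trans (hM₀ 0)
  have h1 : ContDiff ℝ ∞ (fderiv ℝ g) := h.smooth.fderiv_right (by simp)
  obtain ⟨L, hL⟩ := ContDiff.lipschitzWith_of_hasCompactSupport (h.compact.fderiv ℝ) h1 (by simp)
  refine ⟨M₀ + L, by positivity, fun t => ⟨(h.contDiff_slice t).continuous.measurable,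
    fun y hy x => ?_⟩⟩
  let D : E N → E N →L[ℝ] ℝ := fun z => (fderiv ℝ g (z, t)) ∘L ContinuousLinearMap.inl ℝ (E N) ℝ
  have hD : ∀ z, HasFDerivAt (fun x => g (x, t)) (D z) z := fun z =>
    (h.smooth.differentiable (by simp) (z, t)).hasFDerivAt.comp z (hasFDerivAt_prodMk_left z t)
  have hDy : D y = 0 := by
    have h2 : (fun x => g (x, t)) =ᶠ[𝓝 y] fun _ => (0 : ℝ) := by
      filter_upwards [hΩo.mem_nhds hy] with z hz
      exact h.vanish z hz t
    exact (hD y).unique ((hasFDerivAt_const (0 : ℝ) y).congr_of_eventuallyEq h2)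
  have hDn : ∀ z, ‖D z‖ ≤ L * ‖z - y‖ := by
    intro z
    have h3 : D z = (fderiv ℝ g (z, t) - fderiv ℝ g (y, t)) ∘L ContinuousLinearMap.inl ℝ (E N) ℝ := by
      rw [ContinuousLinearMap.sub_comp]
      show D z = D z - D y
      rw [hDy, sub_zero]
    rw [h3]
    refine (ContinuousLinearMap.opNorm_comp_le _ _).trans ?_
    have h4 := hL.norm_sub_le (z, t) (y, t)
    have h5 : ‖((z, t) : E N × ℝ) - (y, t)‖ = ‖z - y‖ := by
      simp [Prod.norm_def]
    rw [h5] at h4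
    exact (mul_le_of_le_one_right (norm_nonneg _)
      (ContinuousLinearMap.norm_inl_le_one ℝ (E N) ℝ)).trans h4
  have hseg : ∀ z ∈ segment ℝ y x, ‖D z‖ ≤ L * ‖x - y‖ := fun z hz =>
    (hDn z).trans (mul_le_mul_of_nonneg_left (norm_sub_le_of_mem_segment hz) L.2)
  have hquad := (convex_segment y x).norm_image_sub_le_of_norm_hasFDerivWithin_le
    (fun z _ => (hD z).hasFDerivWithinAt) hseg (left_mem_segment ℝ y x) (right_mem_segment ℝ y x)
  rw [h.vanish y hy t, sub_zero, Real.norm_eq_abs, mul_assoc, ← sq] at hquad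
  rw [mul_min_of_nonneg _ _ (by positivity : (0 : ℝ) ≤ M₀ + L), mul_one]
  refine le_min ((hM₀ (x, t)).trans (le_add_of_nonneg_right L.2)) (hquad.trans ?_)
  exact mul_le_mul_of_nonneg_right (le_add_of_nonneg_left hM₀0) (sq_nonneg _)

/-- The source generated by smooth exterior data is differentiable in time. -/
theorem hasDerivAt_extSource (hN : 0 < N) (hs0 : 0 < s) (hs1 : s < 1) (hΩo : IsOpen Ω)
    (hΩb : Bornology.IsBounded Ω) (h : IsExteriorData Ω g) (t : ℝ) :
    HasDerivAt (fun τ => extSource s Ω fun x => g (x, τ))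
      (extSource s Ω fun x => NonlocalMGT.timeDeriv g (x, t)) t := by
  have hΩ := hΩo.measurableSet
  obtain ⟨D, hD⟩ := exists_extSource_bound (s := s) hN hs0 hs1 hΩ hΩb
  obtain ⟨M₀, -, hM₀⟩ := h.exists_extBound hΩo
  obtain ⟨M₁, -, hM₁⟩ := h.timeDeriv.exists_extBound hΩo
  obtain ⟨M₂, hM₂0, hM₂⟩ := h.timeDeriv.timeDeriv.exists_extBound hΩo
  rw [hasDerivAt_iff_isLittleO]
  -- The remainder g(t') - g(t) - (t' - t) g_t(t) has an `ExtBound` with constant M₂|t' - t|², where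
  -- M₂ belongs to g_tt: the spatial weight min(1, |x - y|²) is kept by Taylor's formula at each x.
  refine (Asymptotics.IsBigO.of_bound (D * M₂) (Eventually.of_forall fun t' => ?_)).trans_isLittleO
    (Asymptotics.isLittleO_pow_sub_sub t one_lt_two)
  have e1 : extSource s Ω (fun x => (g (x, t') + (-1) * g (x, t))
      + (-(t' - t)) * NonlocalMGT.timeDeriv g (x, t))
      = extSource s Ω (fun x => g (x, t')) - extSource s Ω (fun x => g (x, t))
        - (t' - t) • extSource s Ω fun x => NonlocalMGT.timeDeriv g (x, t) := by
    rw [((hM₀ t').add ((hM₀ t).const_mul (-1))).extSource_add_mul hN hs0 hs1 hΩ hΩb (hM₁ t),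
      (hM₀ t').extSource_add_mul hN hs0 hs1 hΩ hΩb (hM₀ t)]
    simp only [neg_smul, one_smul]
    abel
  have hb : ExtBound Ω (fun x => (g (x, t') + (-1) * g (x, t))
      + (-(t' - t)) * NonlocalMGT.timeDeriv g (x, t)) (M₂ * |t' - t| ^ 2) := by
    refine ⟨(((hM₀ t').add ((hM₀ t).const_mul (-1))).add
      ((hM₁ t).const_mul (-(t' - t)))).meas, fun y hy x => ?_⟩
    have := abs_sub_sub_mul_le (fun τ => h.hasDerivAt x τ) (fun τ => h.timeDeriv.hasDerivAt x τ)
      (fun τ => (hM₂ τ).bound y hy x) t t'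
    have e2 : g (x, t') + (-1) * g (x, t) + (-(t' - t)) * NonlocalMGT.timeDeriv g (x, t)
        = g (x, t') - g (x, t) - (t' - t) * NonlocalMGT.timeDeriv g (x, t) := by ring
    rw [e2, mul_right_comm]
    exact this
  rw [← e1, Real.norm_of_nonneg (by positivity), Real.norm_eq_abs, mul_assoc]
  exact hD _ _ (by positivity) hb

end IsExteriorData

end NonlocalMGT

/-! ### Weak solutions -/

theorem HasDerivWithinAt.clm_apply_const {X Y : Type*} [NormedAddCommGroup X] [NormedSpace ℝ X]
    [NormedAddCommGroup Y] [NormedSpace ℝ Y] (L : X →L[ℝ] Y) {f : ℝ → X} {f' : X} {S : Set ℝ}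
    {t : ℝ} (h : HasDerivWithinAt f f' S t) : HasDerivWithinAt (fun τ => L (f τ)) (L f') S t :=
  L.hasFDerivAt.comp_hasDerivWithinAt t h

theorem inner_sub_smul_left {H : Type*} [NormedAddCommGroup H] [InnerProductSpace ℝ H] (x y z : H)
    (r : ℝ) : (inner ℝ (x - r • y) z : ℝ) = inner ℝ x z - r * inner ℝ y z := by
  rw [inner_sub_left, real_inner_smul_left]

namespace NonlocalMGT

variable {N : ℕ} {s : ℝ} {Ω : Set (E N)}

theorem IsDirichletEigenbasis.formEigenbasis (hN : 0 < N) (hs0 : 0 < s) (hs1 : s < 1)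
    (hΩ : MeasurableSet Ω) (hΩb : Bornology.IsBounded Ω) {φ : ℕ → sobolevZero s Ω} {lam : ℕ → ℝ}
    (h : IsDirichletEigenbasis s Ω φ lam) :
    FormEigenbasis (toL2 s Ω) (energyForm s Ω) φ lam where
  inj := toL2_injective hΩ
  symm := energyForm_symm
  coercive := isCoercive_energyForm hN hs0 hs1 hΩ hΩb
  orthonormal := h.orthonormal
  total := h.total
  eigen n v := by
    rw [energyForm_apply, h.eigen n v, inner_smul_left]
    rfl

theorem exists_isDirichletEigenbasis (hN : 0 < N) (hs0 : 0 < s) (hs1 : s < 1) (hΩo : IsOpen Ω)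
    (hΩb : Bornology.IsBounded Ω) (hΩn : Ω.Nonempty) :
    ∃ φ lam, IsDirichletEigenbasis s Ω φ lam := by
  obtain ⟨φ, lam, h1, h2, h3, h4⟩ := exists_form_eigenbasis (isCompactOperator_toL2 hN hs0 hΩb)
    (denseRange_toL2 hN hs0 hs1 hΩo hΩb) (not_finiteDimensional_L2On hN hΩo hΩn hΩb)
    energyForm_symm (isCoercive_energyForm hN hs0 hs1 hΩo.measurableSet hΩb)
  refine ⟨φ, lam, h1, h2, fun n v => ?_, h4⟩
  rw [← energyForm_apply, h3, inner_smul_left]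
  rfl

/-- The expansion in a Hilbert basis. The complex coefficients are real numbers, so the remainder
has the same norm as in real L²(Ω). -/
theorem isL2Series_inner {φ : ℕ → sobolevZero s Ω} {lam : ℕ → ℝ}
    (h : IsDirichletEigenbasis s Ω φ lam) {a : ℕ → ℂ} {f : L2On Ω}
    (ha : ∀ n, a n = ((inner ℝ f (toL2 s Ω (φ n)) : ℝ) : ℂ)) : IsL2Series s Ω φ a f := by
  let B : HilbertBasis ℕ ℝ (L2On Ω) := HilbertBasis.mk h.orthonormal h.total.ge
  have hB : ∀ n, B n = toL2 s Ω (φ n) := fun n => by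
    simp only [B, HilbertBasis.coe_mk]
  have h1 : Tendsto (fun m : ℕ => f - ∑ n ∈ Finset.range m,
      (inner ℝ f (toL2 s Ω (φ n)) : ℝ) • toL2 s Ω (φ n)) atTop (𝓝 0) := by
    have h2 := (B.hasSum_repr f).tendsto_sum_nat
    have h3 := (tendsto_const_nhds (x := f)).sub h2
    rw [sub_self] at h3
    refine h3.congr fun m => ?_
    congr 1
    refine Finset.sum_congr rfl fun n _ => ?_
    rw [B.repr_apply_apply, hB, real_inner_comm]
  have h4 := h1.enorm
  rw [enorm_zero] at h4
  refine h4.congr fun m => ?_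
  rw [Lp.enorm_def]
  refine eLpNorm_congr_norm_ae ?_
  have h5 : ∀ᵐ x ∂(volume.restrict Ω), ∀ n, toL2 s Ω (φ n) x = (φ n : Ambient N).fst x :=
    ae_all_iff.mpr fun n => toL2_coeFn (φ n)
  have h6 : ∀ᵐ x ∂(volume.restrict Ω), ∀ n,
      ((inner ℝ f (toL2 s Ω (φ n)) : ℝ) • toL2 s Ω (φ n) : L2On Ω) x
        = (inner ℝ f (toL2 s Ω (φ n)) : ℝ) * toL2 s Ω (φ n) x :=
    ae_all_iff.mpr fun n => Lp.coeFn_smul _ _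
  filter_upwards [h5, h6, Lp.coeFn_sub f (∑ n ∈ Finset.range m,
      (inner ℝ f (toL2 s Ω (φ n)) : ℝ) • toL2 s Ω (φ n)),
    Lp.coeFn_finsetSum (Finset.range m)
      (fun n => (inner ℝ f (toL2 s Ω (φ n)) : ℝ) • toL2 s Ω (φ n))] with x h7 h8 h9 h10
  rw [h9, Pi.sub_apply, h10, Finset.sum_apply]
  simp only [h8, h7, ha]
  rw [← Complex.norm_real]
  push_cast
  rfl

/-- `toNeg` as a continuous linear map. -/
noncomputable def toNegL (s : ℝ) (Ω : Set (E N)) : L2On Ω →L[ℝ] NegSobolev s Ω :=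
  LinearMap.mkContinuous
    { toFun := toNeg s Ω
      map_add' := fun f g => by
        ext w
        simp [toNeg]
      map_smul' := fun r f => by
        ext w
        simp [toNeg] } ‖toL2 s Ω‖ fun f => by
    refine (ContinuousLinearMap.opNorm_comp_le _ _).trans (le_of_eq ?_)
    rw [innerSL_apply_norm, mul_comm]

theorem toNegL_apply (f : L2On Ω) : toNegL s Ω f = toNeg s Ω f := rfl

theorem toNeg_apply (f : L2On Ω) (w : sobolevZero s Ω) :
    toNeg s Ω f w = inner ℝ f (toL2 s Ω w) := rfl

theorem restr_eq_zero {u : L2 N} {k : E N → ℝ} (hΩ : MeasurableSet Ω)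
    (hu : (u : E N → ℝ) =ᵐ[volume] k) (hk : ∀ y ∈ Ω, k y = 0) : restr Ω u = 0 := by
  refine Lp.ext ?_
  filter_upwards [restr_coeFn (Ω := Ω) u, ae_restrict_of_ae hu, ae_restrict_mem hΩ,
    Lp.coeFn_zero ℝ 2 (volume.restrict Ω)] with x h1 h2 h3 h4
  rw [h1, h2, hk x h3, h4, Pi.zero_apply]

theorem fracForm_add_left {u u' w : Ambient N} (hu : u ∈ sobolev N s) (hu' : u' ∈ sobolev N s)
    (hw : w ∈ sobolev N s) : fracForm s (u + u') w = fracForm s u w + fracForm s u' w := by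
  rw [fracForm_eq_inner hu hw, fracForm_eq_inner hu' hw,
    fracForm_eq_inner ((sobolev N s).add_mem hu hu') hw, WithLp.add_snd, inner_add_left, mul_add]

/-- The pairing of `(-Δ)^s` of a function with exterior data `k`. -/
theorem fracForm_add_exterior (hN : 0 < N) (hs0 : 0 < s) (hs1 : s < 1) (hΩ : MeasurableSet Ω)
    (hΩb : Bornology.IsBounded Ω) {k : E N → ℝ} {M : ℝ} (hk : ExtBound Ω k M) {uk : Ambient N}
    (huk : uk ∈ sobolev N s) (hukk : (uk.fst : E N → ℝ) =ᵐ[volume] k) (v w : sobolevZero s Ω) :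
    fracForm s ((v : Ambient N) + uk) (w : Ambient N)
      = energyForm s Ω v w - inner ℝ (extSource s Ω k) (toL2 s Ω w) := by
  rw [energyForm_apply, sub_eq_add_neg, ← hk.fracForm_eq hN hs0 hs1 hΩ hΩb hukk w]
  exact fracForm_add_left (mem_sobolevZero.mp v.2).1 huk (mem_sobolevZero.mp w.2).1

theorem restr_add_exterior (hΩ : MeasurableSet Ω) {k : E N → ℝ} {uk : Ambient N}
    (hukk : (uk.fst : E N → ℝ) =ᵐ[volume] k) (hk : ∀ y ∈ Ω, k y = 0) (v : sobolevZero s Ω) :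
    restr Ω ((v : Ambient N) + uk).fst = toL2 s Ω v := by
  rw [WithLp.add_fst, map_add, restr_eq_zero hΩ hukk hk, add_zero]
  rfl

theorem add_exterior_ae {k : E N → ℝ} {uk : Ambient N}
    (hukk : (uk.fst : E N → ℝ) =ᵐ[volume] k) (v : sobolevZero s Ω) :
    ∀ᵐ x, x ∉ Ω → ((v : Ambient N) + uk).fst x = k x := by
  filter_upwards [(mem_sobolevZero.mp v.2).2, hukk, Lp.coeFn_add (v : Ambient N).fst uk.fst]
    with x h1 h2 h3 hx
  rw [WithLp.add_fst, h3, Pi.add_apply, h1 hx, h2, zero_add]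

/-- The pairing of `(-Δ)^s f` with an eigenfunction. -/
theorem fracForm_eigenfunction (hN : 0 < N) (hs0 : 0 < s) (hs1 : s < 1) (hΩ : MeasurableSet Ω)
    (hΩb : Bornology.IsBounded Ω) {φ : ℕ → sobolevZero s Ω} {lam : ℕ → ℝ}
    (h : FormEigenbasis (toL2 s Ω) (energyForm s Ω) φ lam) {k : E N → ℝ} {M : ℝ}
    (hk : ExtBound Ω k M) {uk : Ambient N} (huk : uk ∈ sobolev N s)
    (hukk : (uk.fst : E N → ℝ) =ᵐ[volume] k) {f : Ambient N} (hf : f ∈ sobolev N s)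
    (hfk : ∀ᵐ x, x ∉ Ω → f.fst x = k x) (n : ℕ) :
    fracForm s f (φ n : Ambient N) = lam n * inner ℝ (restr Ω f.fst) (toL2 s Ω (φ n))
      - inner ℝ (extSource s Ω k) (toL2 s Ω (φ n)) := by
  -- Subtracting the lift of the exterior data leaves an element of the energy space, to which the
  -- eigenvalue relation applies; the lift itself contributes the source.
  have hmem : f - uk ∈ sobolevZero s Ω := by
    refine mem_sobolevZero.mpr ⟨(sobolev N s).sub_mem hf huk, ?_⟩
    filter_upwards [hfk, hukk, Lp.coeFn_sub f.fst uk.fst] with x h1 h2 h3 hx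
    rw [WithLp.sub_fst, h3, Pi.sub_apply, h1 hx, h2, sub_self]
  have h1 : toL2 s Ω ⟨f - uk, hmem⟩ = restr Ω f.fst := by
    show restr Ω (f.fst - uk.fst) = _
    rw [map_sub, restr_eq_zero hΩ hukk fun y hy => hk.eq_zero hy, sub_zero]
  have h2 := h.eigen_right n ⟨f - uk, hmem⟩
  rw [energyForm_apply, h1] at h2
  have h3 := fracForm_add_left ((sobolev N s).sub_mem hf huk) huk
    (mem_sobolevZero.mp (φ n).2).1
  rw [sub_add_cancel] at h3
  rw [h3, hk.fracForm_eq hN hs0 hs1 hΩ hΩb hukk]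
  simp only at h2
  rw [h2]
  ring

/-- The data `c² g + b g_t`. -/
noncomputable def mixedData (b c : ℝ) (g : E N × ℝ → ℝ) (t : ℝ) (x : E N) : ℝ :=
  c ^ 2 * g (x, t) + b * timeDeriv g (x, t)

namespace IsExteriorData

variable {g : E N × ℝ → ℝ}

theorem exists_sobolev_mixedData (hN : 0 < N) (hs0 : 0 < s) (hs1 : s < 1)
    (h : IsExteriorData Ω g) (b c t : ℝ) :
    ∃ u : Ambient N, u ∈ sobolev N s ∧ (u.fst : E N → ℝ) =ᵐ[volume] mixedData b c g t :=
  exists_sobolev_of_contDiff hN hs0 hs1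
    ((contDiff_const.mul (h.contDiff_slice t)).add
      (contDiff_const.mul (h.timeDeriv.contDiff_slice t)))
    (((h.hasCompactSupport_slice t).mul_left).add ((h.timeDeriv.hasCompactSupport_slice t).mul_left))

theorem exists_extBound_mixedData (hΩo : IsOpen Ω) (h : IsExteriorData Ω g) (b c : ℝ) :
    ∃ M : ℝ, ∀ t, ExtBound Ω (mixedData b c g t) M := by
  obtain ⟨M₀, -, hM₀⟩ := h.exists_extBound hΩo
  obtain ⟨M₁, -, hM₁⟩ := h.timeDeriv.exists_extBound hΩo
  exact ⟨_, fun t => ((hM₀ t).const_mul (c ^ 2)).add ((hM₁ t).const_mul b)⟩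

theorem extSource_mixedData (hN : 0 < N) (hs0 : 0 < s) (hs1 : s < 1) (hΩo : IsOpen Ω)
    (hΩb : Bornology.IsBounded Ω) (h : IsExteriorData Ω g) (b c t : ℝ) :
    extSource s Ω (mixedData b c g t) = c ^ 2 • extSource s Ω (fun x => g (x, t))
      + b • extSource s Ω (fun x => NonlocalMGT.timeDeriv g (x, t)) := by
  obtain ⟨M₀, -, hM₀⟩ := h.exists_extBound hΩo
  obtain ⟨M₁, -, hM₁⟩ := h.timeDeriv.exists_extBound hΩo
  -- Zero data as first summand of `extSource_add_mul` yield homogeneity: taken twice they give S 0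
  -- = 0, then with g they give S(c²g) = c² S g.
  have hz : ExtBound Ω (fun _ : E N => (0 : ℝ)) 0 := ⟨measurable_const, fun y _ x => by simp⟩
  have e1 := ((hM₀ t).const_mul (c ^ 2)).extSource_add_mul (s := s) hN hs0 hs1 hΩo.measurableSet
    hΩb (hM₁ t) b
  have e2 := hz.extSource_add_mul (s := s) hN hs0 hs1 hΩo.measurableSet hΩb (hM₀ t) (c ^ 2)
  have e3 := hz.extSource_add_mul (s := s) hN hs0 hs1 hΩo.measurableSet hΩb hz 1
  simp only [zero_add, mul_zero, one_smul, left_eq_add] at e2 e3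
  rw [e3, zero_add] at e2
  rw [← e2, ← e1]
  rfl

theorem continuous_extSource (hN : 0 < N) (hs0 : 0 < s) (hs1 : s < 1) (hΩo : IsOpen Ω)
    (hΩb : Bornology.IsBounded Ω) (h : IsExteriorData Ω g) :
    Continuous fun t => extSource s Ω fun x => g (x, t) :=
  continuous_iff_continuousAt.mpr fun t =>
    (h.hasDerivAt_extSource hN hs0 hs1 hΩo hΩb t).continuousAt

theorem continuous_extSource_mixedData (hN : 0 < N) (hs0 : 0 < s) (hs1 : s < 1) (hΩo : IsOpen Ω)
    (hΩb : Bornology.IsBounded Ω) (h : IsExteriorData Ω g) (b c : ℝ) :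
    Continuous fun t => extSource s Ω (mixedData b c g t) := by
  simp only [h.extSource_mixedData hN hs0 hs1 hΩo hΩb]
  exact ((h.continuous_extSource hN hs0 hs1 hΩo hΩb).const_smul (c ^ 2)).add
    ((h.timeDeriv.continuous_extSource hN hs0 hs1 hΩo hΩb).const_smul b)

end IsExteriorData

set_option maxHeartbeats 400000 in
theorem exists_isWeakSolution (hN : 0 < N) (hs0 : 0 < s) (hs1 : s < 1) (hΩo : IsOpen Ω)
    (hΩb : Bornology.IsBounded Ω) (hΩn : Ω.Nonempty) (α c : ℝ) {b T : ℝ} (hb : 0 < b) (hT : 0 < T)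
    (u₀ u₁ : sobolevZero s Ω) (u₂ : L2On Ω) {g : E N × ℝ → ℝ} (hg : IsExteriorData Ω g) :
    ∃ (u : ℝ → L2 N) (ut utt : ℝ → NegSobolev s Ω), IsWeakSolution s Ω α b c T g (toL2 s Ω u₀)
      (toNeg s Ω (toL2 s Ω u₁)) (toNeg s Ω u₂) u ut utt := by
  have hΩ := hΩo.measurableSet
  obtain ⟨φ, lam, hφ⟩ := exists_isDirichletEigenbasis hN hs0 hs1 hΩo hΩb hΩn
  have hF := hφ.formEigenbasis hN hs0 hs1 hΩ hΩb
  have hRc := hg.continuous_extSource_mixedData hN hs0 hs1 hΩo hΩb b c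
  obtain ⟨U, U₁, U₂, cU, cU₁, cU₂, hU0, hU₁0, hU₂0, dU, dU₁, dU₂⟩ :=
    hF.exists_evolution α c hb hT.le u₀ u₁ u₂ hRc
  choose G hGs hG using fun t => exists_sobolev_of_contDiff (s := s) hN hs0 hs1
    (hg.contDiff_slice t) (hg.hasCompactSupport_slice t)
  choose G' hG's hG' using fun t => hg.exists_sobolev_mixedData (s := s) hN hs0 hs1 b c t
  obtain ⟨M, hM⟩ := hg.exists_extBound_mixedData hΩo b c
  -- The solution U with homogeneous exterior values plus the lift g(·,t), which is zero in Ω.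
  -- Likewise `f` below is c²U + bU₁ plus the lift of c²g + bg_t.
  let u : ℝ → L2 N := fun t => ((U t : Ambient N) + G t).fst
  have hru : ∀ t, restr Ω (u t) = toL2 s Ω (U t) := fun t =>
    restr_add_exterior hΩ (hG t) (fun y hy => hg.vanish y hy t) (U t)
  obtain ⟨V, hV⟩ : ∃ V : ℝ → sobolevZero s Ω, ∀ t, V t = c ^ 2 • U t + b • U₁ t :=
    ⟨_, fun _ => rfl⟩
  have cV : Continuous V := by
    simp only [funext hV]
    exact (cU.const_smul (c ^ 2)).add (cU₁.const_smul b)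
  let f : ℝ → sobolev N s := fun t =>
    ⟨(V t : Ambient N) + G' t, (sobolev N s).add_mem (mem_sobolevZero.mp (V t).2).1 (hG's t)⟩
  have hrf : ∀ t, restr Ω (f t : Ambient N).fst = toL2 s Ω (V t) := fun t =>
    restr_add_exterior hΩ (hG' t) (fun y hy => (hM t).eq_zero hy) (V t)
  obtain ⟨u₃, du₃, cu₃, hu₃⟩ : ∃ u₃ : ℝ → NegSobolev s Ω,
      (∀ t ∈ Icc 0 T, HasDerivWithinAt (fun τ => toNeg s Ω (U₂ τ)) (u₃ t) (Icc 0 T) t) ∧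
      Continuous u₃ ∧ ∀ t w, u₃ t w = inner ℝ (extSource s Ω (mixedData b c g t) - α • U₂ t)
        (toL2 s Ω w) - energyForm s Ω (V t) w := by
    refine ⟨fun t => toNegL s Ω (extSource s Ω (mixedData b c g t) - α • U₂ t)
      - energyForm s Ω (V t), ?_,
      ((toNegL s Ω).continuous.comp (hRc.sub (cU₂.const_smul α))).sub
        ((energyForm s Ω).continuous.comp cV), fun _ _ => rfl⟩
    simp only [hV]
    exact dU₂
  refine ⟨u, fun t => toNeg s Ω (toL2 s Ω (U₁ t)), fun t => toNeg s Ω (U₂ t), ?_⟩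
  constructor
  · simp only [hru]
    exact ((toL2 s Ω).continuous.comp cU).continuousOn
  · intro t ht
    simp only [hru]
    exact ((dU t ht).clm_apply_const (toL2 s Ω)).clm_apply_const (Y := NegSobolev s Ω) (toNegL s Ω)
  · intro t ht
    exact (dU₁ t ht).clm_apply_const (Y := NegSobolev s Ω) (toNegL s Ω)
  · exact ((toNegL s Ω).continuous.comp cU₂).continuousOn
  · refine ⟨u₃, f, fun t ht => ?_, cu₃.continuousOn, Eventually.of_forall fun t _ => ⟨?_, ?_⟩,
      fun w => Eventually.of_forall fun t _ => ?_⟩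
    · exact HasDerivWithinAt.hasDerivAt (F := NegSobolev s Ω) (du₃ t ⟨ht.1.le, ht.2.le⟩)
        (Icc_mem_nhds ht.1 ht.2)
    · rw [hrf, hru, hV]
      simp only [← toNegL_apply, map_add, map_smul]
    · filter_upwards [add_exterior_ae (hG' t) (V t)] with x h1 hx
      rw [(hg.hasDerivAt x t).deriv]
      exact h1 hx
    · have h1 : fracForm s (f t : Ambient N) (w : Ambient N) = _ :=
        fracForm_add_exterior hN hs0 hs1 hΩ hΩb (hM t) (hG's t) (hG' t) (V t) w
      have h2 : (u₃ t + α • toNeg s Ω (U₂ t)) w = u₃ t w + α * inner ℝ (U₂ t) (toL2 s Ω w) := rfl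
      rw [h2, h1, hu₃, inner_sub_smul_left]
      ring
  · rw [hru, hU0]
  · simp only [hU₁0]
  · simp only [hU₂0]
  · intro t _
    exact add_exterior_ae (hG t) (U t)

end NonlocalMGT

/-! ### The modes of a weak solution -/

theorem HasDerivAt.clm_apply_const {X Y : Type*} [NormedAddCommGroup X] [NormedSpace ℝ X]
    [NormedAddCommGroup Y] [NormedSpace ℝ Y] (L : X →L[ℝ] Y) {f : ℝ → X} {f' : X} {t : ℝ}
    (h : HasDerivAt f f' t) : HasDerivAt (fun τ => L (f τ)) (L f') t :=
  L.hasFDerivAt.comp_hasDerivAt t h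

/-- The variational identity holds only for almost every t. Continuity of both sides, for the left
one that of u_ttt in the definition of a weak solution, extends it to the whole open interval. -/
theorem eqOn_lincomb_of_ae {z r p q y : ℝ → ℝ} {T α β γ : ℝ}
    (h : ∀ᵐ t, t ∈ Ioo 0 T → z t = r t - (α * p t + β * q t + γ * y t))
    (hz : ContinuousOn z (Ioo 0 T)) (hr : Continuous r) (hp : ContinuousOn p (Icc 0 T))
    (hq : ContinuousOn q (Icc 0 T)) (hy : ContinuousOn y (Icc 0 T)) {t : ℝ} (ht : t ∈ Ioo 0 T) :
    z t = r t - (α * p t + β * q t + γ * y t) := by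
  have hsub : Ioo 0 T ⊆ Icc 0 T := Ioo_subset_Icc_self
  refine Measure.eqOn_open_of_ae_eq (μ := volume) ((ae_restrict_iff' measurableSet_Ioo).mpr h)
    isOpen_Ioo hz ?_ ht
  exact hr.continuousOn.sub ((((hp.mono hsub).const_smul α).add
    ((hq.mono hsub).const_smul β)).add ((hy.mono hsub).const_smul γ))

namespace NonlocalMGT

variable {N : ℕ} {s : ℝ} {Ω : Set (E N)}

section

variable {α b c T : ℝ} {g : E N × ℝ → ℝ} {d₀ : L2On Ω} {d₁ d₂ : NegSobolev s Ω}
  {u : ℝ → L2 N} {ut utt : ℝ → NegSobolev s Ω}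

theorem hasDerivWithinAt_apply {f : ℝ → NegSobolev s Ω} {f' : NegSobolev s Ω} {S : Set ℝ} {t : ℝ}
    (h : HasDerivWithinAt f f' S t) (w : sobolevZero s Ω) :
    HasDerivWithinAt (fun τ => f τ w) (f' w) S t :=
  HasDerivWithinAt.clm_apply_const (X := NegSobolev s Ω) (ContinuousLinearMap.apply ℝ ℝ w) h

theorem hasDerivAt_apply {f : ℝ → NegSobolev s Ω} {f' : NegSobolev s Ω} {t : ℝ}
    (h : HasDerivAt f f' t) (w : sobolevZero s Ω) : HasDerivAt (fun τ => f τ w) (f' w) t :=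
  HasDerivAt.clm_apply_const (X := NegSobolev s Ω) (ContinuousLinearMap.apply ℝ ℝ w) h

theorem continuousOn_apply {f : ℝ → NegSobolev s Ω} {S : Set ℝ} (h : ContinuousOn f S)
    (w : sobolevZero s Ω) : ContinuousOn (fun τ => f τ w) S :=
  h.clm_apply continuousOn_const

/-- The equation for the coefficients of a weak solution in an eigenbasis. -/
theorem IsWeakSolution.hasDerivAt_mode (hN : 0 < N) (hs0 : 0 < s) (hs1 : s < 1) (hΩo : IsOpen Ω)
    (hΩb : Bornology.IsBounded Ω) {φ : ℕ → sobolevZero s Ω} {lam : ℕ → ℝ}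
    (hφ : IsDirichletEigenbasis s Ω φ lam) (hg : IsExteriorData Ω g)
    (hu : IsWeakSolution s Ω α b c T g d₀ d₁ d₂ u ut utt) (n : ℕ) :
    ∀ t ∈ Ioo 0 T, HasDerivAt (fun τ => utt τ (φ n))
      (inner ℝ (extSource s Ω (mixedData b c g t)) (toL2 s Ω (φ n)) - (α * utt t (φ n)
        + lam n * b * ut t (φ n) + lam n * c ^ 2 * inner ℝ (restr Ω (u t)) (toL2 s Ω (φ n)))) t := by
  have hΩ := hΩo.measurableSet
  have hF := hφ.formEigenbasis hN hs0 hs1 hΩ hΩb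
  obtain ⟨M, hM⟩ := hg.exists_extBound_mixedData hΩo b c
  obtain ⟨u₃, f, hd, hc, hf, heq⟩ := hu.equation
  have hcy : ContinuousOn (fun t => (inner ℝ (restr Ω (u t)) (toL2 s Ω (φ n)) : ℝ)) (Icc 0 T) :=
    hu.cont.inner continuousOn_const
  have hcy' : ContinuousOn (fun t => ut t (φ n)) (Icc 0 T) := fun t ht =>
    (hasDerivWithinAt_apply (hu.deriv_two t ht) (φ n)).continuousWithinAt
  have hcy'' := continuousOn_apply hu.cont_two (φ n)
  have hcr : Continuous fun t =>
      (inner ℝ (extSource s Ω (mixedData b c g t)) (toL2 s Ω (φ n)) : ℝ) :=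
    (hg.continuous_extSource_mixedData hN hs0 hs1 hΩo hΩb b c).inner continuous_const
  have hae : ∀ᵐ t, t ∈ Ioo 0 T → u₃ t (φ n)
      = inner ℝ (extSource s Ω (mixedData b c g t)) (toL2 s Ω (φ n)) - (α * utt t (φ n)
        + lam n * b * ut t (φ n)
        + lam n * c ^ 2 * inner ℝ (restr Ω (u t)) (toL2 s Ω (φ n))) := by
    filter_upwards [hf, heq (φ n)] with t h1 h2 ht
    obtain ⟨h3, h4⟩ := h1 ht
    obtain ⟨uk, huk, hukk⟩ := hg.exists_sobolev_mixedData hN hs0 hs1 b c t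
    have h5 : ∀ᵐ x, x ∉ Ω → (f t : Ambient N).fst x = mixedData b c g t x := by
      filter_upwards [h4] with x h6 hx
      rw [h6 hx, (hg.hasDerivAt x t).deriv]
      rfl
    have h7 := fracForm_eigenfunction hN hs0 hs1 hΩ hΩb hF (hM t) huk hukk (f t).2 h5 n
    have h8 : (inner ℝ (restr Ω (f t : Ambient N).fst) (toL2 s Ω (φ n)) : ℝ)
        = c ^ 2 * inner ℝ (restr Ω (u t)) (toL2 s Ω (φ n)) + b * ut t (φ n) :=
      congrArg (fun S : NegSobolev s Ω => S (φ n)) h3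
    have h9 : u₃ t (φ n) + α * utt t (φ n) + fracForm s (f t : Ambient N) (φ n : Ambient N) = 0 :=
      h2 ht
    rw [h7, h8] at h9
    linarith
  intro t ht
  exact (hasDerivAt_apply (hd t ht) (φ n)).congr_deriv
    (eqOn_lincomb_of_ae hae (continuousOn_apply hc (φ n)) hcr hcy'' hcy' hcy ht)

/-- Duhamel's formula for the coefficients of a weak solution in an eigenbasis. -/
theorem IsWeakSolution.mode_formula (hN : 0 < N) (hs0 : 0 < s) (hs1 : s < 1) (hΩo : IsOpen Ω)
    (hΩb : Bornology.IsBounded Ω) {φ : ℕ → sobolevZero s Ω} {lam : ℕ → ℝ}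
    (hφ : IsDirichletEigenbasis s Ω φ lam) (hg : IsExteriorData Ω g)
    (hu : IsWeakSolution s Ω α b c T g d₀ d₁ d₂ u ut utt) (n : ℕ) {K K₁ K₂ : ℝ → ℂ}
    (hK : ∀ t, HasDerivAt K (K₁ t) t) (hK₁ : ∀ t, HasDerivAt K₁ (K₂ t) t)
    (hK₂ : ∀ t, HasDerivAt K₂ (-(α * K₂ t + (lam n * b) * K₁ t + (lam n * c ^ 2) * K t)) t)
    (hK0 : K 0 = 0) (hK10 : K₁ 0 = 0) (hK20 : K₂ 0 = 1) {t : ℝ} (ht : t ∈ Icc 0 T) :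
    ((inner ℝ (restr Ω (u t)) (toL2 s Ω (φ n)) : ℝ) : ℂ)
      = (K₂ t + α * K₁ t + (lam n * b) * K t) * (inner ℝ d₀ (toL2 s Ω (φ n)) : ℝ)
        + (K₁ t + α * K t) * (d₁ (φ n) : ℝ) + K t * (d₂ (φ n) : ℝ)
        + ∫ τ in (0 : ℝ)..t, K (t - τ)
          * (inner ℝ (extSource s Ω (mixedData b c g τ)) (toL2 s Ω (φ n)) : ℝ) := by
  have hy : ∀ t ∈ Icc 0 T, HasDerivWithinAt
      (fun τ => (inner ℝ (restr Ω (u τ)) (toL2 s Ω (φ n)) : ℝ)) (ut t (φ n)) (Icc 0 T) t :=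
    fun t ht => hasDerivWithinAt_apply (hu.deriv_one t ht) (φ n)
  have hy' : ∀ t ∈ Icc 0 T, HasDerivWithinAt (fun τ => ut τ (φ n)) (utt t (φ n)) (Icc 0 T) t :=
    fun t ht => hasDerivWithinAt_apply (hu.deriv_two t ht) (φ n)
  have hcr : Continuous fun t =>
      (inner ℝ (extSource s Ω (mixedData b c g t)) (toL2 s Ω (φ n)) : ℝ) :=
    (hg.continuous_extSource_mixedData hN hs0 hs1 hΩo hΩb b c).inner continuous_const
  have hofReal : ∀ {y : ℝ → ℝ}, ContinuousOn y (Icc 0 T) →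
      ContinuousOn (fun t => (y t : ℂ)) (Icc 0 T) := fun h =>
    Complex.continuous_ofReal.comp_continuousOn h
  have key := duhamel_cubic (T := T) hK hK₁ hK₂ hK0 hK10 hK20
    (y := fun t => ((inner ℝ (restr Ω (u t)) (toL2 s Ω (φ n)) : ℝ) : ℂ))
    (y' := fun t => ((ut t (φ n) : ℝ) : ℂ)) (y'' := fun t => ((utt t (φ n) : ℝ) : ℂ))
    (r := fun t => ((inner ℝ (extSource s Ω (mixedData b c g t)) (toL2 s Ω (φ n)) : ℝ) : ℂ))
    (hofReal fun t ht => (hy t ht).continuousWithinAt)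
    (hofReal fun t ht => (hy' t ht).continuousWithinAt)
    (hofReal (continuousOn_apply hu.cont_two (φ n))) (hofReal hcr.continuousOn)
    (fun t ht => ((hy t ⟨ht.1.le, ht.2.le⟩).hasDerivAt (Icc_mem_nhds ht.1 ht.2)).ofReal_comp)
    (fun t ht => ((hy' t ⟨ht.1.le, ht.2.le⟩).hasDerivAt (Icc_mem_nhds ht.1 ht.2)).ofReal_comp)
    (fun t ht => ((hu.hasDerivAt_mode hN hs0 hs1 hΩo hΩb hφ hg n t ht).ofReal_comp).congr_deriv
      (by push_cast; rfl)) ht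
  simp only [hu.init_zero, hu.init_one, hu.init_two] at key
  exact key

end

end NonlocalMGT

/-! ### The series representation -/

/-- The boundary terms vanish at τ = t because C(0) = 0 and at τ = 0 because Q(0) = 0. -/
theorem integral_mul_convolution_by_parts {C C' Q Q' : ℝ → ℂ} (hC : ∀ t, HasDerivAt C (C' t) t)
    (hC' : Continuous C') (hQ : ∀ t, HasDerivAt Q (Q' t) t) (hQ' : Continuous Q') (hC0 : C 0 = 0)
    (hQ0 : Q 0 = 0) (t : ℝ) :
    ∫ τ in (0 : ℝ)..t, Q τ * C' (t - τ) = ∫ τ in (0 : ℝ)..t, C (t - τ) * Q' τ := by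
  have hd : ∀ τ, HasDerivAt (fun τ => C (t - τ)) (-C' (t - τ)) τ := fun τ => by
    have := (hC (t - τ)).scomp τ ((hasDerivAt_id τ).const_sub t)
    exact this.congr_deriv (by simp)
  have h := intervalIntegral.integral_mul_deriv_eq_deriv_mul (a := 0) (b := t) (u := Q) (u' := Q')
    (v := fun τ => C (t - τ)) (v' := fun τ => -C' (t - τ)) (fun τ _ => hQ τ) (fun τ _ => hd τ)
    (hQ'.intervalIntegrable _ _)
    ((hC'.comp (continuous_const.sub continuous_id)).neg.intervalIntegrable _ _)
  simp only [sub_self, hC0, hQ0, mul_zero, zero_mul, zero_sub, mul_neg,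
    intervalIntegral.integral_neg, neg_inj] at h
  rw [h]
  exact intervalIntegral.integral_congr fun τ _ => mul_comm _ _

theorem NonlocalMGT.IsModeSolution.continuous_deriv {α b c lam : ℝ} {y₀ y₁ y₂ : ℂ} {y : ℝ → ℂ}
    (h : IsModeSolution α b c lam y₀ y₁ y₂ y) : Continuous (deriv y) :=
  continuous_iff_continuousAt.mpr fun t => (h.hasDerivAt.2.1 t).continuousAt

/-- A solution of the mode equation in terms of the solution with data `(0, 0, 1)`. -/
theorem NonlocalMGT.IsModeSolution.eq_fundamental {α b c lam : ℝ} {y₀ y₁ y₂ : ℂ} {y C : ℝ → ℂ}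
    (hy : IsModeSolution α b c lam y₀ y₁ y₂ y) (hC : IsModeSolution α b c lam 0 0 1 C) {t : ℝ}
    (ht : 0 ≤ t) : y t = (iteratedDeriv 2 C t + α * deriv C t + (lam * b) * C t) * y₀
      + (deriv C t + α * C t) * y₁ + C t * y₂ := by
  obtain ⟨h1, h2, h3⟩ := hC.hasDerivAt
  obtain ⟨g1, g2, g3⟩ := hy.hasDerivAt
  have hc : ∀ {f f' : ℝ → ℂ}, (∀ t, HasDerivAt f (f' t) t) → ContinuousOn f (Icc 0 t) := fun h τ _ =>
    (h τ).continuousAt.continuousWithinAt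
  have key := duhamel_cubic (T := t) h1 h2 h3 hC.2.2.1 hC.2.2.2.1 hC.2.2.2.2 (r := fun _ => 0)
    (hc g1) (hc g2) (hc g3) continuousOn_const (fun τ _ => g1 τ) (fun τ _ => g2 τ)
    (fun τ _ => (g3 τ).congr_deriv (by ring)) ⟨ht, le_rfl⟩
  simp only [mul_zero, intervalIntegral.integral_zero, add_zero, hy.2.2.1, hy.2.2.2.1,
    hy.2.2.2.2] at key
  exact key

namespace NonlocalMGT

variable {N : ℕ} {s : ℝ} {Ω : Set (E N)} {α b c T : ℝ} {g : E N × ℝ → ℝ}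

/-- The equation for C gives C''' + αC'' = -lam(bC' + c²C): the factor 1/lam cancels, and the sign
cancels against (g, 𝒩_s φ) = -(S g, φ). Integration by parts moves the derivative of bC' to g, which
produces b g_t; it uses g(·,0) = 0. -/
theorem convCoef_eq (hN : 0 < N) (hs0 : 0 < s) (hs1 : s < 1) (hΩo : IsOpen Ω)
    (hΩb : Bornology.IsBounded Ω) (hg : IsExteriorData Ω g) (hg0 : ∀ x, g (x, 0) = 0) {lam : ℝ}
    (hlam : lam ≠ 0) (φ : sobolevZero s Ω) {C : ℝ → ℂ} (hC : IsModeSolution α b c lam 0 0 1 C)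
    (t : ℝ) : convCoef s Ω α g φ lam C t = ∫ τ in (0 : ℝ)..t, C (t - τ)
      * (inner ℝ (extSource s Ω (mixedData b c g τ)) (toL2 s Ω φ) : ℝ) := by
  obtain ⟨M, -, hM⟩ := hg.exists_extBound hΩo
  let Q : ℝ → ℝ := fun τ => inner ℝ (extSource s Ω fun x => g (x, τ)) (toL2 s Ω φ)
  let Q' : ℝ → ℝ := fun τ => inner ℝ (extSource s Ω fun x => timeDeriv g (x, τ)) (toL2 s Ω φ)
  have hQ : ∀ τ, HasDerivAt Q (Q' τ) τ := fun τ => by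
    have := (hg.hasDerivAt_extSource hN hs0 hs1 hΩo hΩb τ).inner ℝ
      (hasDerivAt_const τ (toL2 s Ω φ))
    exact this.congr_deriv (by simp [Q'])
  have hQ' : Continuous Q' :=
    (hg.timeDeriv.continuous_extSource hN hs0 hs1 hΩo hΩb).inner continuous_const
  have hQc : Continuous Q := continuous_iff_continuousAt.mpr fun τ => (hQ τ).continuousAt
  have hpair : ∀ τ, exteriorPairing s Ω g φ τ = -Q τ := fun τ =>
    (hM τ).integral_mul_normalDeriv hN hs0 hs1 hΩo.measurableSet hΩb φ
  have hQ0 : Q 0 = 0 := by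
    rw [← neg_eq_zero, ← hpair]
    simp [exteriorPairing, hg0]
  have hr : ∀ τ, (inner ℝ (extSource s Ω (mixedData b c g τ)) (toL2 s Ω φ) : ℝ)
      = c ^ 2 * Q τ + b * Q' τ := fun τ => by
    rw [hg.extSource_mixedData hN hs0 hs1 hΩo hΩb, inner_add_left, real_inner_smul_left,
      real_inner_smul_left]
  have h3 : ∀ τ, iteratedDeriv 3 C τ + α * iteratedDeriv 2 C τ
      = -(lam * (b * deriv C τ + c ^ 2 * C τ)) := fun τ => by
    linear_combination hC.2.1 τ
  have hl : (lam : ℂ) ≠ 0 := Complex.ofReal_ne_zero.mpr hlam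
  have hCc : Continuous C := hC.1.continuous
  have hsub : Continuous fun τ => t - τ := continuous_const.sub continuous_id
  have hQcc : Continuous fun τ => (Q τ : ℂ) := Complex.continuous_ofReal.comp hQc
  have hQcc' : Continuous fun τ => (Q' τ : ℂ) := Complex.continuous_ofReal.comp hQ'
  have hparts := integral_mul_convolution_by_parts hC.hasDerivAt.1 hC.continuous_deriv
    (fun τ => (hQ τ).ofReal_comp) hQcc' hC.2.2.1 (by rw [hQ0, Complex.ofReal_zero]) t
  have i1 : IntervalIntegrable (fun τ => (c : ℂ) ^ 2 * (C (t - τ) * Q τ)) volume 0 t :=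
    (continuous_const.mul ((hCc.comp hsub).mul hQcc)).intervalIntegrable _ _
  have i2 : IntervalIntegrable (fun τ => (b : ℂ) * (Q τ * deriv C (t - τ))) volume 0 t :=
    (continuous_const.mul (hQcc.mul (hC.continuous_deriv.comp hsub))).intervalIntegrable _ _
  have i3 : IntervalIntegrable (fun τ => (b : ℂ) * (C (t - τ) * Q' τ)) volume 0 t :=
    (continuous_const.mul ((hCc.comp hsub).mul hQcc')).intervalIntegrable _ _
  have e1 : convCoef s Ω α g φ lam C t = ∫ τ in (0 : ℝ)..t,
      ((c : ℂ) ^ 2 * (C (t - τ) * Q τ) + b * (Q τ * deriv C (t - τ))) := by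
    refine intervalIntegral.integral_congr fun τ _ => ?_
    simp only [hpair, h3]
    push_cast
    field_simp
    ring
  have e2 : ∫ τ in (0 : ℝ)..t, C (t - τ)
      * (inner ℝ (extSource s Ω (mixedData b c g τ)) (toL2 s Ω φ) : ℝ) = ∫ τ in (0 : ℝ)..t,
      ((c : ℂ) ^ 2 * (C (t - τ) * Q τ) + b * (C (t - τ) * Q' τ)) := by
    refine intervalIntegral.integral_congr fun τ _ => ?_
    simp only [hr]
    push_cast
    ring
  rw [e1, e2, intervalIntegral.integral_add i1 i2, intervalIntegral.integral_add i1 i3,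
    intervalIntegral.integral_const_mul (b : ℂ), intervalIntegral.integral_const_mul (b : ℂ), hparts]

/-! ### Coefficients and uniqueness of weak solutions -/

variable {u₀ u₁ : sobolevZero s Ω} {u₂ : L2On Ω} {u : ℝ → L2 N} {ut utt : ℝ → NegSobolev s Ω}

theorem IsWeakSolution.mode_eq_coef (hN : 0 < N) (hs0 : 0 < s) (hs1 : s < 1) (hΩo : IsOpen Ω)
    (hΩb : Bornology.IsBounded Ω) {φ : ℕ → sobolevZero s Ω} {lam : ℕ → ℝ}
    (hφ : IsDirichletEigenbasis s Ω φ lam) (hg : IsExteriorData Ω g) (hg0 : ∀ x, g (x, 0) = 0)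
    (hu : IsWeakSolution s Ω α b c T g (toL2 s Ω u₀) (toNeg s Ω (toL2 s Ω u₁)) (toNeg s Ω u₂)
      u ut utt) (n : ℕ) {A B C : ℝ → ℂ} (hABC : IsCoefTriple α b c (lam n) A B C)
    {t : ℝ} (ht : t ∈ Icc 0 T) :
    ((inner ℝ (restr Ω (u t)) (toL2 s Ω (φ n)) : ℝ) : ℂ)
      = A t * (inner ℝ (toL2 s Ω u₀) (toL2 s Ω (φ n)) : ℝ)
        + B t * (inner ℝ (toL2 s Ω u₁) (toL2 s Ω (φ n)) : ℝ)
        + C t * (inner ℝ u₂ (toL2 s Ω (φ n)) : ℝ)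
        + convCoef s Ω α g (φ n) (lam n) C t := by
  obtain ⟨hA, hB, hC⟩ := hABC.isModeSolution
  obtain ⟨h1, h2, h3⟩ := hC.hasDerivAt
  have hlam := (hφ.formEigenbasis hN hs0 hs1 hΩo.measurableSet hΩb).lam_pos n
  have key := hu.mode_formula hN hs0 hs1 hΩo hΩb hφ hg n h1 h2 h3 hC.2.2.1 hC.2.2.2.1 hC.2.2.2.2 ht
  rw [← convCoef_eq hN hs0 hs1 hΩo hΩb hg hg0 hlam.ne' (φ n) hC t, toNeg_apply, toNeg_apply] at key
  have hAt := hA.eq_fundamental hC ht.1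
  have hBt := hB.eq_fundamental hC ht.1
  simp only [mul_one, mul_zero, add_zero, zero_add] at hAt hBt
  rw [← hAt, ← hBt] at key
  exact key

/-- Duhamel's formula expresses every coefficient through the data alone. Any kernel with initial
values (0,0,1) will do, so the characteristic roots play no role. -/
theorem IsWeakSolution.restr_eq (hN : 0 < N) (hs0 : 0 < s) (hs1 : s < 1) (hΩo : IsOpen Ω)
    (hΩb : Bornology.IsBounded Ω) {φ : ℕ → sobolevZero s Ω} {lam : ℕ → ℝ}
    (hφ : IsDirichletEigenbasis s Ω φ lam) (hg : IsExteriorData Ω g) {d₀ : L2On Ω}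
    {d₁ d₂ : NegSobolev s Ω} (hu : IsWeakSolution s Ω α b c T g d₀ d₁ d₂ u ut utt) {v : ℝ → L2 N}
    {vt vtt : ℝ → NegSobolev s Ω} (hv : IsWeakSolution s Ω α b c T g d₀ d₁ d₂ v vt vtt) {t : ℝ}
    (ht : t ∈ Icc 0 T) : restr Ω (v t) = restr Ω (u t) := by
  refine (hφ.formEigenbasis hN hs0 hs1 hΩo.measurableSet hΩb).ext_right fun n => ?_
  obtain ⟨y, y', y'', hy, hy', hy'', hy0, hy'0, hy''0⟩ :=
    exists_cubic_mode α b c (lam n) 0 0 1 (r := fun _ => 0) continuous_const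
  have h := fun {x : ℝ → L2 N} {xt xtt : ℝ → NegSobolev s Ω}
      (hx : IsWeakSolution s Ω α b c T g d₀ d₁ d₂ x xt xtt) =>
    hx.mode_formula hN hs0 hs1 hΩo hΩb hφ hg n (fun t => (hy t).ofReal_comp)
      (fun t => (hy' t).ofReal_comp)
      (fun t => (hy'' t).ofReal_comp.congr_deriv (by push_cast; ring)) (by rw [hy0, Complex.ofReal_zero])
      (by rw [hy'0, Complex.ofReal_zero]) (by rw [hy''0, Complex.ofReal_one]) ht
  exact Complex.ofReal_injective ((h hv).trans (h hu).symm)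

theorem hasDerivWithinAt_unique {f h : ℝ → NegSobolev s Ω} {f' h' : NegSobolev s Ω} (hT : 0 < T)
    (hf : ∀ t ∈ Icc 0 T, f t = h t) {t : ℝ} (ht : t ∈ Icc 0 T)
    (h1 : HasDerivWithinAt f f' (Icc 0 T) t) (h2 : HasDerivWithinAt h h' (Icc 0 T) t) : f' = h' :=
  (uniqueDiffOn_Icc hT t ht).eq_deriv _ (HasDerivWithinAt.congr h1 (fun τ hτ => (hf τ hτ).symm)
    (hf t ht).symm) h2

theorem eq_of_restr_eq (hΩ : MeasurableSet Ω) {k : E N → ℝ} {x y : L2 N}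
    (h : restr Ω x = restr Ω y) (hx : ∀ᵐ z, z ∉ Ω → x z = k z) (hy : ∀ᵐ z, z ∉ Ω → y z = k z) :
    x = y := by
  have h1 : ∀ᵐ z ∂(volume.restrict Ω), x z = y z := by
    filter_upwards [restr_coeFn (Ω := Ω) x, restr_coeFn (Ω := Ω) y] with z h2 h3
    rw [← h2, h, h3]
  refine Lp.ext ?_
  filter_upwards [(ae_restrict_iff' hΩ).mp h1, hx, hy] with z h2 h3 h4
  by_cases hz : z ∈ Ω
  · exact h2 hz
  · rw [h3 hz, h4 hz]

/-- Equality on Ω passes to the time derivatives by uniqueness of derivatives within [0,T]. The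
exterior condition is imposed only on (0,T), so at the end points u is determined in Ω only. -/
theorem IsWeakSolution.unique (hN : 0 < N) (hs0 : 0 < s) (hs1 : s < 1) (hΩo : IsOpen Ω)
    (hΩb : Bornology.IsBounded Ω) (hT : 0 < T) {φ : ℕ → sobolevZero s Ω} {lam : ℕ → ℝ}
    (hφ : IsDirichletEigenbasis s Ω φ lam) (hg : IsExteriorData Ω g) {d₀ : L2On Ω}
    {d₁ d₂ : NegSobolev s Ω} (hu : IsWeakSolution s Ω α b c T g d₀ d₁ d₂ u ut utt) {v : ℝ → L2 N}
    {vt vtt : ℝ → NegSobolev s Ω} (hv : IsWeakSolution s Ω α b c T g d₀ d₁ d₂ v vt vtt) :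
    (∀ t ∈ Icc 0 T, restr Ω (v t) = restr Ω (u t) ∧ vt t = ut t ∧ vtt t = utt t) ∧
      ∀ t ∈ Ioo 0 T, v t = u t := by
  have h0 : ∀ t ∈ Icc 0 T, restr Ω (v t) = restr Ω (u t) := fun t ht =>
    hu.restr_eq hN hs0 hs1 hΩo hΩb hφ hg hv ht
  have h1 : ∀ t ∈ Icc 0 T, vt t = ut t := fun t ht =>
    hasDerivWithinAt_unique hT (fun τ hτ => congrArg (toNeg s Ω) (h0 τ hτ)) ht
      (hv.deriv_one t ht) (hu.deriv_one t ht)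
  have h2 : ∀ t ∈ Icc 0 T, vtt t = utt t := fun t ht =>
    hasDerivWithinAt_unique hT h1 ht (hv.deriv_two t ht) (hu.deriv_two t ht)
  exact ⟨fun t ht => ⟨h0 t ht, h1 t ht, h2 t ht⟩, fun t ht =>
    eq_of_restr_eq hΩo.measurableSet (h0 t ⟨ht.1.le, ht.2.le⟩) (hv.exterior t ht)
      (hu.exterior t ht)⟩

theorem isExteriorData_of_tsupport_subset (hg : ContDiff ℝ ∞ g) (hgc : HasCompactSupport g)
    (hgs : tsupport g ⊆ Ωᶜ ×ˢ Ioo 0 T) : IsExteriorData Ω g where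
  smooth := hg
  compact := hgc
  vanish _ hy _ := image_eq_zero_of_notMem_tsupport fun h => (hgs h).1 hy

theorem isExteriorData_zero : IsExteriorData Ω (0 : E N × ℝ → ℝ) where
  smooth := contDiff_const
  compact := HasCompactSupport.zero
  vanish _ _ _ := rfl

theorem convCoef_zero (φ : sobolevZero s Ω) (lam : ℝ) (C : ℝ → ℂ) (t : ℝ) :
    convCoef s Ω α (0 : E N × ℝ → ℝ) φ lam C t = 0 := by
  simp [convCoef, exteriorPairing]

end NonlocalMGT

/-! ### The main theorem -/

theorem mainTheorem5 (N : ℕ) (hN : 0 < N) (s : ℝ) (hs0 : 0 < s) (hs1 : s < 1)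
    (Ω : Set (E N)) (hΩo : IsOpen Ω) (hΩb : Bornology.IsBounded Ω) (hΩn : Ω.Nonempty)
    (α b c T : ℝ) (hb : 0 < b) (hT : 0 < T)
    (u₀ u₁ : sobolevZero s Ω) (u₂ : L2On Ω)
    (g : E N × ℝ → ℝ) (hg : ContDiff ℝ ∞ g) (hgc : HasCompactSupport g)
    (hgs : tsupport g ⊆ Ωᶜ ×ˢ Ioo 0 T) :
    (∃ φ lam, IsDirichletEigenbasis s Ω φ lam) ∧
    ∃ (u : ℝ → L2 N) (ut utt : ℝ → NegSobolev s Ω),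
      IsWeakSolution s Ω α b c T g (toL2 s Ω u₀) (toNeg s Ω (toL2 s Ω u₁)) (toNeg s Ω u₂)
        u ut utt ∧
      (∀ (v : ℝ → L2 N) (vt vtt : ℝ → NegSobolev s Ω),
        IsWeakSolution s Ω α b c T g (toL2 s Ω u₀) (toNeg s Ω (toL2 s Ω u₁)) (toNeg s Ω u₂)
          v vt vtt →
        (∀ t ∈ Icc 0 T, restr Ω (v t) = restr Ω (u t) ∧ vt t = ut t ∧ vtt t = utt t) ∧
        ∀ t ∈ Ioo 0 T, v t = u t) ∧
      ∀ (φ : ℕ → sobolevZero s Ω) (lam : ℕ → ℝ), IsDirichletEigenbasis s Ω φ lam →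
        ∀ A B C : ℕ → ℝ → ℂ, (∀ n, IsCoefTriple α b c (lam n) (A n) (B n) (C n)) →
          ∀ t ∈ Icc 0 T, ∃ w v : L2On Ω, restr Ω (u t) = w + v ∧
            IsL2Series s Ω φ (fun n =>
              A n t * (inner ℝ (toL2 s Ω u₀) (toL2 s Ω (φ n)) : ℝ)
                + B n t * (inner ℝ (toL2 s Ω u₁) (toL2 s Ω (φ n)) : ℝ)
                + C n t * (inner ℝ u₂ (toL2 s Ω (φ n)) : ℝ)) w ∧
            IsL2Series s Ω φ (fun n => convCoef s Ω α g (φ n) (lam n) (C n) t) v := by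
  have hG : IsExteriorData Ω g := isExteriorData_of_tsupport_subset hg hgc hgs
  have hg0 : ∀ x, g (x, 0) = 0 := fun x =>
    image_eq_zero_of_notMem_tsupport fun h => lt_irrefl _ (hgs h).2.1
  have hΦ := exists_isDirichletEigenbasis hN hs0 hs1 hΩo hΩb hΩn
  obtain ⟨u, ut, utt, hu⟩ :=
    exists_isWeakSolution hN hs0 hs1 hΩo hΩb hΩn α c hb hT u₀ u₁ u₂ hG
  -- The weak solution with the same initial data and g = 0 is the sum of the first series, hence
  -- that series converges. The second series is the expansion of the difference of the two
  -- solutions.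
  obtain ⟨w, wt, wtt, hw⟩ :=
    exists_isWeakSolution hN hs0 hs1 hΩo hΩb hΩn α c hb hT u₀ u₁ u₂ isExteriorData_zero
  refine ⟨hΦ, u, ut, utt, hu, fun v vt vtt hv => ?_, fun φ lam hφ A B C hABC t ht => ?_⟩
  · obtain ⟨φ, lam, hφ⟩ := hΦ
    exact hu.unique hN hs0 hs1 hΩo hΩb hT hφ hG hv
  · have hcw : ∀ n, A n t * (inner ℝ (toL2 s Ω u₀) (toL2 s Ω (φ n)) : ℝ)
        + B n t * (inner ℝ (toL2 s Ω u₁) (toL2 s Ω (φ n)) : ℝ)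
        + C n t * (inner ℝ u₂ (toL2 s Ω (φ n)) : ℝ)
        = ((inner ℝ (restr Ω (w t)) (toL2 s Ω (φ n)) : ℝ) : ℂ) := fun n => by
      rw [hw.mode_eq_coef hN hs0 hs1 hΩo hΩb hφ isExteriorData_zero (fun _ => rfl) n (hABC n) ht,
        convCoef_zero, add_zero]
    refine ⟨restr Ω (w t), restr Ω (u t) - restr Ω (w t), (add_sub_cancel _ _).symm,
      isL2Series_inner hφ hcw, isL2Series_inner hφ fun n => ?_⟩
    rw [inner_sub_left, Complex.ofReal_sub, ← hcw n,
      hu.mode_eq_coef hN hs0 hs1 hΩo hΩb hφ hG hg0 n (hABC n) ht, add_sub_cancel_left]
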